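/- Let $n\ge 4$, let $M$ be an $n$-dimensional real-analytic manifold with a real-analytic pseudo-Riemannian metric $g_{ab}$ of arbitrary signature. A semicolon (or $\nabla$) denotes the Levi-Civita covariant derivative, square brackets denote antisymmetrization normalized by $1/k!$ (indices between vertical bars are excluded), and $\nabla^2=g^{ef}\nabla_e\nabla_f$. The curvature convention is $v_{a;bc}-v_{a;cb}=R^d{}_{abc}v_d$, $R_{ab}=R^c{}_{acb}$. A *Weyl candidate* is a tensor $X_{abcd}=X_{[ab]cd}=X_{ab[cd]}$ with $X_{a[bcd]}=0$ and $X^a{}_{bca}=0$. For a Weyl candidate field $X$ put $$\{R\otimes X\}_{abcd}=2\left(R^e{}_{dm[a}X^m{}_{b]ec}-R^e{}_{cm[a}X^m{}_{b]ed}\right)+R_{m[c}X^m{}_{d]ab}+R_{m[a}X^m{}_{b]cd}-\tfrac12\left(R_{cdem}X_{ab}{}^{em}+R_{abem}X_{cd}{}^{em}\right).$$ **Theorem.** Let $W_{abcd}$ be a real-analytic Weyl candidate field on $M$. Then every point of $M$ has an open neighbourhood $U$ (contained in any prescribed analytic coordinate domain around that point) on which there are a real-analytic double $(2,3)$-form $P_{abcde}=P_{[ab][cde]}$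 and a real-analytic Weyl candidate field $X_{abcd}$ (a superpotential) such that, on $U$, $$P_{a[bcde]}=0,\qquad P^{ab}{}_{abc}=0,$$ $$W_{abcd}=P_{abcdi}{}^{;i}+P_{cdabi}{}^{;i}-2P^{i}{}_{[c|abi|;d]}-2P^{i}{}_{[a|cdi|;b]},$$ $$P_{abcde}=\tfrac32\,X_{ab[cd;e]},$$ $$\nabla^2X_{abcd}-\{R\otimes X\}_{abcd}=W_{abcd}.$$ -/

import Mathlib

open scoped Manifold ContDiff Topology

noncomputable section

namespace WeylPotential

/-! ### Pointwise algebra -/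

/-- Antisymmetrization `T_{[a₁ … a_k]}`, with the factor `1 / k!`. -/
def antisymmetrize {ι : Type*} {k : ℕ} (T : (Fin k → ι) → ℝ) (v : Fin k → ι) : ℝ :=
  ((k.factorial : ℕ) : ℝ)⁻¹ *
    ∑ σ : Equiv.Perm (Fin k), ((Equiv.Perm.sign σ : ℤ) : ℝ) * T (fun i => v (σ i))

section Algebra

variable {V : Type*} [AddCommGroup V] [Module ℝ V] {n : ℕ}

/-- The inverse `g^{ij}` of the Gram matrix of a bilinear form `g` in a basis `b`. -/
def invGram (g : MultilinearMap ℝ (fun _ : Fin 2 => V) ℝ)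
    (b : Module.Basis (Fin n) ℝ V) : Matrix (Fin n) (Fin n) ℝ :=
  (Matrix.of fun i j => g ![b i, b j])⁻¹

/-- A nondegenerate symmetric bilinear form (of any signature). -/
structure IsScalarProduct (g : MultilinearMap ℝ (fun _ : Fin 2 => V) ℝ) : Prop where
  symm : ∀ u v, g ![u, v] = g ![v, u]
  nondegenerate : ∀ u, (∀ v, g ![u, v] = 0) → u = 0

/-- `X_{abcd} = X_{[ab]cd} = X_{ab[cd]}`, `X_{a[bcd]} = 0` and `X^a_{bca} = 0`, on an
`n`-dimensional space `V` with scalar product `g`. -/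
structure IsWeylCandidate (n : ℕ) (g : MultilinearMap ℝ (fun _ : Fin 2 => V) ℝ)
    (X : MultilinearMap ℝ (fun _ : Fin 4 => V) ℝ) : Prop where
  skew_left : ∀ u v w z, X ![v, u, w, z] = -X ![u, v, w, z]
  skew_right : ∀ u v w z, X ![u, v, z, w] = -X ![u, v, w, z]
  cyclic : ∀ u v w z,
    antisymmetrize (fun t : Fin 3 → V => X ![u, t 0, t 1, t 2]) ![v, w, z] = 0
  trace_eq_zero : ∀ (b : Module.Basis (Fin n) ℝ V) (v w : V),
    ∑ i, ∑ j, invGram g b i j * X ![b i, v, w, b j] = 0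

/-- A double `(2,3)`-form: `P_{abcde} = P_{[ab][cde]}`. -/
structure IsDoubleTwoThreeForm (P : MultilinearMap ℝ (fun _ : Fin 5 => V) ℝ) : Prop where
  skew_two : ∀ u v x y z, P ![v, u, x, y, z] = -P ![u, v, x, y, z]
  skew_three_left : ∀ u v x y z, P ![u, v, y, x, z] = -P ![u, v, x, y, z]
  skew_three_right : ∀ u v x y z, P ![u, v, x, z, y] = -P ![u, v, x, y, z]

/-- A double `(2,3)`-form with `P_{a[bcde]} = 0` and `P^{ab}_{abc} = 0`. -/
structure IsWeylPotentialForm (n : ℕ) (g : MultilinearMap ℝ (fun _ : Fin 2 => V) ℝ)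
    (P : MultilinearMap ℝ (fun _ : Fin 5 => V) ℝ) : Prop where
  isDoubleForm : IsDoubleTwoThreeForm P
  cyclic : ∀ u v x y z,
    antisymmetrize (fun t : Fin 4 → V => P ![u, t 0, t 1, t 2, t 3]) ![v, x, y, z] = 0
  trace_eq_zero : ∀ (b : Module.Basis (Fin n) ℝ V) (v : V),
    ∑ i, ∑ j, ∑ k, ∑ l,
      invGram g b i k * invGram g b j l * P ![b i, b j, b k, b l, v] = 0

end Algebra

/-! ### Tensor calculus in coordinates

All indices are lowered; `![a, b, …]` lists them in order, and the index of a covariant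
derivative is put last, so that `covDeriv G T y ![a, b, c]` is `T_{ab;c}` at `y`. -/

/-- Components of a covariant tensor field of rank `k` as functions of `n` coordinates. -/
abbrev Components (n k : ℕ) : Type := EuclideanSpace ℝ (Fin n) → (Fin k → Fin n) → ℝ

section Coordinates

variable {n k : ℕ}

/-- The partial derivative `∂_i f` at `y`. -/
def partialDeriv (i : Fin n) (f : EuclideanSpace ℝ (Fin n) → ℝ)
    (y : EuclideanSpace ℝ (Fin n)) : ℝ :=
  fderiv ℝ f y (EuclideanSpace.single i 1)

/-- The inverse metric `g^{ij}` at `y`. -/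
def invMetric (G : Components n 2) (y : EuclideanSpace ℝ (Fin n)) :
    Matrix (Fin n) (Fin n) ℝ :=
  (Matrix.of fun i j => G y ![i, j])⁻¹

/-- The Christoffel symbol `Γ^m_{ij}` of the Levi-Civita connection at `y`. -/
def christoffel (G : Components n 2) (m i j : Fin n) (y : EuclideanSpace ℝ (Fin n)) : ℝ :=
  (1 / 2) * ∑ l, invMetric G y m l *
    (partialDeriv i (fun x => G x ![j, l]) y + partialDeriv j (fun x => G x ![i, l]) y
      - partialDeriv l (fun x => G x ![i, j]) y)

/-- The covariant derivative `T_{a₁…a_k;e} = ∂_e T_{a₁…a_k} - ∑_s Γ^m_{e a_s} T_{a₁…m…a_k}`. -/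
def covDeriv (G : Components n 2) (T : Components n k) : Components n (k + 1) :=
  fun y v =>
    partialDeriv (v (Fin.last k)) (fun x => T x (fun s => v s.castSucc)) y
      - ∑ s : Fin k, ∑ m : Fin n, christoffel G m (v (Fin.last k)) (v s.castSucc) y *
          T y (Function.update (fun r : Fin k => v r.castSucc) s m)

/-- The curvature `R^d_{abc}`, in the convention `v_{a;bc} - v_{a;cb} = R^d_{abc} v_d`. -/
def riemannUp (G : Components n 2) (d a b c : Fin n) (y : EuclideanSpace ℝ (Fin n)) : ℝ :=
  partialDeriv b (christoffel G d a c) y - partialDeriv c (christoffel G d a b) y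
    + ∑ m, (christoffel G d m b y * christoffel G m a c y
      - christoffel G d m c y * christoffel G m a b y)

/-- The curvature with its first index lowered, `R_{dabc} = g_{dm} R^m_{abc}`. -/
def riemannDown (G : Components n 2) (d a b c : Fin n) (y : EuclideanSpace ℝ (Fin n)) : ℝ :=
  ∑ m, G y ![d, m] * riemannUp G m a b c y

/-- The Ricci tensor `R_{ab} = R^c_{acb}`. -/
def ricci (G : Components n 2) (a b : Fin n) (y : EuclideanSpace ℝ (Fin n)) : ℝ :=
  ∑ c, riemannUp G c a c b y

/-- `X^m_{bcd}`. -/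
def raiseFirst (G : Components n 2) (X : Components n 4) (m b c d : Fin n)
    (y : EuclideanSpace ℝ (Fin n)) : ℝ :=
  ∑ r, invMetric G y m r * X y ![r, b, c, d]

/-- `X_{ab}^{em}`. -/
def raiseLastTwo (G : Components n 2) (X : Components n 4) (a b e m : Fin n)
    (y : EuclideanSpace ℝ (Fin n)) : ℝ :=
  ∑ r, ∑ s, invMetric G y e r * invMetric G y m s * X y ![a, b, r, s]

/-- `∇² X_{abcd} = X_{abcd;e}^e`. -/
def laplacian (G : Components n 2) (X : Components n 4) : Components n 4 :=
  fun y v => ∑ e, ∑ f, invMetric G y e f *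
    covDeriv G (covDeriv G X) y ![v 0, v 1, v 2, v 3, e, f]

/-- The terms linear in the curvature, `{R ⊗ X}_{abcd}`, namely
`2 (R^e_{dm[a} X^m_{b]ec} - R^e_{cm[a} X^m_{b]ed}) + R_{m[c} X^m_{d]ab} + R_{m[a} X^m_{b]cd}`
`- (1/2) (R_{cdem} X_{ab}^{em} + R_{abem} X_{cd}^{em})`. -/
def curvatureTerm (G : Components n 2) (X : Components n 4) (a b c d : Fin n)
    (y : EuclideanSpace ℝ (Fin n)) : ℝ :=
  2 * (antisymmetrize (fun t : Fin 2 → Fin n => ∑ e, ∑ m,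
          riemannUp G e d m (t 0) y * raiseFirst G X m (t 1) e c y) ![a, b]
      - antisymmetrize (fun t : Fin 2 → Fin n => ∑ e, ∑ m,
          riemannUp G e c m (t 0) y * raiseFirst G X m (t 1) e d y) ![a, b])
    + antisymmetrize (fun t : Fin 2 → Fin n => ∑ m,
        ricci G m (t 0) y * raiseFirst G X m (t 1) a b y) ![c, d]
    + antisymmetrize (fun t : Fin 2 → Fin n => ∑ m,
        ricci G m (t 0) y * raiseFirst G X m (t 1) c d y) ![a, b]
    - (1 / 2) * ∑ e, ∑ m, (riemannDown G c d e m y * raiseLastTwo G X a b e m y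
        + riemannDown G a b e m y * raiseLastTwo G X c d e m y)

/-- `P_{abcdi}^{;i} + P_{cdabi}^{;i} - 2 P_{i[c|ab|}^i_{;d]} - 2 P^i_{[a|cdi|;b]}`. -/
def weylOfPotential (G : Components n 2) (P : Components n 5) (a b c d : Fin n)
    (y : EuclideanSpace ℝ (Fin n)) : ℝ :=
  ∑ i, ∑ j, invMetric G y i j * covDeriv G P y ![a, b, c, d, i, j]
    + ∑ i, ∑ j, invMetric G y i j * covDeriv G P y ![c, d, a, b, i, j]
    - 2 * antisymmetrize (fun t : Fin 2 → Fin n => ∑ i, ∑ j,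
        invMetric G y i j * covDeriv G P y ![i, t 0, a, b, j, t 1]) ![c, d]
    - 2 * antisymmetrize (fun t : Fin 2 → Fin n => ∑ i, ∑ j,
        invMetric G y i j * covDeriv G P y ![i, t 0, c, d, j, t 1]) ![a, b]

/-- `(3/2) X_{ab[cd;e]}`. -/
def potentialOfSuperpotential (G : Components n 2) (X : Components n 4)
    (a b c d e : Fin n) (y : EuclideanSpace ℝ (Fin n)) : ℝ :=
  (3 / 2) * antisymmetrize (fun t : Fin 3 → Fin n =>
    covDeriv G X y ![a, b, t 0, t 1, t 2]) ![c, d, e]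

end Coordinates

/-! ### Tensor fields on an analytic manifold -/

section Manifold

variable {n k : ℕ} {M : Type*} [TopologicalSpace M]
  [ChartedSpace (EuclideanSpace ℝ (Fin n)) M]

/-- A (not necessarily continuous) covariant tensor field of rank `k` on `M`. -/
abbrev TensorField (n : ℕ) (M : Type*) [TopologicalSpace M]
    [ChartedSpace (EuclideanSpace ℝ (Fin n)) M] (k : ℕ) : Type _ :=
  ∀ p : M, MultilinearMap ℝ (fun _ : Fin k => TangentSpace (𝓡 n) p) ℝ

/-- The coordinate vector `∂_i` of the chart `e` at the point with coordinates `y`. -/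
def coordVector (e : OpenPartialHomeomorph M (EuclideanSpace ℝ (Fin n)))
    (y : EuclideanSpace ℝ (Fin n)) (i : Fin n) : TangentSpace (𝓡 n) (e.symm y) :=
  mfderiv (𝓡 n) (𝓡 n) e.symm y (EuclideanSpace.single i (1 : ℝ))

/-- The components `T(∂_{a₁}, …, ∂_{a_k})` in the chart `e`, as functions of the coordinates
(meaningful on `e.target`). -/
def components (e : OpenPartialHomeomorph M (EuclideanSpace ℝ (Fin n)))
    (T : TensorField n M k) : Components n k :=
  fun y v => T (e.symm y) (fun s => coordVector e y (v s))

/-- The components of `T` in the chart `e` are real analytic on (the image of) `U`. -/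
def AnalyticInChart (e : OpenPartialHomeomorph M (EuclideanSpace ℝ (Fin n)))
    (T : TensorField n M k) (U : Set M) : Prop :=
  ∀ v : Fin k → Fin n,
    AnalyticOnNhd ℝ (fun y => components e T y v) (e.target ∩ e.symm ⁻¹' U)

/-- A real analytic tensor field: analytic components in all charts of the analytic structure. -/
def IsAnalyticTensorField (T : TensorField n M k) : Prop :=
  ∀ e ∈ IsManifold.maximalAtlas (𝓡 n) ω M, AnalyticInChart e T Set.univ

/-- An analytic pseudo-Riemannian metric of arbitrary signature. -/
structure IsAnalyticPseudoRiemannianMetric (g : TensorField n M 2) : Prop where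
  isScalarProduct : ∀ p, IsScalarProduct (g p)
  analytic : IsAnalyticTensorField g

end Manifold

end WeylPotential

end

/-! Once P is defined as (3/2) X_{ab[cd;e]}, its algebraic symmetries follow from those of X and
from the fact that the covariant derivative of a Weyl candidate is again a Weyl candidate in its
first four slots (`isPotentialArray_potentialArray`). Inserting this P into the expression for W,
tracelessness of X removes most terms. What is left is ∇²X plus differences of second covariant
derivatives taken in opposite orders, which the Ricci identity turns into curvature
(`weylOfPotential_eq`). For Weyl candidates this curvature is exactly {R⊗X} (`curvatureTerm_eq`), so
the whole theorem reduces to solving ∇²X = {R⊗X} + W locally with X a Weyl candidate.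

The algebraic constraint on X is met by projection, not by choosing initial data that propagate it.
The pointwise projection π onto Weyl candidates is built from g, its inverse and slot permutations,
hence commutes with ∇ (`IsParallel.of_weylProj`). The equation ∇²Y = R(πY) + W is solved for an
unconstrained array Y (`IsMetricOn.exists_solution`), where R is the operator `curvOp`. This
operator maps Weyl candidates to Weyl candidates, because each curvature endomorphism is an
infinitesimal isometry. Applying π to the equation therefore shows that X = πY satisfies ∇²X = R(X)
+ W (`IsMetricOn.exists_superpotential`).

The unconstrained equation is a linear second order analytic system with scalar principal part
g^{ij}∂_i∂_j. Instead of adapted coordinates, one nonzero entry g^{st} of the inverse metric at the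
point is used, a diagonal one if there is any. The system then reads ∂_s∂_t u + (remainder) = F, and
the ansatz u = ∫_s∫_t h makes it h + Kh = F. In the weighted norm with weights γ!/|γ|! r^γ, an
integration in x_s followed by a derivative in x_j costs at most r_s/r_j, uniformly in the degree.
With r_s and r_t much smaller than the other radii, and all radii small, K is a contraction and a
Neumann series gives h (`exists_small_weights`, `exists_formal_solution`). The signature of g plays
no role.

The argument is carried out on component arrays in a chart. Basis independence of traces and
multilinearity translate between arrays and tensor fields. -/

noncomputable section

namespace WeylPotential

/-! ### A weighted norm on multivariate power series -/

section PowerSeries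

open MvPowerSeries
open scoped ENNReal Nat

variable {n : ℕ}

/-- The weight `γ! / |γ|! * r ^ γ`. -/
def weight (r : Fin n → ℝ) (γ : Fin n →₀ ℕ) : ℝ :=
  (∏ i, ((γ i)! : ℝ) * r i ^ γ i) / (γ.degree)!

/-- The weighted norm `∑ |a_γ| * (|γ|)_k * γ! / |γ|! * r ^ γ`, where `(d)_k` is the falling
factorial. -/
def weightedNorm (r : Fin n → ℝ) (k : ℕ) (a : MvPowerSeries (Fin n) ℝ) : ℝ≥0∞ :=
  ∑' γ, ENNReal.ofReal (|coeff γ a| * ((γ.degree.descFactorial k : ℕ) : ℝ) * weight r γ)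

/-- The antiderivative of a power series in the variable `s`, vanishing for `x_s = 0`. -/
def antideriv (s : Fin n) (a : MvPowerSeries (Fin n) ℝ) : MvPowerSeries (Fin n) ℝ :=
  fun γ => if γ s = 0 then 0 else coeff (γ - Finsupp.single s 1) a / (γ s : ℝ)

lemma coeff_antideriv (s : Fin n) (a : MvPowerSeries (Fin n) ℝ) (γ : Fin n →₀ ℕ) :
    coeff γ (antideriv s a) =
      if γ s = 0 then 0 else coeff (γ - Finsupp.single s 1) a / (γ s : ℝ) := rfl

lemma coeff_add_single_antideriv (s : Fin n) (a : MvPowerSeries (Fin n) ℝ) (γ : Fin n →₀ ℕ) :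
    coeff (γ + Finsupp.single s 1) (antideriv s a) = coeff γ a / (γ s + 1) := by
  rw [coeff_antideriv]
  simp

lemma pderiv_antideriv (s : Fin n) (a : MvPowerSeries (Fin n) ℝ) :
    pderiv ℝ s (antideriv s a) = a := by
  ext γ
  rw [coeff_pderiv, coeff_add_single_antideriv]
  field_simp

lemma pderiv_comm (i j : Fin n) (a : MvPowerSeries (Fin n) ℝ) :
    pderiv ℝ i (pderiv ℝ j a) = pderiv ℝ j (pderiv ℝ i a) := by
  ext γ
  simp only [coeff_pderiv]
  rw [add_right_comm]
  by_cases h : i = j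
  · subst h; rfl
  · simp [h, Ne.symm h]
    ring

lemma weight_nonneg {r : Fin n → ℝ} (hr : ∀ i, 0 < r i) (γ : Fin n →₀ ℕ) : 0 ≤ weight r γ :=
  div_nonneg (Finset.prod_nonneg fun i _ => mul_nonneg (by positivity) (pow_nonneg (hr i).le _))
    (by positivity)

/-- This one-step ratio is the reason for the factor γ!/|γ|!: the factor γ_s + 1 cancels the one
produced by differentiation or integration, and |γ| + 1 is absorbed by the falling factorial. -/
lemma weight_add_single (r : Fin n → ℝ) (γ : Fin n →₀ ℕ) (s : Fin n) :
    weight r (γ + Finsupp.single s 1) * (γ.degree + 1) = weight r γ * (γ s + 1) * r s := by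
  have h1 : (γ + Finsupp.single s 1).degree = γ.degree + 1 := by simp
  have h2 : (∏ i, (((γ + Finsupp.single s 1 : Fin n →₀ ℕ) i)! : ℝ) *
        r i ^ (γ + Finsupp.single s 1 : Fin n →₀ ℕ) i)
      = (∏ i, ((γ i)! : ℝ) * r i ^ γ i) * ((γ s + 1) * r s) := by
    rw [← Finset.mul_prod_erase _ _ (Finset.mem_univ s),
      ← Finset.mul_prod_erase Finset.univ (fun i => ((γ i)! : ℝ) * r i ^ γ i) (Finset.mem_univ s)]
    have : ∏ i ∈ Finset.univ.erase s,
        (((γ + Finsupp.single s 1 : Fin n →₀ ℕ) i)! : ℝ) *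
          r i ^ (γ + Finsupp.single s 1 : Fin n →₀ ℕ) i
        = ∏ i ∈ Finset.univ.erase s, ((γ i)! : ℝ) * r i ^ γ i := by
      refine Finset.prod_congr rfl fun i hi => ?_
      have : s ≠ i := (Finset.ne_of_mem_erase hi).symm
      simp [this]
    rw [this]
    simp [Nat.factorial_succ, pow_succ]
    ring
  unfold weight
  rw [h1, h2, Nat.factorial_succ]
  have : ((γ.degree)! : ℝ) ≠ 0 := by positivity
  push_cast
  field_simp

/-- Dividing by factorials, this says that the product of the binomials C(p_i + q_i, q_i) is at most
C(∑p + ∑q, ∑q). -/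
lemma factorial_prod_le {ι : Type*} (s : Finset ι) (p q : ι → ℕ) :
    (∏ i ∈ s, (p i + q i)!) * ((∑ i ∈ s, p i)! * (∑ i ∈ s, q i)!) ≤
      (∏ i ∈ s, (p i)!) * (∏ i ∈ s, (q i)!) * (∑ i ∈ s, (p i + q i))! := by
  classical
  induction s using Finset.induction_on with
  | empty => simp
  | insert i s hi ih =>
    simp only [Finset.prod_insert hi, Finset.sum_insert hi]
    set P := ∑ i ∈ s, p i
    set Q := ∑ i ∈ s, q i
    rw [Finset.sum_add_distrib] at ih ⊢
    change _ * (P ! * Q !) ≤ _ * (P + Q)! at ih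
    change _ ≤ _ * (p i + q i + (P + Q))!
    have h1 := Nat.add_choose_mul_factorial_mul_factorial (p i) (q i)
    have h2 := Nat.add_choose_mul_factorial_mul_factorial P Q
    have h3 := Nat.add_choose_mul_factorial_mul_factorial (p i + P) (q i + Q)
    -- One summand of the Vandermonde convolution is bounded by the whole sum.
    have h5 : (p i + q i).choose (q i) * (P + Q).choose Q ≤
        (p i + q i + (P + Q)).choose (q i + Q) := by
      rw [Nat.add_choose_eq (p i + q i) (P + Q)]
      exact Finset.single_le_sum (f := fun ij : ℕ × ℕ =>
        (p i + q i).choose ij.1 * (P + Q).choose ij.2) (fun _ _ => Nat.zero_le _)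
        (Finset.HasAntidiagonal.mem_antidiagonal.2 rfl : (q i, Q) ∈ _)
    have h6 : p i + P + (q i + Q) = p i + q i + (P + Q) := by ring
    rw [h6] at h3
    set N := (p i + q i + (P + Q))!
    have hpos : 0 < (P + Q)! := Nat.factorial_pos _
    refine Nat.le_of_mul_le_mul_right ?_ hpos
    calc (p i + q i)! * (∏ x ∈ s, (p x + q x)!) * ((p i + P)! * (q i + Q)!) * (P + Q)!
        = ((p i + P)! * (q i + Q)!) * (p i + q i).choose (q i) * (P + Q).choose Q *
            (p i)! * (q i)! * ((∏ x ∈ s, (p x + q x)!) * (P ! * Q !)) := by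
          rw [← h1, ← h2]; ring
      _ ≤ ((p i + P)! * (q i + Q)!) * (p i + q i).choose (q i) * (P + Q).choose Q *
            (p i)! * (q i)! * ((∏ i ∈ s, (p i)!) * (∏ i ∈ s, (q i)!) * (P + Q)!) :=
          Nat.mul_le_mul_left _ ih
      _ = ((p i + q i).choose (q i) * (P + Q).choose Q) * (((p i + P)! * (q i + Q)!) *
            (p i)! * (q i)! * ((∏ i ∈ s, (p i)!) * (∏ i ∈ s, (q i)!) * (P + Q)!)) := by ring
      _ ≤ ((p i + q i + (P + Q)).choose (q i + Q)) * (((p i + P)! * (q i + Q)!) *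
            (p i)! * (q i)! * ((∏ i ∈ s, (p i)!) * (∏ i ∈ s, (q i)!) * (P + Q)!)) :=
          Nat.mul_le_mul_right _ h5
      _ = _ := by rw [← h3]; ring

lemma weight_add_le {r : Fin n → ℝ} (hr : ∀ i, 0 < r i) (p q : Fin n →₀ ℕ) :
    weight r (p + q) ≤ weight r p * weight r q := by
  have h := factorial_prod_le Finset.univ p q
  have h' : ((∏ i, (p i + q i)! : ℕ) : ℝ) * (((p.degree)! : ℝ) * ((q.degree)! : ℝ)) ≤
      ((∏ i, (p i)! : ℕ) : ℝ) * ((∏ i, (q i)! : ℕ) : ℝ) * (((p + q).degree)! : ℝ) := by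
    simp only [Finsupp.degree_eq_sum]
    exact_mod_cast h
  push_cast at h'
  unfold weight
  rw [div_mul_div_comm, div_le_div_iff₀ (by positivity) (by positivity)]
  simp only [Finset.prod_mul_distrib, Finsupp.add_apply, pow_add]
  have hP : 0 ≤ (∏ i, r i ^ p i) * ∏ i, r i ^ q i :=
    mul_nonneg (Finset.prod_nonneg fun i _ => pow_nonneg (hr i).le _)
      (Finset.prod_nonneg fun i _ => pow_nonneg (hr i).le _)
  calc _ = ((∏ i, ((p i + q i)! : ℝ)) * (((p.degree)! : ℝ) * ((q.degree)! : ℝ))) *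
        ((∏ i, r i ^ p i) * ∏ i, r i ^ q i) := by ring
    _ ≤ _ := mul_le_mul_of_nonneg_right h' hP
    _ = _ := by ring

/-- An exact equality, with no dependence on the degree: one integration pays for raising the
falling factorial by one, that is, for one later derivative in an arbitrary direction. -/
lemma weightedNorm_antideriv_succ {r : Fin n → ℝ} (hr : ∀ i, 0 < r i) (k : ℕ) (s : Fin n)
    (a : MvPowerSeries (Fin n) ℝ) :
    weightedNorm r (k + 1) (antideriv s a) = ENNReal.ofReal (r s) * weightedNorm r k a := by
  unfold weightedNorm
  rw [← ENNReal.tsum_mul_left]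
  rw [← Function.Injective.tsum_eq (g := fun γ : Fin n →₀ ℕ => γ + Finsupp.single s 1)
    (add_left_injective _)]
  · refine tsum_congr fun γ => ?_
    rw [← ENNReal.ofReal_mul (hr s).le, coeff_add_single_antideriv]
    congr 1
    have h1 : (γ + Finsupp.single s 1).degree = γ.degree + 1 := by simp
    have h2 := weight_add_single r γ s
    have h3 : (0 : ℝ) < γ s + 1 := by positivity
    rw [h1, Nat.succ_descFactorial_succ, abs_div, abs_of_pos h3]
    push_cast
    calc _ = |coeff γ a| / (γ s + 1) * (γ.degree.descFactorial k : ℝ) *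
          (weight r (γ + Finsupp.single s 1) * (γ.degree + 1)) := by ring
      _ = _ := by rw [h2]; field_simp
  · intro γ hγ
    have : γ s ≠ 0 := by
      intro h
      apply hγ
      simp [coeff_antideriv, h]
    refine ⟨γ - Finsupp.single s 1, ?_⟩
    exact tsub_add_cancel_of_le (by simpa [Nat.one_le_iff_ne_zero] using this)

/-- An antiderivative has no constant term, so the extra factor |γ| of the preceding norm is at
least 1 wherever it matters. -/
lemma weightedNorm_zero_antideriv_le {r : Fin n → ℝ} (hr : ∀ i, 0 < r i) (s : Fin n)
    (a : MvPowerSeries (Fin n) ℝ) :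
    weightedNorm r 0 (antideriv s a) ≤ ENNReal.ofReal (r s) * weightedNorm r 0 a := by
  rw [← weightedNorm_antideriv_succ hr]
  refine ENNReal.tsum_le_tsum fun γ => ENNReal.ofReal_le_ofReal ?_
  by_cases h : γ.degree = 0
  · have : γ = 0 := (Finsupp.degree_eq_zero_iff γ).1 h
    subst this
    simp [coeff_antideriv]
  · refine mul_le_mul_of_nonneg_right (mul_le_mul_of_nonneg_left ?_ (abs_nonneg _))
      (weight_nonneg hr γ)
    simp only [Nat.descFactorial_zero, zero_add, Nat.descFactorial_one]
    exact_mod_cast Nat.one_le_iff_ne_zero.2 h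

/-- The same cancellation as for the antiderivative; only an inequality, because the monomials free
of x_j are lost. -/
lemma weightedNorm_pderiv_le {r : Fin n → ℝ} (hr : ∀ i, 0 < r i) (k : ℕ) (j : Fin n)
    (a : MvPowerSeries (Fin n) ℝ) :
    weightedNorm r k (pderiv ℝ j a) ≤ ENNReal.ofReal (r j)⁻¹ * weightedNorm r (k + 1) a := by
  unfold weightedNorm
  rw [← ENNReal.tsum_mul_left]
  refine le_trans (le_of_eq ?_) (ENNReal.tsum_comp_le_tsum_of_injective
    (f := fun γ : Fin n →₀ ℕ => γ + Finsupp.single j 1) (add_left_injective _) _)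
  refine tsum_congr fun γ => ?_
  rw [← ENNReal.ofReal_mul (inv_nonneg.2 (hr j).le), coeff_pderiv]
  congr 1
  have h1 : (γ + Finsupp.single j 1).degree = γ.degree + 1 := by simp
  have h2 := weight_add_single r γ j
  have h3 : (0 : ℝ) < γ j + 1 := by positivity
  have h4 := (hr j).ne'
  rw [h1, Nat.succ_descFactorial_succ, abs_mul, abs_of_pos h3]
  push_cast
  calc _ = (r j)⁻¹ * |coeff (γ + Finsupp.single j 1) a| * (γ.degree.descFactorial k : ℝ) *
        (weight r γ * (γ j + 1) * r j) := by field_simp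
    _ = _ := by rw [← h2]; ring

/-- Submultiplicativity of the weights carries over to the Cauchy product. Working in `ℝ≥0∞` allows
the rearrangement without summability hypotheses. -/
lemma weightedNorm_mul_le {r : Fin n → ℝ} (hr : ∀ i, 0 < r i) (a b : MvPowerSeries (Fin n) ℝ) :
    weightedNorm r 0 (a * b) ≤ weightedNorm r 0 a * weightedNorm r 0 b := by
  unfold weightedNorm
  simp only [Nat.descFactorial_zero, Nat.cast_one, mul_one]
  have key : ∀ γ, ENNReal.ofReal (|coeff γ (a * b)| * weight r γ) ≤
      ∑ p ∈ Finset.HasAntidiagonal.antidiagonal γ, ENNReal.ofReal (|coeff p.1 a| * weight r p.1) *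
        ENNReal.ofReal (|coeff p.2 b| * weight r p.2) := by
    intro γ
    have hw := weight_nonneg hr
    simp_rw [← ENNReal.ofReal_mul (mul_nonneg (abs_nonneg _) (hw _))]
    rw [← ENNReal.ofReal_sum_of_nonneg (fun p _ => mul_nonneg
      (mul_nonneg (abs_nonneg _) (hw _)) (mul_nonneg (abs_nonneg _) (hw _)))]
    refine ENNReal.ofReal_le_ofReal ?_
    rw [coeff_mul]
    refine (mul_le_mul_of_nonneg_right (Finset.abs_sum_le_sum_abs _ _) (hw _)).trans ?_
    rw [Finset.sum_mul]
    refine Finset.sum_le_sum fun p hp => ?_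
    rw [← Finset.HasAntidiagonal.mem_antidiagonal.1 hp, abs_mul]
    calc _ ≤ |coeff p.1 a| * |coeff p.2 b| * (weight r p.1 * weight r p.2) :=
          mul_le_mul_of_nonneg_left (weight_add_le hr _ _) (by positivity)
      _ = _ := by ring
  refine (ENNReal.tsum_le_tsum key).trans (le_of_eq ?_)
  rw [← ENNReal.tsum_mul_right]
  simp_rw [← ENNReal.tsum_mul_left]
  rw [← ENNReal.tsum_prod (f := fun p q => ENNReal.ofReal (|coeff p a| * weight r p) *
        ENNReal.ofReal (|coeff q b| * weight r q)),
    ← (Finset.HasAntidiagonal.sigmaAntidiagonalEquivProd (A := Fin n →₀ ℕ)).tsum_eq, ENNReal.tsum_sigma']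
  refine tsum_congr fun γ => ?_
  rw [tsum_fintype, ← Finset.sum_coe_sort]
  rfl

lemma weightedNorm_add_le {r : Fin n → ℝ} (hr : ∀ i, 0 < r i) (k : ℕ)
    (a b : MvPowerSeries (Fin n) ℝ) :
    weightedNorm r k (a + b) ≤ weightedNorm r k a + weightedNorm r k b := by
  unfold weightedNorm
  rw [← ENNReal.tsum_add]
  refine ENNReal.tsum_le_tsum fun γ => ?_
  have hw := weight_nonneg hr
  rw [← ENNReal.ofReal_add (mul_nonneg (by positivity) (hw _))
    (mul_nonneg (by positivity) (hw _))]
  refine ENNReal.ofReal_le_ofReal ?_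
  rw [map_add, ← add_mul, ← add_mul]
  exact mul_le_mul_of_nonneg_right (mul_le_mul_of_nonneg_right (abs_add_le _ _) (by positivity))
    (hw _)

lemma weightedNorm_zero (r : Fin n → ℝ) (k : ℕ) : weightedNorm r k 0 = 0 := by
  simp [weightedNorm]

lemma weightedNorm_neg (r : Fin n → ℝ) (k : ℕ) (a : MvPowerSeries (Fin n) ℝ) :
    weightedNorm r k (-a) = weightedNorm r k a := by
  simp [weightedNorm]

lemma weightedNorm_sum_le {r : Fin n → ℝ} (hr : ∀ i, 0 < r i) (k : ℕ) {ι : Type*}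
    (s : Finset ι) (a : ι → MvPowerSeries (Fin n) ℝ) :
    weightedNorm r k (∑ i ∈ s, a i) ≤ ∑ i ∈ s, weightedNorm r k (a i) :=
  Finset.le_sum_of_subadditive _ (weightedNorm_zero r k).le (weightedNorm_add_le hr k) _ _

end PowerSeries

/-! ### Formal solutions of linear second order systems -/

section FormalSolution

open MvPowerSeries
open scoped ENNReal Nat MvPowerSeries.WithPiTopology

variable {n : ℕ}

/-- Convergence of power series is coefficientwise here, and each coefficient of the derivative
involves a single coefficient of the original series. -/
lemma hasSum_pderiv (j : Fin n) {d : ℕ → MvPowerSeries (Fin n) ℝ} {h : MvPowerSeries (Fin n) ℝ}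
    (H : HasSum d h) : HasSum (fun k => pderiv ℝ j (d k)) (pderiv ℝ j h) := by
  rw [WithPiTopology.hasSum_iff_hasSum_coeff] at H ⊢
  intro γ
  simp only [coeff_pderiv]
  exact (H _).mul_right _

lemma hasSum_antideriv (s : Fin n) {d : ℕ → MvPowerSeries (Fin n) ℝ}
    {h : MvPowerSeries (Fin n) ℝ} (H : HasSum d h) :
    HasSum (fun k => antideriv s (d k)) (antideriv s h) := by
  rw [WithPiTopology.hasSum_iff_hasSum_coeff] at H ⊢
  intro γ
  simp only [coeff_antideriv]
  split_ifs
  · exact hasSum_zero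
  · exact (H _).div_const _

lemma weight_pos {r : Fin n → ℝ} (hr : ∀ i, 0 < r i) (γ : Fin n →₀ ℕ) : 0 < weight r γ :=
  div_pos (Finset.prod_pos fun i _ => mul_pos (by positivity) (pow_pos (hr i) _))
    (by positivity)

lemma enorm_coeff_le {r : Fin n → ℝ} (hr : ∀ i, 0 < r i) (a : MvPowerSeries (Fin n) ℝ)
    (γ : Fin n →₀ ℕ) :
    ‖coeff γ a‖ₑ ≤ ENNReal.ofReal (weight r γ)⁻¹ * weightedNorm r 0 a := by
  have hw := weight_pos hr γ
  have h1 : ENNReal.ofReal (|coeff γ a| * ((γ.degree.descFactorial 0 : ℕ) : ℝ) * weight r γ) ≤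
    weightedNorm r 0 a := ENNReal.le_tsum γ
  calc ‖coeff γ a‖ₑ = ENNReal.ofReal (weight r γ)⁻¹ *
        ENNReal.ofReal (|coeff γ a| * ((γ.degree.descFactorial 0 : ℕ) : ℝ) * weight r γ) := by
        rw [← ENNReal.ofReal_mul (by positivity), Real.enorm_eq_ofReal_abs]
        congr 1
        simp
        field_simp
    _ ≤ _ := by gcongr

/-- The triangle inequality for infinite sums. It shows that the coefficientwise sum of the Neumann
series still has finite norm. -/
lemma weightedNorm_le_of_hasSum {r : Fin n → ℝ} (hr : ∀ i, 0 < r i)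
    {d : ℕ → MvPowerSeries (Fin n) ℝ} {h : MvPowerSeries (Fin n) ℝ} (H : HasSum d h) :
    weightedNorm r 0 h ≤ ∑' k, weightedNorm r 0 (d k) := by
  rw [WithPiTopology.hasSum_iff_hasSum_coeff] at H
  unfold weightedNorm
  rw [ENNReal.tsum_comm]
  refine ENNReal.tsum_le_tsum fun γ => ?_
  have hw := weight_nonneg hr γ
  simp only [Nat.descFactorial_zero, Nat.cast_one, mul_one]
  simp_rw [ENNReal.ofReal_mul (abs_nonneg _)]
  rw [ENNReal.tsum_mul_right]
  gcongr
  simp_rw [← Real.enorm_eq_ofReal_abs]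
  rw [← (H γ).tsum_eq]
  exact enorm_tsum_le_tsum_enorm

lemma exists_hasSum_of_tsum_weightedNorm {r : Fin n → ℝ} (hr : ∀ i, 0 < r i)
    {d : ℕ → MvPowerSeries (Fin n) ℝ} (hd : ∑' k, weightedNorm r 0 (d k) ≠ ⊤) :
    ∃ h, HasSum d h := by
  suffices Summable d from this
  rw [WithPiTopology.summable_iff_summable_coeff]
  intro γ
  refine Summable.of_enorm ?_
  refine ne_top_of_le_ne_top ?_ (ENNReal.tsum_le_tsum fun k => enorm_coeff_le hr (d k) γ)
  rw [ENNReal.tsum_mul_left]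
  exact ENNReal.mul_ne_top ENNReal.ofReal_ne_top hd

variable {ι : Type*} [Fintype ι]

/-- Neumann series for `h + K h = F`. -/
lemma exists_formal_neumann {r : Fin n → ℝ} (hr : ∀ i, 0 < r i)
    (K : (ι → MvPowerSeries (Fin n) ℝ) → ι → MvPowerSeries (Fin n) ℝ)
    (hK : ∀ (d : ℕ → ι → MvPowerSeries (Fin n) ℝ) (h : ι → MvPowerSeries (Fin n) ℝ),
      (∀ I, HasSum (fun k => d k I) (h I)) → ∀ I, HasSum (fun k => K (d k) I) (K h I))
    (q : ℝ≥0∞) (hq : q < 1)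
    (hKq : ∀ h, ∑ I, weightedNorm r 0 (K h I) ≤ q * ∑ I, weightedNorm r 0 (h I))
    (F : ι → MvPowerSeries (Fin n) ℝ) (hF : ∀ I, weightedNorm r 0 (F I) ≠ ⊤) :
    ∃ h : ι → MvPowerSeries (Fin n) ℝ,
      (∀ I, weightedNorm r 0 (h I) ≠ ⊤) ∧ ∀ I, h I + K h I = F I := by
  -- The Neumann terms (-K)^k F; their total norms decay like q^k.
  let d : ℕ → ι → MvPowerSeries (Fin n) ℝ := fun k => k.rec F fun _ g I => -K g I
  have hd0 : d 0 = F := rfl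
  have hds : ∀ k, d (k + 1) = fun I => -K (d k) I := fun k => rfl
  have hdk : ∀ k, ∑ I, weightedNorm r 0 (d k I) ≤ q ^ k * ∑ I, weightedNorm r 0 (F I) := by
    intro k
    induction k with
    | zero => simp [hd0]
    | succ k ih =>
      simp only [hds, weightedNorm_neg]
      refine (hKq _).trans ?_
      rw [pow_succ', mul_assoc]
      gcongr
  have hFs : ∑ I, weightedNorm r 0 (F I) ≠ ⊤ := by
    simp [ENNReal.sum_eq_top, hF]
  have hsum : ∀ I, ∑' k, weightedNorm r 0 (d k I) ≠ ⊤ := by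
    intro I
    have : ∀ k, weightedNorm r 0 (d k I) ≤ q ^ k * ∑ I, weightedNorm r 0 (F I) := fun k =>
      (Finset.single_le_sum (f := fun I => weightedNorm r 0 (d k I)) (fun _ _ => zero_le)
        (Finset.mem_univ I)).trans (hdk k)
    refine ne_top_of_le_ne_top ?_ (ENNReal.tsum_le_tsum this)
    rw [ENNReal.tsum_mul_right, ENNReal.tsum_geometric]
    refine ENNReal.mul_ne_top ?_ hFs
    rw [ne_eq, ENNReal.inv_eq_top, tsub_eq_zero_iff_le, not_le]
    exact hq
  choose h hh using fun I => exists_hasSum_of_tsum_weightedNorm hr (hsum I)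
  refine ⟨h, fun I => ne_top_of_le_ne_top (hsum I) (weightedNorm_le_of_hasSum hr (hh I)), ?_⟩
  intro I
  have h1 := hK d h hh I
  have h2 : HasSum (fun k => d (k + 1) I) (-K h I) := h1.neg
  -- The shifted series ∑ d (k+1) has the two sums -K h and h - F; comparing them gives the
  -- equation.
  have h3 := (hasSum_nat_add_iff' (f := fun k => d k I) 1).2 (hh I)
  have h4 := h2.unique h3
  simp only [Finset.range_one, Finset.sum_singleton, hd0] at h4
  linear_combination -h4

/-- Formal solutions of `∂_s ∂_t u + ∑ ε_{ij} ∂_i ∂_j u + ∑ B_j ∂_j u + C u = F`, with a bound. -/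
lemma exists_formal_solution {r : Fin n → ℝ} (hr : ∀ i, 0 < r i) (s t : Fin n)
    (ε : Fin n → Fin n → MvPowerSeries (Fin n) ℝ)
    (B : Fin n → ι → ι → MvPowerSeries (Fin n) ℝ) (C : ι → ι → MvPowerSeries (Fin n) ℝ)
    (F : ι → MvPowerSeries (Fin n) ℝ) (hF : ∀ I, weightedNorm r 0 (F I) ≠ ⊤)
    (hq : (∑ i, ∑ j, weightedNorm r 0 (ε i j) * ENNReal.ofReal (r s * r t / (r i * r j)))
      + (∑ j, ∑ I, ∑ J, weightedNorm r 0 (B j I J) * ENNReal.ofReal (r s * r t / r j))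
      + ∑ I, ∑ J, weightedNorm r 0 (C I J) * ENNReal.ofReal (r s * r t) < 1) :
    ∃ u : ι → MvPowerSeries (Fin n) ℝ,
      (∀ I, weightedNorm r 0 (u I) ≠ ⊤) ∧
      (∀ I i, weightedNorm r 0 (pderiv ℝ i (u I)) ≠ ⊤) ∧
      (∀ I i j, weightedNorm r 0 (pderiv ℝ i (pderiv ℝ j (u I))) ≠ ⊤) ∧
      ∀ I, pderiv ℝ s (pderiv ℝ t (u I)) + ((∑ i, ∑ j, ε i j * pderiv ℝ i (pderiv ℝ j (u I)))
        + (∑ j, ∑ J, B j I J * pderiv ℝ j (u J)) + ∑ J, C I J * u J) = F I := by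
  have hst := mul_nonneg (hr s).le (hr t).le
  have N0 : ∀ h, weightedNorm r 0 (antideriv s (antideriv t h)) ≤
      ENNReal.ofReal (r s * r t) * weightedNorm r 0 h := fun h => by
    refine (weightedNorm_zero_antideriv_le hr s _).trans ?_
    rw [ENNReal.ofReal_mul (hr s).le, mul_assoc]
    gcongr
    exact weightedNorm_zero_antideriv_le hr t _
  have N1 : ∀ j h, weightedNorm r 0 (pderiv ℝ j (antideriv s (antideriv t h))) ≤
      ENNReal.ofReal (r s * r t / r j) * weightedNorm r 0 h := fun j h => by
    refine (weightedNorm_pderiv_le hr 0 j _).trans ?_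
    rw [weightedNorm_antideriv_succ hr, div_eq_mul_inv, ENNReal.ofReal_mul hst,
      ENNReal.ofReal_mul (hr s).le, mul_comm (_ * _) (ENNReal.ofReal (r j)⁻¹), mul_assoc, mul_assoc]
    gcongr
    exact weightedNorm_zero_antideriv_le hr t _
  -- The two integrations raise the norm index from 0 to 2 with the exact factor r_s r_t, and the
  -- two derivatives bring it back to 0 at the cost 1/(r_i r_j).
  have N2 : ∀ i j h, weightedNorm r 0 (pderiv ℝ i (pderiv ℝ j (antideriv s (antideriv t h)))) ≤
      ENNReal.ofReal (r s * r t / (r i * r j)) * weightedNorm r 0 h := fun i j h => by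
    refine (weightedNorm_pderiv_le hr 0 i _).trans ?_
    rw [div_eq_mul_inv, mul_inv, ENNReal.ofReal_mul hst, ENNReal.ofReal_mul (inv_nonneg.2 (hr i).le),
      ENNReal.ofReal_mul (hr s).le, mul_comm (_ * _) (_ * ENNReal.ofReal (r j)⁻¹), mul_assoc,
      mul_assoc]
    gcongr
    refine (weightedNorm_pderiv_le hr 1 j _).trans ?_
    rw [weightedNorm_antideriv_succ hr, weightedNorm_antideriv_succ hr, mul_assoc]
  -- The lower terms of the equation rewritten for h = ∂_s∂_t u. The principal part is scalar, so it
  -- does not mix the components I.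
  let K : (ι → MvPowerSeries (Fin n) ℝ) → ι → MvPowerSeries (Fin n) ℝ := fun h I =>
    (∑ i, ∑ j, ε i j * pderiv ℝ i (pderiv ℝ j (antideriv s (antideriv t (h I)))))
      + (∑ j, ∑ J, B j I J * pderiv ℝ j (antideriv s (antideriv t (h J))))
      + ∑ J, C I J * antideriv s (antideriv t (h J))
  have hK : ∀ (d : ℕ → ι → MvPowerSeries (Fin n) ℝ) (h : ι → MvPowerSeries (Fin n) ℝ),
      (∀ I, HasSum (fun k => d k I) (h I)) → ∀ I, HasSum (fun k => K (d k) I) (K h I) := by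
    intro d h H I
    refine ((hasSum_sum fun i _ => hasSum_sum fun j _ => ?_).add
      (hasSum_sum fun i _ => hasSum_sum fun j _ => ?_)).add (hasSum_sum fun j _ => ?_)
    · exact (hasSum_pderiv _ (hasSum_pderiv _
        (hasSum_antideriv _ (hasSum_antideriv _ (H _))))).mul_left _
    · exact (hasSum_pderiv _ (hasSum_antideriv _ (hasSum_antideriv _ (H _)))).mul_left _
    · exact (hasSum_antideriv _ (hasSum_antideriv _ (H _))).mul_left _
  have hKq : ∀ h, ∑ I, weightedNorm r 0 (K h I) ≤ ((∑ i, ∑ j, weightedNorm r 0 (ε i j) *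
        ENNReal.ofReal (r s * r t / (r i * r j)))
      + (∑ j, ∑ I, ∑ J, weightedNorm r 0 (B j I J) * ENNReal.ofReal (r s * r t / r j))
      + ∑ I, ∑ J, weightedNorm r 0 (C I J) * ENNReal.ofReal (r s * r t)) *
        ∑ I, weightedNorm r 0 (h I) := by
    intro h
    set S := ∑ I, weightedNorm r 0 (h I) with hS
    have hle : ∀ J, weightedNorm r 0 (h J) ≤ S := fun J =>
      Finset.single_le_sum (f := fun I => weightedNorm r 0 (h I)) (fun _ _ => zero_le)
        (Finset.mem_univ J)
    have e : ∀ I, weightedNorm r 0 (K h I) ≤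
        (∑ i, ∑ j, weightedNorm r 0 (ε i j) * ENNReal.ofReal (r s * r t / (r i * r j))) *
          weightedNorm r 0 (h I)
        + (∑ j, ∑ J, weightedNorm r 0 (B j I J) * ENNReal.ofReal (r s * r t / r j)) * S
        + (∑ J, weightedNorm r 0 (C I J) * ENNReal.ofReal (r s * r t)) * S := by
      intro I
      refine (weightedNorm_add_le hr 0 _ _).trans (add_le_add
        ((weightedNorm_add_le hr 0 _ _).trans (add_le_add ?_ ?_)) ?_)
      · rw [Finset.sum_mul]
        refine (weightedNorm_sum_le hr 0 _ _).trans (Finset.sum_le_sum fun i _ => ?_)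
        rw [Finset.sum_mul]
        refine (weightedNorm_sum_le hr 0 _ _).trans (Finset.sum_le_sum fun j _ => ?_)
        rw [mul_assoc]
        exact (weightedNorm_mul_le hr _ _).trans (mul_le_mul' le_rfl (N2 _ _ _))
      · rw [Finset.sum_mul]
        refine (weightedNorm_sum_le hr 0 _ _).trans (Finset.sum_le_sum fun j _ => ?_)
        rw [Finset.sum_mul]
        refine (weightedNorm_sum_le hr 0 _ _).trans (Finset.sum_le_sum fun J _ => ?_)
        rw [mul_assoc]
        exact (weightedNorm_mul_le hr _ _).trans
          (mul_le_mul' le_rfl ((N1 _ _).trans (mul_le_mul' le_rfl (hle J))))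
      · rw [Finset.sum_mul]
        refine (weightedNorm_sum_le hr 0 _ _).trans (Finset.sum_le_sum fun J _ => ?_)
        rw [mul_assoc]
        exact (weightedNorm_mul_le hr _ _).trans
          (mul_le_mul' le_rfl ((N0 _).trans (mul_le_mul' le_rfl (hle J))))
    refine (Finset.sum_le_sum fun I _ => e I).trans (le_of_eq ?_)
    rw [Finset.sum_add_distrib, Finset.sum_add_distrib, ← Finset.mul_sum, ← Finset.sum_mul,
      ← Finset.sum_mul, ← hS, ← add_mul, ← add_mul]
    congr 3
    rw [Finset.sum_comm]
  obtain ⟨h, hh, hh'⟩ := exists_formal_neumann hr K hK _ hq hKq F hF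
  have fin : ∀ x, ∀ I, ENNReal.ofReal x * weightedNorm r 0 (h I) ≠ ⊤ := fun x I =>
    ENNReal.mul_ne_top ENNReal.ofReal_ne_top (hh I)
  -- The double antiderivative is the solution with zero data on x_s = 0 and x_t = 0. No second pair
  -- of derivatives is needed: ∂_s∂_t recovers h.
  refine ⟨fun I => antideriv s (antideriv t (h I)),
    fun I => ne_top_of_le_ne_top (fin _ I) (N0 _),
    fun I i => ne_top_of_le_ne_top (fin _ I) (N1 _ _),
    fun I i j => ne_top_of_le_ne_top (fin _ I) (N2 _ _ _), fun I => ?_⟩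
  rw [pderiv_comm s t, pderiv_antideriv, pderiv_antideriv]
  exact hh' I

end FormalSolution

/-! ### Evaluation of power series on polydiscs -/

section Evaluation

open MvPowerSeries
open scoped Nat

variable {n : ℕ}

/-- Absolute convergence on the closed polydisc of radius `ρ`. -/
def AbsSummable (ρ : ℝ) (a : MvPowerSeries (Fin n) ℝ) : Prop :=
  Summable fun γ => |coeff γ a| * ρ ^ γ.degree

/-- The sum of a power series at `x`. -/
def evalAt (a : MvPowerSeries (Fin n) ℝ) (x : EuclideanSpace ℝ (Fin n)) : ℝ :=
  ∑' γ, coeff γ a * ∏ i, x i ^ γ i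

/-- Equivalent to bounding multinomial coefficients by n^|γ|. It turns a finite weighted norm into
absolute convergence on a genuine polydisc. -/
lemma pow_degree_le_weight {r : Fin n → ℝ} (hr : ∀ i, 0 < r i) {ρ : ℝ} (hρ : 0 ≤ ρ)
    (h : ∀ i, n * ρ ≤ r i) (γ : Fin n →₀ ℕ) : ρ ^ γ.degree ≤ weight r γ := by
  obtain ⟨k, hk⟩ : ∃ k, γ.degree = k := ⟨_, rfl⟩
  induction k generalizing γ with
  | zero =>
    rw [Finsupp.degree_eq_zero_iff] at hk
    subst hk
    simp [weight]
  | succ k ih =>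
    -- By pigeonhole some exponent is at least |γ|/n. Removing one unit of it divides the weight by
    -- γ_s r_s/|γ| ≥ r_s/n ≥ ρ.
    obtain ⟨s, hs⟩ : ∃ s, k + 1 ≤ n * γ s := by
      have hne : (Finset.univ : Finset (Fin n)).Nonempty := by
        rw [Finset.univ_nonempty_iff]
        by_contra hempty
        rw [not_nonempty_iff] at hempty
        have : γ = 0 := Subsingleton.elim _ _
        simp [this] at hk
      obtain ⟨s, -, hs⟩ := Finset.exists_le_of_sum_le hne
        (f := fun _ => k + 1) (g := fun s => n * γ s) (by
          rw [← Finset.mul_sum, ← Finsupp.degree_eq_sum, hk]; simp)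
      exact ⟨s, hs⟩
    have hs0 : γ s ≠ 0 := by rintro h0; simp [h0] at hs
    obtain ⟨μ, rfl⟩ : ∃ μ : Fin n →₀ ℕ, γ = μ + Finsupp.single s 1 :=
      ⟨γ - Finsupp.single s 1,
        (tsub_add_cancel_of_le (by simpa [Nat.one_le_iff_ne_zero] using hs0)).symm⟩
    have hμ : μ.degree = k := by simpa using hk
    have h1 := ih μ hμ
    have h2 := weight_add_single r μ s
    rw [hk]
    rw [hμ] at h1 h2
    have hs' : (k : ℝ) + 1 ≤ n * (μ s + 1) := by
      have : ((k + 1 : ℕ) : ℝ) ≤ ((n * (μ + Finsupp.single s 1 : Fin n →₀ ℕ) s : ℕ) : ℝ) := by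
        exact_mod_cast hs
      simpa using this
    refine le_of_mul_le_mul_right ?_ (by positivity : (0 : ℝ) < k + 1)
    rw [h2]
    calc ρ ^ (k + 1) * (k + 1) = ρ ^ k * (ρ * (k + 1)) := by ring
      _ ≤ weight r μ * ((μ s + 1) * r s) := by
        refine mul_le_mul h1 ?_ (by positivity) (weight_nonneg hr μ)
        calc ρ * (k + 1) ≤ ρ * (n * (μ s + 1)) := by gcongr
          _ = (μ s + 1) * (n * ρ) := by ring
          _ ≤ _ := by have := h s; gcongr
      _ = _ := by ring

lemma AbsSummable.of_weightedNorm {r : Fin n → ℝ} (hr : ∀ i, 0 < r i) {ρ : ℝ} (hρ : 0 ≤ ρ)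
    (h : ∀ i, n * ρ ≤ r i) {a : MvPowerSeries (Fin n) ℝ} (ha : weightedNorm r 0 a ≠ ⊤) :
    AbsSummable ρ a := by
  have h1 : Summable fun γ => |coeff γ a| * weight r γ := by
    have hn : ∀ γ, 0 ≤ |coeff γ a| * weight r γ := fun γ =>
      mul_nonneg (abs_nonneg _) (weight_nonneg hr γ)
    have := ENNReal.summable_toReal ha
    refine this.congr fun γ => ?_
    rw [ENNReal.toReal_ofReal (by simpa using hn γ)]
    simp
  exact Summable.of_nonneg_of_le (fun γ => by positivity)
    (fun γ => mul_le_mul_of_nonneg_left (pow_degree_le_weight hr hρ h γ) (abs_nonneg _)) h1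

/-- The constant coefficient is kept apart, and every other term gains τ^|γ| ≤ τ. Shrinking the
radii thus brings the norm of a coefficient function down to its value at the origin. -/
lemma weightedNorm_le_of_absSummable {r : Fin n → ℝ} (hr : ∀ i, 0 < r i) {ρ τ : ℝ} (hρ : 0 ≤ ρ)
    (hτ : 0 ≤ τ) (hτ1 : τ ≤ 1) (h : ∀ i, r i ≤ τ * ρ) {a : MvPowerSeries (Fin n) ℝ}
    (ha : AbsSummable ρ a) :
    weightedNorm r 0 a ≤
      ENNReal.ofReal (|coeff 0 a| + τ * ∑' γ, |coeff γ a| * ρ ^ γ.degree) := by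
  have hw : ∀ γ, weight r γ ≤ (τ * ρ) ^ γ.degree := fun γ => by
    unfold weight
    rw [div_le_iff₀ (by positivity), Finset.prod_mul_distrib, mul_comm]
    refine mul_le_mul ?_ ?_ (by positivity) (by positivity)
    · rw [Finsupp.degree_eq_sum, ← Finset.prod_pow_eq_pow_sum]
      exact Finset.prod_le_prod (fun i _ => pow_nonneg (hr i).le _)
        fun i _ => pow_le_pow_left₀ (hr i).le (h i) _
    · rw [Finsupp.degree_eq_sum]
      have := Nat.le_of_dvd (Nat.factorial_pos _)
        (Nat.prod_factorial_dvd_factorial_sum Finset.univ γ)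
      exact_mod_cast this
  have hterm : ∀ γ, |coeff γ a| * weight r γ ≤
      (if γ = 0 then |coeff γ a| else 0) + τ * (|coeff γ a| * ρ ^ γ.degree) := fun γ => by
    refine (mul_le_mul_of_nonneg_left (hw γ) (abs_nonneg _)).trans ?_
    split_ifs with h0
    · subst h0
      simp
      positivity
    · have hd : γ.degree ≠ 0 := by rwa [ne_eq, Finsupp.degree_eq_zero_iff]
      have : τ ^ γ.degree ≤ τ := pow_le_of_le_one hτ hτ1 hd
      rw [mul_pow, zero_add]
      calc _ = τ ^ γ.degree * (|coeff γ a| * ρ ^ γ.degree) := by ring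
        _ ≤ _ := by gcongr
  have hs1 : HasSum (fun γ : Fin n →₀ ℕ => if γ = 0 then |coeff γ a| else 0) |coeff 0 a| := by
    convert hasSum_ite_eq (0 : Fin n →₀ ℕ) |coeff 0 a| using 2 with γ
    split_ifs with h0
    · rw [h0]
    · rfl
  have hs := hs1.add (ha.hasSum.mul_left τ)
  rw [← hs.tsum_eq]
  unfold weightedNorm
  simp only [Nat.descFactorial_zero, Nat.cast_one, mul_one]
  rw [ENNReal.ofReal_tsum_of_nonneg _ hs.summable]
  · exact ENNReal.tsum_le_tsum fun γ => ENNReal.ofReal_le_ofReal (hterm γ)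
  · intro γ
    have : 0 ≤ |coeff γ a| * ρ ^ γ.degree := by positivity
    split_ifs <;> positivity

lemma abs_prod_pow_le {ρ : ℝ} {x : Fin n → ℝ} (hx : ∀ i, |x i| ≤ ρ) (γ : Fin n →₀ ℕ) :
    |∏ i, x i ^ γ i| ≤ ρ ^ γ.degree := by
  rw [Finset.abs_prod, Finsupp.degree_eq_sum, ← Finset.prod_pow_eq_pow_sum]
  refine Finset.prod_le_prod (fun i _ => abs_nonneg _) fun i _ => ?_
  rw [abs_pow]
  exact pow_le_pow_left₀ (abs_nonneg _) (hx i) _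

lemma AbsSummable.summable {ρ : ℝ} {a : MvPowerSeries (Fin n) ℝ} (ha : AbsSummable ρ a)
    {x : EuclideanSpace ℝ (Fin n)} (hx : ∀ i, |x i| ≤ ρ) :
    Summable fun γ => ‖coeff γ a * ∏ i, x i ^ γ i‖ := by
  refine Summable.of_nonneg_of_le (fun γ => norm_nonneg _) (fun γ => ?_) ha
  rw [norm_mul]
  exact mul_le_mul_of_nonneg_left (abs_prod_pow_le hx γ) (norm_nonneg _)

lemma AbsSummable.add {ρ : ℝ} (hρ : 0 ≤ ρ) {a b : MvPowerSeries (Fin n) ℝ}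
    (ha : AbsSummable ρ a) (hb : AbsSummable ρ b) : AbsSummable ρ (a + b) := by
  refine Summable.of_nonneg_of_le (fun γ => by positivity) (fun γ => ?_) (Summable.add ha hb)
  rw [map_add, ← add_mul]
  exact mul_le_mul_of_nonneg_right (abs_add_le _ _) (by positivity)

lemma AbsSummable.zero (ρ : ℝ) : AbsSummable ρ (0 : MvPowerSeries (Fin n) ℝ) := by
  simp [AbsSummable, summable_zero]

lemma AbsSummable.sum {ρ : ℝ} (hρ : 0 ≤ ρ) {ι : Type*} (s : Finset ι)
    {a : ι → MvPowerSeries (Fin n) ℝ} (ha : ∀ i ∈ s, AbsSummable ρ (a i)) :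
    AbsSummable ρ (∑ i ∈ s, a i) :=
  Finset.sum_induction a _ (fun _ _ => AbsSummable.add hρ) (AbsSummable.zero ρ) ha

lemma summable_sum_antidiagonal {A : Type*} [AddCommMonoid A] [Finset.HasAntidiagonal A]
    {f g : A → ℝ} (hf : Summable f) (hg : Summable g) (hf0 : ∀ x, 0 ≤ f x) (hg0 : ∀ x, 0 ≤ g x) :
    Summable fun γ => ∑ p ∈ Finset.HasAntidiagonal.antidiagonal γ, f p.1 * g p.2 :=
  summable_sum_mul_antidiagonal_of_summable_mul (Summable.mul_of_nonneg hf hg hf0 hg0)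

lemma tsum_sum_antidiagonal {A : Type*} [AddCommMonoid A] [Finset.HasAntidiagonal A]
    {f g : A → ℝ} (hf : Summable fun x => ‖f x‖) (hg : Summable fun x => ‖g x‖) :
    ∑' γ, ∑ p ∈ Finset.HasAntidiagonal.antidiagonal γ, f p.1 * g p.2 =
      (∑' x, f x) * ∑' x, g x :=
  (hf.of_norm.tsum_mul_tsum_eq_tsum_sum_antidiagonal hg.of_norm
    (summable_mul_of_summable_norm hf hg)).symm

lemma AbsSummable.mul {ρ : ℝ} (hρ : 0 ≤ ρ) {a b : MvPowerSeries (Fin n) ℝ}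
    (ha : AbsSummable ρ a) (hb : AbsSummable ρ b) : AbsSummable ρ (a * b) := by
  have key := summable_sum_antidiagonal ha hb (fun _ => by positivity) (fun _ => by positivity)
  refine Summable.of_nonneg_of_le (fun γ => by positivity) (fun γ => ?_) key
  rw [coeff_mul]
  refine (mul_le_mul_of_nonneg_right (Finset.abs_sum_le_sum_abs _ _) (by positivity)).trans ?_
  rw [Finset.sum_mul]
  refine Finset.sum_le_sum fun p hp => le_of_eq ?_
  rw [← Finset.HasAntidiagonal.mem_antidiagonal.1 hp, abs_mul, map_add, pow_add]
  ring

lemma evalAt_add {ρ : ℝ} {a b : MvPowerSeries (Fin n) ℝ} (ha : AbsSummable ρ a)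
    (hb : AbsSummable ρ b) {x : EuclideanSpace ℝ (Fin n)} (hx : ∀ i, |x i| ≤ ρ) :
    evalAt (a + b) x = evalAt a x + evalAt b x := by
  unfold evalAt
  rw [← (ha.summable hx).of_norm.tsum_add (hb.summable hx).of_norm]
  simp [add_mul]

lemma evalAt_zero (x : EuclideanSpace ℝ (Fin n)) : evalAt 0 x = 0 := by
  simp [evalAt]

lemma evalAt_sum {ρ : ℝ} (hρ : 0 ≤ ρ) {ι : Type*} (s : Finset ι)
    {a : ι → MvPowerSeries (Fin n) ℝ} (ha : ∀ i ∈ s, AbsSummable ρ (a i))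
    {x : EuclideanSpace ℝ (Fin n)} (hx : ∀ i, |x i| ≤ ρ) :
    evalAt (∑ i ∈ s, a i) x = ∑ i ∈ s, evalAt (a i) x := by
  classical
  induction s using Finset.induction_on with
  | empty => simp [evalAt_zero]
  | insert i s hi ih =>
    rw [Finset.sum_insert hi, Finset.sum_insert hi, evalAt_add (ρ := ρ) (ha i (by simp))
      (AbsSummable.sum hρ s fun j hj => ha j (by simp [hj])) hx,
      ih fun j hj => ha j (by simp [hj])]

lemma evalAt_mul {ρ : ℝ} {a b : MvPowerSeries (Fin n) ℝ} (ha : AbsSummable ρ a)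
    (hb : AbsSummable ρ b) {x : EuclideanSpace ℝ (Fin n)} (hx : ∀ i, |x i| ≤ ρ) :
    evalAt (a * b) x = evalAt a x * evalAt b x := by
  have h1 := ha.summable hx
  have h2 := hb.summable hx
  unfold evalAt
  have key := tsum_sum_antidiagonal h1 h2
  rw [← key]
  refine tsum_congr fun γ => ?_
  rw [coeff_mul, Finset.sum_mul]
  refine Finset.sum_congr rfl fun p hp => ?_
  rw [← Finset.HasAntidiagonal.mem_antidiagonal.1 hp]
  simp only [Finsupp.add_apply, pow_add, Finset.prod_mul_distrib]
  ring

end Evaluation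

/-! ### Analyticity, termwise differentiation and power series expansion -/

section EvaluationAnalytic

open MvPowerSeries
open scoped Nat ENNReal

variable {n : ℕ}

/-- The monomial `x ^ γ` is the diagonal of a multilinear map of norm at most one. -/
lemma exists_multilinear_monomial (k : ℕ) (γ : Fin n →₀ ℕ) (hγ : γ.degree = k) :
    ∃ m : EuclideanSpace ℝ (Fin n) [×k]→L[ℝ] ℝ,
      (∀ x, m (fun _ => x) = ∏ i, x i ^ γ i) ∧ ‖m‖ ≤ 1 := by
  induction k generalizing γ with
  | zero =>
    rw [Finsupp.degree_eq_zero_iff] at hγ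
    subst hγ
    refine ⟨ContinuousMultilinearMap.uncurry0 ℝ _ 1, fun x => by simp, by simp⟩
  | succ k ih =>
    obtain ⟨s, hs⟩ : ∃ s, γ s ≠ 0 := by
      by_contra! h0
      have : γ = 0 := Finsupp.ext h0
      simp [this] at hγ
    obtain ⟨μ, rfl⟩ : ∃ μ : Fin n →₀ ℕ, γ = μ + Finsupp.single s 1 :=
      ⟨γ - Finsupp.single s 1,
        (tsub_add_cancel_of_le (by simpa [Nat.one_le_iff_ne_zero] using hs)).symm⟩
    obtain ⟨m, hm, hm1⟩ := ih μ (by simpa using hγ)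
    refine ⟨((EuclideanSpace.proj s : EuclideanSpace ℝ (Fin n) →L[ℝ] ℝ).smulRight m).uncurryLeft,
      fun x => ?_, ?_⟩
    · have : Fin.tail (fun _ : Fin (k + 1) => x) = fun _ => x := rfl
      rw [ContinuousLinearMap.uncurryLeft_apply, this]
      simp only [ContinuousLinearMap.smulRight_apply, _root_.smul_apply, hm,
        Finsupp.add_apply, pow_add, Finset.prod_mul_distrib, smul_eq_mul]
      have : ∏ i, x i ^ (Finsupp.single s 1 : Fin n →₀ ℕ) i = x s := by
        rw [Finset.prod_eq_single s (fun i _ hi => by simp [hi.symm])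
          (by simp)]
        simp
      rw [this, mul_comm]
      rfl
    · rw [ContinuousLinearMap.uncurryLeft_norm, ContinuousLinearMap.norm_smulRight_apply]
      refine mul_le_one₀ ?_ (norm_nonneg _) hm1
      refine ContinuousLinearMap.opNorm_le_bound _ zero_le_one fun x => ?_
      simpa using PiLp.norm_apply_le x s

lemma coord_abs_le {x : EuclideanSpace ℝ (Fin n)} {ρ : ℝ} (hx : ‖x‖ ≤ ρ) (i : Fin n) :
    |x i| ≤ ρ :=
  (PiLp.norm_apply_le x i).trans hx

lemma preimage_degree (k : ℕ) :
    (Finsupp.degree : (Fin n →₀ ℕ) → ℕ) ⁻¹' {k} =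
      ((Finset.univ : Finset (Fin n)).finsuppAntidiag k : Set (Fin n →₀ ℕ)) := by
  ext γ
  simp [Finset.mem_finsuppAntidiag, Finsupp.degree_eq_sum]

/-- Grouping monomials by total degree gives a formal multilinear series whose k-th term has norm at
most the sum of the coefficients' absolute values in degree k. -/
lemma analyticOnNhd_evalAt {ρ : ℝ} (hρ : 0 < ρ) {a : MvPowerSeries (Fin n) ℝ}
    (ha : AbsSummable ρ a) : AnalyticOnNhd ℝ (evalAt a) (Metric.ball 0 ρ) := by
  have hm : ∀ (k : ℕ) (γ : Fin n →₀ ℕ), ∃ m : EuclideanSpace ℝ (Fin n) [×k]→L[ℝ] ℝ,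
      γ.degree = k → (∀ x, m (fun _ => x) = ∏ i, x i ^ γ i) ∧ ‖m‖ ≤ 1 := fun k γ => by
    by_cases h : γ.degree = k
    · obtain ⟨m, h1⟩ := exists_multilinear_monomial k γ h
      exact ⟨m, fun _ => h1⟩
    · exact ⟨0, fun h' => absurd h' h⟩
  choose m hm using hm
  let p : FormalMultilinearSeries ℝ (EuclideanSpace ℝ (Fin n)) ℝ := fun k =>
    ∑ γ ∈ (Finset.univ : Finset (Fin n)).finsuppAntidiag k, coeff γ a • m k γ
  have hmem : ∀ {k : ℕ} {γ : Fin n →₀ ℕ},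
      γ ∈ (Finset.univ : Finset (Fin n)).finsuppAntidiag k → γ.degree = k := fun {k γ} h => by
    rw [Finset.mem_finsuppAntidiag] at h
    rw [Finsupp.degree_eq_sum, h.1]
  have hp : ∀ k x, p k (fun _ => x) = ∑ γ ∈ (Finset.univ : Finset (Fin n)).finsuppAntidiag k,
      coeff γ a * ∏ i, x i ^ γ i := fun k x => by
    simp only [p, _root_.sum_apply, _root_.smul_apply,
      smul_eq_mul]
    exact Finset.sum_congr rfl fun γ hγ => by rw [(hm k γ (hmem hγ)).1]
  have hfp : HasFPowerSeriesOnBall (evalAt a) p 0 (ENNReal.ofReal ρ) := by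
    refine ⟨?_, by simpa using hρ, ?_⟩
    · refine FormalMultilinearSeries.le_radius_of_bound (r := ρ.toNNReal) p
        (∑' γ, |coeff γ a| * ρ ^ γ.degree) fun k => ?_
      rw [Real.coe_toNNReal _ hρ.le]
      calc ‖p k‖ * ρ ^ k ≤ (∑ γ ∈ (Finset.univ : Finset (Fin n)).finsuppAntidiag k,
            |coeff γ a|) * ρ ^ k := by
            gcongr
            refine norm_sum_le_of_le _ fun γ hγ => ?_
            rw [norm_smul]
            exact mul_le_of_le_one_right (norm_nonneg _) (hm k γ (hmem hγ)).2
        _ = ∑ γ ∈ (Finset.univ : Finset (Fin n)).finsuppAntidiag k,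
              |coeff γ a| * ρ ^ γ.degree := by
            rw [Finset.sum_mul]
            exact Finset.sum_congr rfl fun γ hγ => by rw [hmem hγ]
        _ ≤ _ := ha.sum_le_tsum _ fun γ _ => by positivity
    · intro y hy
      rw [zero_add]
      have hy' : ‖y‖ ≤ ρ := by
        have : dist y 0 < ρ := by
          rw [Metric.eball_ofReal] at hy
          exact hy
        rw [dist_zero_right] at this
        exact this.le
      have h1 := (ha.summable (coord_abs_le hy')).of_norm.hasSum.tsum_fiberwise Finsupp.degree
      refine h1.congr_fun fun k => ?_
      rw [hp, preimage_degree]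
      exact (Finset.tsum_subtype _ _).symm
  exact fun x hx => hfp.analyticAt_of_mem (by rw [Metric.eball_ofReal]; exact hx)

/-- Termwise differentiation along the coordinate line through x. Assuming that the differentiated
series converges on the same polydisc avoids any loss of radius. -/
lemma partialDeriv_evalAt {ρ : ℝ} (hρ : 0 < ρ) {a : MvPowerSeries (Fin n) ℝ}
    (ha : AbsSummable ρ a) (j : Fin n) (hj : AbsSummable ρ (pderiv ℝ j a))
    {x : EuclideanSpace ℝ (Fin n)} (hx : ‖x‖ < ρ) :
    partialDeriv j (evalAt a) x = evalAt (pderiv ℝ j a) x := by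
  have hd : DifferentiableAt ℝ (evalAt a) x :=
    (analyticOnNhd_evalAt hρ ha x (by simpa using hx)).differentiableAt
  unfold partialDeriv
  rw [← hd.lineDeriv_eq_fderiv]
  let L : ℝ → EuclideanSpace ℝ (Fin n) := fun t => x + t • EuclideanSpace.single j 1
  have hL : ∀ t i, L t i = x i + t * (if i = j then 1 else 0) := fun t i => by
    simp [L]
  have hLc : Continuous L := by fun_prop
  -- The parameters for which the line stays in the ball: an open convex set, hence preconnected, as
  -- the differentiation theorem for series requires.
  let S : Set ℝ := L ⁻¹' Metric.ball 0 ρ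
  have hSo : IsOpen S := Metric.isOpen_ball.preimage hLc
  have hSc : Convex ℝ S := by
    have : S = (AffineMap.lineMap x (x + EuclideanSpace.single j (1 : ℝ)) : ℝ →ᵃ[ℝ] _) ⁻¹'
        Metric.ball 0 ρ := by
      ext t
      simp [S, L, AffineMap.lineMap_apply, add_comm]
    rw [this]
    exact (convex_ball _ _).affine_preimage _
  have h0 : (0 : ℝ) ∈ S := by simpa [S, L] using hx
  have hSabs : ∀ t ∈ S, ∀ i, |L t i| ≤ ρ := fun t ht i => by
    have : dist (L t) 0 < ρ := ht
    rw [dist_zero_right] at this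
    exact coord_abs_le this.le i
  have hinj : Function.Injective fun μ : Fin n →₀ ℕ => μ + Finsupp.single j 1 :=
    add_left_injective _
  have hsub : ∀ γ : Fin n →₀ ℕ, γ j ≠ 0 →
      γ ∈ Set.range fun μ : Fin n →₀ ℕ => μ + Finsupp.single j 1 := fun γ hγ =>
    ⟨γ - Finsupp.single j 1,
      tsub_add_cancel_of_le (by simpa [Nat.one_le_iff_ne_zero] using hγ)⟩
  have hprod : ∀ (γ : Fin n →₀ ℕ) (t : ℝ), ∏ i, L t i ^ γ i =
      (∏ i ∈ Finset.univ.erase j, x i ^ γ i) * (x j + t) ^ γ j := fun γ t => by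
    rw [← Finset.mul_prod_erase _ _ (Finset.mem_univ j), mul_comm]
    congr 1
    · refine Finset.prod_congr rfl fun i hi => ?_
      rw [hL, if_neg (Finset.ne_of_mem_erase hi)]; simp
    · rw [hL, if_pos rfl]; simp
  have hprod' : ∀ (μ : Fin n →₀ ℕ) (t : ℝ), ∏ i, L t i ^ μ i =
      (∏ i ∈ Finset.univ.erase j, x i ^ (μ + Finsupp.single j 1 : Fin n →₀ ℕ) i) *
        (x j + t) ^ μ j := fun μ t => by
    rw [hprod]
    congr 1
    refine Finset.prod_congr rfl fun i hi => ?_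
    simp [(Finset.ne_of_mem_erase hi)]
  let g' : (Fin n →₀ ℕ) → ℝ → ℝ := fun γ t =>
    coeff γ a * ((∏ i ∈ Finset.univ.erase j, x i ^ γ i) * (γ j * (x j + t) ^ (γ j - 1)))
  have hg'shift : ∀ (μ : Fin n →₀ ℕ) (t : ℝ), g' (μ + Finsupp.single j 1) t =
      coeff μ (pderiv ℝ j a) * ∏ i, L t i ^ μ i := fun μ t => by
    rw [coeff_pderiv, hprod']
    simp [g']
    ring
  -- The majorant is that of the differentiated series, shifted by one in the exponent of x_j. The
  -- case γ j = 0 is set to zero because the subtraction truncates there.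
  let u : (Fin n →₀ ℕ) → ℝ := fun γ => if γ j = 0 then 0 else
    |coeff (γ - Finsupp.single j 1) (pderiv ℝ j a)| * ρ ^ (γ - Finsupp.single j 1).degree
  have hu : Summable u := by
    rw [← hinj.summable_iff]
    · refine Summable.congr hj fun μ => ?_
      simp [u]
    · intro γ hγ
      by_contra h
      exact hγ (hsub γ fun h0 => h (by simp [u, h0]))
  have hbound : ∀ γ t, t ∈ S → ‖g' γ t‖ ≤ u γ := fun γ t ht => by
    by_cases hγ : γ j = 0
    · simp [g', u, hγ]
    · obtain ⟨μ, rfl⟩ := hsub γ hγ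
      have : u (μ + Finsupp.single j 1) = |coeff μ (pderiv ℝ j a)| * ρ ^ μ.degree := by
        simp [u]
      dsimp only
      rw [this, hg'shift, norm_mul]
      exact mul_le_mul_of_nonneg_left (abs_prod_pow_le (hSabs t ht) μ) (norm_nonneg _)
  have key := hasDerivAt_tsum_of_isPreconnected (𝕜 := ℝ)
    (g := fun (γ : Fin n →₀ ℕ) t => coeff γ a * ∏ i, L t i ^ γ i) (g' := g') hu hSo
    hSc.isPreconnected (fun γ t ht => by
      simp only [hprod]
      refine HasDerivAt.const_mul _ (HasDerivAt.const_mul _ ?_)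
      simpa using ((hasDerivAt_id t).const_add (x j)).fun_pow (γ j)) hbound h0
    (ha.summable (hSabs 0 h0)).of_norm h0
  change deriv (fun t => evalAt a (L t)) 0 = _
  refine key.deriv.trans ?_
  rw [← hinj.tsum_eq]
  · simp only [hg'shift]
    have : L 0 = x := by simp [L]
    rw [this]
    rfl
  · intro γ hγ
    exact hsub γ fun h0 => hγ (by simp [g', h0])

/-- An analytic function is the sum of a power series on a small polydisc. -/
lemma exists_evalAt_eq {f : EuclideanSpace ℝ (Fin n) → ℝ} (hf : AnalyticAt ℝ f 0) :
    ∃ ρ : ℝ, 0 < ρ ∧ ∃ a : MvPowerSeries (Fin n) ℝ, AbsSummable ρ a ∧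
      ∀ x : EuclideanSpace ℝ (Fin n), ‖x‖ < ρ → f x = evalAt a x := by
  obtain ⟨p, R, hp⟩ := hf
  obtain ⟨ρ', hρ'0, hρ'R⟩ := ENNReal.lt_iff_exists_nnreal_btwn.1 hp.r_pos
  have hρ'0 : 0 < (ρ' : ℝ) := by exact_mod_cast hρ'0
  -- Expanding the k-th multilinear term in coordinates produces n^k words, so nρ must stay within
  -- the original radius ρ'.
  set ρ : ℝ := ρ' / (n + 1) with hρdef
  have hρ : 0 < ρ := by positivity
  have hnρ : n * ρ ≤ ρ' := by
    rw [hρdef, mul_div_assoc', div_le_iff₀ (by positivity)]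
    nlinarith
  have hρle : ρ ≤ ρ' := div_le_self hρ'0.le (by simp)
  have hps : Summable fun k => ‖p k‖ * (ρ' : ℝ) ^ k :=
    p.summable_norm_mul_pow (hρ'R.trans_le hp.r_le)
  -- Words in the coordinate indices. The map c counts letters, and summing over its fibres collects
  -- all words that give the same monomial.
  let Wd := Σ k : ℕ, (Fin k → Fin n)
  let c : Wd → (Fin n →₀ ℕ) := fun w => ∑ l, Finsupp.single (w.2 l) 1
  have hcdeg : ∀ w : Wd, (c w).degree = w.1 := fun w => by
    simp [c, map_sum]
  let F : Wd → ℝ := fun w => p w.1 fun l => EuclideanSpace.single (w.2 l) 1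
  have hF : ∀ w, |F w| ≤ ‖p w.1‖ := fun w => by
    refine ((p w.1).le_opNorm _).trans ?_
    simp
  have hFs : Summable fun w : Wd => |F w| * ρ ^ w.1 := by
    rw [summable_sigma_of_nonneg (fun w => by positivity)]
    refine ⟨fun k => (hasSum_fintype _).summable, ?_⟩
    refine Summable.of_nonneg_of_le (fun k => tsum_nonneg fun w => by positivity) (fun k => ?_) hps
    rw [tsum_fintype]
    calc ∑ w : Fin k → Fin n, |F ⟨k, w⟩| * ρ ^ k ≤ ∑ w : Fin k → Fin n, ‖p k‖ * ρ ^ k :=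
          Finset.sum_le_sum fun w _ => by have := hF ⟨k, w⟩; gcongr
      _ = ‖p k‖ * (n * ρ) ^ k := by simp [mul_pow]; ring
      _ ≤ _ := by gcongr
  have hmono : ∀ (x : EuclideanSpace ℝ (Fin n)) (w : Wd),
      ∏ l, x (w.2 l) = ∏ i, x i ^ (c w) i := fun x w => by
    simp only [c, Finsupp.finsetSum_apply, ← Finset.prod_pow_eq_pow_sum]
    rw [Finset.prod_comm]
    refine Finset.prod_congr rfl fun l _ => ?_
    rw [Finset.prod_eq_single (w.2 l) (fun i _ hi => by simp [hi.symm])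
          (by simp)]
    simp
  have hfib : ∀ (γ : Fin n →₀ ℕ) (w : c ⁻¹' {γ}), (w : Wd).1 = γ.degree := fun γ w => by
    rw [← hcdeg w, show c w = γ from w.2]
  have hFfib : ∀ γ, Summable fun w : c ⁻¹' {γ} => |F w| := fun γ => by
    have h1 : Summable fun w : c ⁻¹' {γ} => |F w| * ρ ^ (w : Wd).1 := hFs.subtype _
    simp only [hfib] at h1
    exact (summable_mul_right_iff (pow_ne_zero _ hρ.ne')).1 h1
  let a : MvPowerSeries (Fin n) ℝ := fun γ => ∑' w : c ⁻¹' {γ}, F w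
  have ha : ∀ γ, coeff γ a = ∑' w : c ⁻¹' {γ}, F w := fun γ => rfl
  refine ⟨ρ, hρ, a, ?_, ?_⟩
  · refine Summable.of_nonneg_of_le (fun γ => by positivity) (fun γ => ?_)
      (hFs.hasSum.tsum_fiberwise c).summable
    simp only [hfib, tsum_mul_right]
    have h1 : Summable fun w : c ⁻¹' {γ} => ‖F w‖ := hFfib γ
    have h2 := norm_tsum_le_tsum_norm h1
    rw [← ha, Real.norm_eq_abs] at h2
    exact mul_le_mul_of_nonneg_right h2 (pow_nonneg hρ.le _)
  · intro x hx
    have hb : ∀ w : Wd, ‖F w * ∏ l, x (w.2 l)‖ ≤ |F w| * ρ ^ w.1 := fun w => by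
      rw [norm_mul, hmono, ← hcdeg w]
      exact mul_le_mul_of_nonneg_left (abs_prod_pow_le (coord_abs_le hx.le) (c w)) (abs_nonneg _)
    have hxs : Summable fun w : Wd => F w * ∏ l, x (w.2 l) := Summable.of_norm_bounded hFs hb
    have h1 := hxs.hasSum.tsum_fiberwise c
    have h2 : HasSum (fun k => ∑ w : Fin k → Fin n, F ⟨k, w⟩ * ∏ l, x (w l)) _ :=
      hxs.hasSum.sigma fun k => hasSum_fintype _
    have h3 : HasSum (fun k => p k fun _ => x) (f x) := by
      have := hp.hasSum (y := x) (by
        rw [Metric.mem_eball, edist_zero_right, ← ofReal_norm]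
        refine lt_of_le_of_lt (ENNReal.ofReal_le_ofReal (hx.le.trans hρle)) ?_
        simpa using hρ'R)
      simpa using this
    have h4 : ∀ k, (p k fun _ => x) = ∑ w : Fin k → Fin n, F ⟨k, w⟩ * ∏ l, x (w l) := fun k => by
      have hx' : x = ∑ i, x i • EuclideanSpace.single i (1 : ℝ) := by
        ext j
        simp [Pi.single_apply]
      conv_lhs => rw [hx']
      rw [ContinuousMultilinearMap.map_sum]
      refine Finset.sum_congr rfl fun w _ => ?_
      rw [ContinuousMultilinearMap.map_smul_univ, smul_eq_mul, mul_comm]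
    simp only [h4] at h3
    rw [h3.unique h2, ← h1.tsum_eq]
    refine tsum_congr fun γ => ?_
    rw [ha, ← tsum_mul_right]
    refine tsum_congr fun w => ?_
    rw [hmono, show c w = γ from w.2]

end EvaluationAnalytic

/-! ### Local analytic solutions of linear second order systems -/

section CauchyKovalevskaya

open MvPowerSeries Filter
open scoped ENNReal

variable {n : ℕ}

lemma AbsSummable.mono {ρ ρ' : ℝ} (hρ : 0 ≤ ρ) (h : ρ ≤ ρ') {a : MvPowerSeries (Fin n) ℝ}
    (ha : AbsSummable ρ' a) : AbsSummable ρ a :=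
  Summable.of_nonneg_of_le (fun γ => by positivity) (fun γ => by gcongr) ha

lemma evalAt_origin (a : MvPowerSeries (Fin n) ℝ) : evalAt a 0 = coeff 0 a := by
  unfold evalAt
  rw [tsum_eq_single 0]
  · simp
  · intro γ hγ
    obtain ⟨i, hi⟩ : ∃ i, γ i ≠ 0 := by
      by_contra! h
      exact hγ (Finsupp.ext h)
    rw [Finset.prod_eq_zero (Finset.mem_univ i) (by simp [hi]), mul_zero]

/-- `f` is the sum of the power series `a` on small polydiscs. -/
def IsSeriesOf (a : MvPowerSeries (Fin n) ℝ) (f : EuclideanSpace ℝ (Fin n) → ℝ) : Prop :=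
  ∀ᶠ ρ in 𝓝[>] (0 : ℝ), AbsSummable ρ a ∧ ∀ x, ‖x‖ < ρ → f x = evalAt a x

lemma exists_isSeriesOf {f : EuclideanSpace ℝ (Fin n) → ℝ} (hf : AnalyticAt ℝ f 0) :
    ∃ a, IsSeriesOf a f := by
  obtain ⟨ρ, hρ, a, ha, h⟩ := exists_evalAt_eq hf
  refine ⟨a, ?_⟩
  filter_upwards [Ioo_mem_nhdsGT hρ] with ρ' hρ'
  exact ⟨ha.mono hρ'.1.le hρ'.2.le, fun x hx => h x (hx.trans hρ'.2)⟩

variable {ι : Type*} [Fintype ι]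

/-- All radii are shrunk by τ, and those in the directions s, t by a further factor η. Then r_s
r_t/(r_i r_j) is at most 1, and at most η unless both i and j lie in {s, t}; precisely for those
pairs ε vanishes at the origin. So the other entries of ε need not be small. -/
lemma exists_small_weights (s t : Fin n) {ρ : ℝ} (hρ : 0 < ρ)
    (ε : Fin n → Fin n → MvPowerSeries (Fin n) ℝ) (hε : ∀ i j, AbsSummable ρ (ε i j))
    (hε0 : ∀ i j, (i = s ∨ i = t) → (j = s ∨ j = t) → coeff 0 (ε i j) = 0)
    (B : Fin n → ι → ι → MvPowerSeries (Fin n) ℝ) (hB : ∀ j I J, AbsSummable ρ (B j I J))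
    (C : ι → ι → MvPowerSeries (Fin n) ℝ) (hC : ∀ I J, AbsSummable ρ (C I J)) :
    ∃ r : Fin n → ℝ, (∀ i, 0 < r i) ∧ (∀ i, r i ≤ ρ) ∧
      (∑ i, ∑ j, weightedNorm r 0 (ε i j) * ENNReal.ofReal (r s * r t / (r i * r j)))
      + (∑ j, ∑ I, ∑ J, weightedNorm r 0 (B j I J) * ENNReal.ofReal (r s * r t / r j))
      + ∑ I, ∑ J, weightedNorm r 0 (C I J) * ENNReal.ofReal (r s * r t) < 1 := by
  classical
  let S : MvPowerSeries (Fin n) ℝ → ℝ := fun a => ∑' γ, |coeff γ a| * ρ ^ γ.degree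
  have hS : ∀ a, 0 ≤ S a := fun a => tsum_nonneg fun γ => by positivity
  set E : ℝ := ∑ i, ∑ j, |coeff 0 (ε i j)| with hEdef
  set D : ℝ := (∑ i, ∑ j, S (ε i j)) + (∑ j, ∑ I, ∑ J, (|coeff 0 (B j I J)| + S (B j I J)) * ρ)
    + ∑ I, ∑ J, (|coeff 0 (C I J)| + S (C I J)) * ρ ^ 2 with hDdef
  have hE : 0 ≤ E := Finset.sum_nonneg fun i _ => Finset.sum_nonneg fun j _ => abs_nonneg _
  have hD : 0 ≤ D := by
    refine add_nonneg (add_nonneg ?_ ?_) ?_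
    · exact Finset.sum_nonneg fun i _ => Finset.sum_nonneg fun j _ => hS _
    · exact Finset.sum_nonneg fun i _ => Finset.sum_nonneg fun j _ => Finset.sum_nonneg fun k _ =>
        mul_nonneg (add_nonneg (abs_nonneg _) (hS _)) hρ.le
    · exact Finset.sum_nonneg fun i _ => Finset.sum_nonneg fun j _ =>
        mul_nonneg (add_nonneg (abs_nonneg _) (hS _)) (by positivity)
  -- E collects the constant parts of ε and is multiplied by η; D collects everything that carries a
  -- factor τ. With these choices each product is at most 1/4.
  set η : ℝ := 1 / (4 * (E + 1)) with hη
  set τ : ℝ := 1 / (4 * (D + 1)) with hτ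
  have hη0 : 0 < η := by positivity
  have hτ0 : 0 < τ := by positivity
  have hη1 : η ≤ 1 := by rw [hη, div_le_one (by positivity)]; linarith
  have hτ1 : τ ≤ 1 := by rw [hτ, div_le_one (by positivity)]; linarith
  have hηE : η * E ≤ 1 / 4 := by
    rw [hη, div_mul_eq_mul_div, div_le_div_iff₀ (by positivity) (by positivity)]; linarith
  have hτD : τ * D ≤ 1 / 4 := by
    rw [hτ, div_mul_eq_mul_div, div_le_div_iff₀ (by positivity) (by positivity)]; linarith
  let r : Fin n → ℝ := fun i => if i = s ∨ i = t then η * (τ * ρ) else τ * ρ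
  have hrs : r s = η * (τ * ρ) := by simp [r]
  have hrt : r t = η * (τ * ρ) := by simp [r]
  have hr : ∀ i, 0 < r i := fun i => by dsimp only [r]; split_ifs <;> positivity
  have hrle : ∀ i, r i ≤ τ * ρ := fun i => by
    dsimp only [r]; split_ifs
    · exact mul_le_of_le_one_left (by positivity) hη1
    · exact le_rfl
  have hrge : ∀ i, η * (τ * ρ) ≤ r i := fun i => by
    dsimp only [r]; split_ifs
    · exact le_rfl
    · exact mul_le_of_le_one_left (by positivity) hη1
  have hτρ : τ * ρ ≤ ρ := mul_le_of_le_one_left hρ.le hτ1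
  have hN : ∀ a, AbsSummable ρ a → weightedNorm r 0 a ≤ ENNReal.ofReal (|coeff 0 a| + τ * S a) :=
    fun a ha => weightedNorm_le_of_absSummable hr hρ.le hτ0.le hτ1 hrle ha
  have hNle : ∀ a, AbsSummable ρ a → weightedNorm r 0 a ≤ ENNReal.ofReal (|coeff 0 a| + S a) :=
    fun a ha => (hN a ha).trans (ENNReal.ofReal_le_ofReal (by
      gcongr; exact mul_le_of_le_one_left (hS a) hτ1))
  refine ⟨r, hr, fun i => (hrle i).trans hτρ, ?_⟩
  have e1 : ∀ i j, weightedNorm r 0 (ε i j) * ENNReal.ofReal (r s * r t / (r i * r j)) ≤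
      ENNReal.ofReal (η * |coeff 0 (ε i j)| + τ * S (ε i j)) := fun i j => by
    refine (mul_le_mul' (hN _ (hε i j)) le_rfl).trans ?_
    rw [← ENNReal.ofReal_mul (add_nonneg (abs_nonneg _) (mul_nonneg hτ0.le (hS _)))]
    refine ENNReal.ofReal_le_ofReal ?_
    have hr1 : r s * r t / (r i * r j) ≤ 1 := by
      rw [div_le_one (mul_pos (hr i) (hr j)), hrs, hrt]
      exact mul_le_mul (hrge i) (hrge j) (by positivity) (hr i).le
    rw [add_mul]
    refine add_le_add ?_ (mul_le_of_le_one_right (mul_nonneg hτ0.le (hS _)) hr1)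
    by_cases hi : i = s ∨ i = t
    · by_cases hj : j = s ∨ j = t
      · simp [hε0 i j hi hj]
      · rw [mul_comm]
        refine mul_le_mul_of_nonneg_right ?_ (abs_nonneg _)
        have : r j = τ * ρ := by simp only [r, if_neg hj]
        rw [hrs, hrt, this, div_le_iff₀ (mul_pos (hr i) (by positivity))]
        calc _ = η * ((η * (τ * ρ)) * (τ * ρ)) := by ring
          _ ≤ _ := by have := hrge i; gcongr
    · rw [mul_comm]
      refine mul_le_mul_of_nonneg_right ?_ (abs_nonneg _)
      have : r i = τ * ρ := by simp only [r, if_neg hi]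
      rw [hrs, hrt, this, div_le_iff₀ (mul_pos (by positivity) (hr j))]
      calc _ = η * ((τ * ρ) * (η * (τ * ρ))) := by ring
        _ ≤ _ := by have := hrge j; gcongr
  have e2 : ∀ j I J, weightedNorm r 0 (B j I J) * ENNReal.ofReal (r s * r t / r j) ≤
      ENNReal.ofReal (τ * ((|coeff 0 (B j I J)| + S (B j I J)) * ρ)) := fun j I J => by
    refine (mul_le_mul' (hNle _ (hB j I J)) le_rfl).trans ?_
    rw [← ENNReal.ofReal_mul (add_nonneg (abs_nonneg _) (hS _))]
    refine ENNReal.ofReal_le_ofReal ?_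
    have h1 : r s * r t / r j ≤ τ * ρ := by
      rw [div_le_iff₀ (hr j)]
      refine mul_le_mul (hrle s) ?_ (hr t).le (by positivity)
      rw [hrt]; exact hrge j
    calc _ ≤ (|coeff 0 (B j I J)| + S (B j I J)) * (τ * ρ) :=
          mul_le_mul_of_nonneg_left h1 (add_nonneg (abs_nonneg _) (hS _))
      _ = _ := by ring
  have e3 : ∀ I J, weightedNorm r 0 (C I J) * ENNReal.ofReal (r s * r t) ≤
      ENNReal.ofReal (τ * ((|coeff 0 (C I J)| + S (C I J)) * ρ ^ 2)) := fun I J => by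
    refine (mul_le_mul' (hNle _ (hC I J)) le_rfl).trans ?_
    rw [← ENNReal.ofReal_mul (add_nonneg (abs_nonneg _) (hS _))]
    refine ENNReal.ofReal_le_ofReal ?_
    have h1 : r s * r t ≤ τ * ρ ^ 2 := by
      calc r s * r t ≤ (τ * ρ) * ρ :=
            mul_le_mul (hrle s) ((hrle t).trans hτρ) (hr t).le (by positivity)
        _ = _ := by ring
    calc _ ≤ (|coeff 0 (C I J)| + S (C I J)) * (τ * ρ ^ 2) :=
          mul_le_mul_of_nonneg_left h1 (add_nonneg (abs_nonneg _) (hS _))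
      _ = _ := by ring
  have p1 : ∀ i j, 0 ≤ η * |coeff 0 (ε i j)| + τ * S (ε i j) := fun i j =>
    add_nonneg (by positivity) (mul_nonneg hτ0.le (hS _))
  have p2 : ∀ j I J, 0 ≤ τ * ((|coeff 0 (B j I J)| + S (B j I J)) * ρ) := fun j I J =>
    mul_nonneg hτ0.le (mul_nonneg (add_nonneg (abs_nonneg _) (hS _)) hρ.le)
  have p3 : ∀ I J, 0 ≤ τ * ((|coeff 0 (C I J)| + S (C I J)) * ρ ^ 2) := fun I J =>
    mul_nonneg hτ0.le (mul_nonneg (add_nonneg (abs_nonneg _) (hS _)) (by positivity))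
  have f1 : (∑ i, ∑ j, weightedNorm r 0 (ε i j) * ENNReal.ofReal (r s * r t / (r i * r j))) ≤
      ENNReal.ofReal (∑ i, ∑ j, (η * |coeff 0 (ε i j)| + τ * S (ε i j))) := by
    rw [ENNReal.ofReal_sum_of_nonneg fun i _ => Finset.sum_nonneg fun j _ => p1 i j]
    refine Finset.sum_le_sum fun i _ => ?_
    rw [ENNReal.ofReal_sum_of_nonneg fun j _ => p1 i j]
    exact Finset.sum_le_sum fun j _ => e1 i j
  have f2 : (∑ j, ∑ I, ∑ J, weightedNorm r 0 (B j I J) * ENNReal.ofReal (r s * r t / r j)) ≤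
      ENNReal.ofReal (∑ j, ∑ I, ∑ J, τ * ((|coeff 0 (B j I J)| + S (B j I J)) * ρ)) := by
    rw [ENNReal.ofReal_sum_of_nonneg fun i _ => Finset.sum_nonneg fun j _ =>
      Finset.sum_nonneg fun k _ => p2 i j k]
    refine Finset.sum_le_sum fun i _ => ?_
    rw [ENNReal.ofReal_sum_of_nonneg fun j _ => Finset.sum_nonneg fun k _ => p2 i j k]
    refine Finset.sum_le_sum fun j _ => ?_
    rw [ENNReal.ofReal_sum_of_nonneg fun k _ => p2 i j k]
    exact Finset.sum_le_sum fun k _ => e2 i j k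
  have f3 : (∑ I, ∑ J, weightedNorm r 0 (C I J) * ENNReal.ofReal (r s * r t)) ≤
      ENNReal.ofReal (∑ I, ∑ J, τ * ((|coeff 0 (C I J)| + S (C I J)) * ρ ^ 2)) := by
    rw [ENNReal.ofReal_sum_of_nonneg fun i _ => Finset.sum_nonneg fun j _ => p3 i j]
    refine Finset.sum_le_sum fun i _ => ?_
    rw [ENNReal.ofReal_sum_of_nonneg fun j _ => p3 i j]
    exact Finset.sum_le_sum fun j _ => e3 i j
  refine (add_le_add (add_le_add f1 f2) f3).trans_lt ?_
  rw [← ENNReal.ofReal_add (Finset.sum_nonneg fun i _ => Finset.sum_nonneg fun j _ => p1 i j)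
    (Finset.sum_nonneg fun i _ => Finset.sum_nonneg fun j _ => Finset.sum_nonneg fun k _ =>
      p2 i j k), ← ENNReal.ofReal_add (add_nonneg
        (Finset.sum_nonneg fun i _ => Finset.sum_nonneg fun j _ => p1 i j)
        (Finset.sum_nonneg fun i _ => Finset.sum_nonneg fun j _ => Finset.sum_nonneg fun k _ =>
      p2 i j k)) (Finset.sum_nonneg fun i _ => Finset.sum_nonneg fun j _ => p3 i j),
    ENNReal.ofReal_lt_one]
  have : (∑ i, ∑ j, (η * |coeff 0 (ε i j)| + τ * S (ε i j)))
      + (∑ j, ∑ I, ∑ J, τ * ((|coeff 0 (B j I J)| + S (B j I J)) * ρ))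
      + ∑ I, ∑ J, τ * ((|coeff 0 (C I J)| + S (C I J)) * ρ ^ 2) = η * E + τ * D := by
    simp only [hEdef, hDdef, Finset.sum_add_distrib, ← Finset.mul_sum]
    ring
  rw [this]
  linarith

/-- Solvability near the origin, for operators with principal part close to `∂_s ∂_t`. -/
lemma exists_solution_origin (s t : Fin n)
    (ε : Fin n → Fin n → EuclideanSpace ℝ (Fin n) → ℝ) (hε : ∀ i j, AnalyticAt ℝ (ε i j) 0)
    (hε0 : ∀ i j, (i = s ∨ i = t) → (j = s ∨ j = t) → ε i j 0 = 0)
    (B : Fin n → ι → ι → EuclideanSpace ℝ (Fin n) → ℝ) (hB : ∀ j I J, AnalyticAt ℝ (B j I J) 0)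
    (C : ι → ι → EuclideanSpace ℝ (Fin n) → ℝ) (hC : ∀ I J, AnalyticAt ℝ (C I J) 0)
    (f : ι → EuclideanSpace ℝ (Fin n) → ℝ) (hf : ∀ I, AnalyticAt ℝ (f I) 0) :
    ∃ u : ι → EuclideanSpace ℝ (Fin n) → ℝ, (∀ I, AnalyticAt ℝ (u I) 0) ∧
      ∀ᶠ y in 𝓝 0, ∀ I, partialDeriv s (partialDeriv t (u I)) y +
        ((∑ i, ∑ j, ε i j y * partialDeriv i (partialDeriv j (u I)) y)
          + (∑ j, ∑ J, B j I J y * partialDeriv j (u J) y) + ∑ J, C I J y * u J y) = f I y := by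
  choose ε' hε' using fun i j => exists_isSeriesOf (hε i j)
  choose B' hB' using fun j I J => exists_isSeriesOf (hB j I J)
  choose C' hC' using fun I J => exists_isSeriesOf (hC I J)
  choose f' hf' using fun I => exists_isSeriesOf (hf I)
  obtain ⟨ρ, ⟨⟨⟨⟨hρ, h1⟩, h2⟩, h3⟩, h4⟩⟩ := ((((eventually_mem_nhdsWithin (a := (0 : ℝ))
    (s := Set.Ioi 0)).and (eventually_all.2 fun i => eventually_all.2 fun j => hε' i j)).and
      (eventually_all.2 fun j => eventually_all.2 fun I => eventually_all.2 fun J =>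
        hB' j I J)).and (eventually_all.2 fun I => eventually_all.2 fun J => hC' I J)).and
          (eventually_all.2 fun I => hf' I) |>.exists
  have hρ : 0 < ρ := hρ
  obtain ⟨r, hr, hrρ, hq⟩ := exists_small_weights s t hρ ε' (fun i j => (h1 i j).1)
    (fun i j hi hj => by
      rw [← evalAt_origin, ← (h1 i j).2 0 (by simpa using hρ), hε0 i j hi hj])
    B' (fun j I J => (h2 j I J).1) C' (fun I J => (h3 I J).1)
  obtain ⟨u, hu0, hu1, hu2, hu⟩ := exists_formal_solution hr s t ε' B' C' f' (fun I =>
    ne_top_of_le_ne_top ENNReal.ofReal_ne_top (weightedNorm_le_of_absSummable hr hρ.le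
      zero_le_one le_rfl (fun i => by simpa using hrρ i) (h4 I).1)) hq
  -- The least radius divided by n + 1 satisfies nσ ≤ r_i for the conversion to a polydisc, and also
  -- σ ≤ ρ, so the coefficient series converge there too.
  obtain ⟨σ, hσ, hσr⟩ : ∃ σ : ℝ, 0 < σ ∧ ∀ i, (n + 1) * σ ≤ r i := by
    have : Nonempty (Fin n) := ⟨s⟩
    obtain ⟨i₀, hi₀⟩ := Finite.exists_min r
    refine ⟨r i₀ / (n + 1), div_pos (hr i₀) (by positivity), fun i => ?_⟩
    rw [mul_div_cancel₀ _ (by positivity)]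
    exact hi₀ i
  have hσ1 : ∀ i, n * σ ≤ r i := fun i => le_trans (by nlinarith) (hσr i)
  have hσρ : σ ≤ ρ := by
    refine le_trans ?_ ((hσr s).trans (hrρ s))
    nlinarith [(Nat.cast_nonneg n : (0 : ℝ) ≤ n)]
  have s0 : ∀ I, AbsSummable σ (u I) := fun I => .of_weightedNorm hr hσ.le hσ1 (hu0 I)
  have s1 : ∀ I i, AbsSummable σ (pderiv ℝ i (u I)) := fun I i =>
    .of_weightedNorm hr hσ.le hσ1 (hu1 I i)
  have s2 : ∀ I i j, AbsSummable σ (pderiv ℝ i (pderiv ℝ j (u I))) := fun I i j =>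
    .of_weightedNorm hr hσ.le hσ1 (hu2 I i j)
  have d1 : ∀ I i y, ‖y‖ < σ → partialDeriv i (evalAt (u I)) y = evalAt (pderiv ℝ i (u I)) y :=
    fun I i y hy => partialDeriv_evalAt hσ (s0 I) i (s1 I i) hy
  have d2 : ∀ I i j y, ‖y‖ < σ → partialDeriv i (partialDeriv j (evalAt (u I))) y =
      evalAt (pderiv ℝ i (pderiv ℝ j (u I))) y := fun I i j y hy => by
    rw [← partialDeriv_evalAt hσ (s1 I j) i (s2 I i j) hy]
    have : partialDeriv j (evalAt (u I)) =ᶠ[𝓝 y] evalAt (pderiv ℝ j (u I)) := by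
      filter_upwards [Metric.isOpen_ball.mem_nhds (by simpa using hy : y ∈ Metric.ball 0 σ)]
        with z hz
      exact d1 I j z (by simpa using hz)
    unfold partialDeriv at this ⊢
    rw [this.fderiv_eq]
  refine ⟨fun I => evalAt (u I), fun I => analyticOnNhd_evalAt hσ (s0 I) 0 (by simpa using hσ), ?_⟩
  filter_upwards [Metric.ball_mem_nhds (0 : EuclideanSpace ℝ (Fin n)) hσ] with y hy I
  have hy : ‖y‖ < σ := by simpa using hy
  have hyρ : ‖y‖ < ρ := hy.trans_le hσρ
  have hyc := coord_abs_le hy.le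
  have m1 : ∀ i j, AbsSummable σ (ε' i j) := fun i j => (h1 i j).1.mono hσ.le hσρ
  have m2 : ∀ j I J, AbsSummable σ (B' j I J) := fun j I J => (h2 j I J).1.mono hσ.le hσρ
  have m3 : ∀ I J, AbsSummable σ (C' I J) := fun I J => (h3 I J).1.mono hσ.le hσρ
  have k1 : ∀ i j, AbsSummable σ (ε' i j * pderiv ℝ i (pderiv ℝ j (u I))) := fun i j =>
    (m1 i j).mul hσ.le (s2 I i j)
  have k2 : ∀ j J, AbsSummable σ (B' j I J * pderiv ℝ j (u J)) := fun j J =>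
    (m2 j I J).mul hσ.le (s1 J j)
  have k3 : ∀ J, AbsSummable σ (C' I J * u J) := fun J => (m3 I J).mul hσ.le (s0 J)
  have S1 := AbsSummable.sum hσ.le Finset.univ fun i _ =>
    AbsSummable.sum hσ.le Finset.univ fun j _ => k1 i j
  have S2 := AbsSummable.sum hσ.le Finset.univ fun i _ =>
    AbsSummable.sum hσ.le Finset.univ fun j _ => k2 i j
  have S3 := AbsSummable.sum hσ.le Finset.univ fun j _ => k3 j
  have := congrArg (fun a => evalAt a y) (hu I)
  rw [evalAt_add (s2 I s t) ((S1.add hσ.le S2).add hσ.le S3) hyc,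
    evalAt_add (S1.add hσ.le S2) S3 hyc, evalAt_add S1 S2 hyc,
    evalAt_sum hσ.le _ (fun i _ => AbsSummable.sum hσ.le Finset.univ fun j _ => k1 i j) hyc,
    evalAt_sum hσ.le _ (fun i _ => AbsSummable.sum hσ.le Finset.univ fun j _ => k2 i j) hyc,
    evalAt_sum hσ.le _ (fun j _ => k3 j) hyc, ← (h4 I).2 y hyρ] at this
  rw [← this, d2 I s t y hy]
  congr 2
  · congr 1
    · refine Finset.sum_congr rfl fun i _ => ?_
      rw [evalAt_sum hσ.le _ (fun j _ => k1 i j) hyc]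
      refine Finset.sum_congr rfl fun j _ => ?_
      rw [evalAt_mul (m1 i j) (s2 I i j) hyc, d2 I i j y hy, (h1 i j).2 y hyρ]
    · refine Finset.sum_congr rfl fun i _ => ?_
      rw [evalAt_sum hσ.le _ (fun j _ => k2 i j) hyc]
      refine Finset.sum_congr rfl fun J _ => ?_
      rw [evalAt_mul (m2 i I J) (s1 J i) hyc, d1 J i y hy, (h2 i I J).2 y hyρ]
  · refine Finset.sum_congr rfl fun J _ => ?_
    rw [evalAt_mul (m3 I J) (s0 J) hyc, (h3 I J).2 y hyρ]

lemma partialDeriv_comp_sub (i : Fin n) (v : EuclideanSpace ℝ (Fin n) → ℝ)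
    (y₀ y : EuclideanSpace ℝ (Fin n)) :
    partialDeriv i (fun x => v (x - y₀)) y = partialDeriv i v (y - y₀) := by
  unfold partialDeriv
  simp only [sub_eq_add_neg, fderiv_comp_add_right]

lemma partialDeriv_comm {f : EuclideanSpace ℝ (Fin n) → ℝ} {y : EuclideanSpace ℝ (Fin n)}
    (hf : AnalyticAt ℝ f y) (i j : Fin n) :
    partialDeriv i (partialDeriv j f) y = partialDeriv j (partialDeriv i f) y := by
  have hs : IsSymmSndFDerivAt ℝ f y := hf.contDiffAt.isSymmSndFDerivAt_of_omega
  have e : ∀ i j, partialDeriv i (partialDeriv j f) y =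
      fderiv ℝ (fderiv ℝ f) y (EuclideanSpace.single i 1) (EuclideanSpace.single j 1) := fun i j => by
    unfold partialDeriv
    rw [fderiv_clm_apply hf.fderiv.differentiableAt (by fun_prop)]
    simp
  rw [e, e]
  exact hs _ _

/-- Local solvability of a linear second order system with scalar symbol in the analytic class. -/
theorem exists_analytic_solution (y₀ : EuclideanSpace ℝ (Fin n))
    (A : Fin n → Fin n → EuclideanSpace ℝ (Fin n) → ℝ) (hA : ∀ i j, AnalyticAt ℝ (A i j) y₀)
    (hsymm : ∀ i j, A i j y₀ = A j i y₀) (hne : ∃ i j, A i j y₀ ≠ 0)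
    (B : Fin n → ι → ι → EuclideanSpace ℝ (Fin n) → ℝ) (hB : ∀ j I J, AnalyticAt ℝ (B j I J) y₀)
    (C : ι → ι → EuclideanSpace ℝ (Fin n) → ℝ) (hC : ∀ I J, AnalyticAt ℝ (C I J) y₀)
    (f : ι → EuclideanSpace ℝ (Fin n) → ℝ) (hf : ∀ I, AnalyticAt ℝ (f I) y₀) :
    ∃ u : ι → EuclideanSpace ℝ (Fin n) → ℝ, (∀ I, AnalyticAt ℝ (u I) y₀) ∧
      ∀ᶠ y in 𝓝 y₀, ∀ I, (∑ i, ∑ j, A i j y * partialDeriv i (partialDeriv j (u I)) y)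
        + (∑ j, ∑ J, B j I J y * partialDeriv j (u J) y) + ∑ J, C I J y * u J y = f I y := by
  classical
  -- A nonzero diagonal entry of A(y₀) is used with s = t if there is one. Otherwise the diagonal
  -- vanishes, and an off-diagonal entry together with its mirror image gives κ = 2 A_{st}. In both
  -- cases the constant matrix K agrees with A(y₀) on {s, t}², and contracted with a symmetric
  -- Hessian it yields κ ∂_s∂_t.
  obtain ⟨s, t, κ, hκ, K, hK0, hK⟩ : ∃ (s t : Fin n) (κ : ℝ), κ ≠ 0 ∧
      ∃ K : Fin n → Fin n → ℝ, (∀ i j, (i = s ∨ i = t) → (j = s ∨ j = t) → A i j y₀ = K i j) ∧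
        ∀ D : Fin n → Fin n → ℝ, (∀ i j, D i j = D j i) → ∑ i, ∑ j, K i j * D i j = κ * D s t := by
    by_cases hd : ∃ s, A s s y₀ ≠ 0
    · obtain ⟨s, hs⟩ := hd
      refine ⟨s, s, _, hs, fun i j => if i = s then (if j = s then A s s y₀ else 0) else 0, ?_, ?_⟩
      · rintro i j hi hj
        have hi : i = s := by simpa using hi
        have hj : j = s := by simpa using hj
        simp [hi, hj]
      · intro D _
        rw [Finset.sum_eq_single s (fun i _ hi => by simp [hi]) (by simp),
          Finset.sum_eq_single s (fun i _ hi => by simp [hi]) (by simp)]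
        simp
    · push Not at hd
      obtain ⟨s, t, hst⟩ := hne
      have hne : s ≠ t := by rintro rfl; exact hst (hd s)
      refine ⟨s, t, 2 * A s t y₀, by simpa using hst, fun i j =>
        if i = s then (if j = t then A s t y₀ else 0) else
          if i = t then (if j = s then A s t y₀ else 0) else 0, ?_, ?_⟩
      · rintro i j (rfl | rfl) (rfl | rfl)
        · simp [hd, hne]
        · simp
        · simp [hne.symm, hsymm i j]
        · simp [hd, hne.symm]
      · intro D hD
        rw [← Finset.add_sum_erase _ _ (Finset.mem_univ s),
          ← Finset.add_sum_erase (Finset.univ.erase s) _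
            (Finset.mem_erase.2 ⟨hne.symm, Finset.mem_univ t⟩), Finset.sum_eq_zero (s :=
              (Finset.univ.erase s).erase t)]
        · simp [hne.symm, hD t s]
          ring
        · intro i hi
          simp only [Finset.mem_erase, Finset.mem_univ, and_true] at hi
          simp [hi.1, hi.2]
  have tr : ∀ {g : EuclideanSpace ℝ (Fin n) → ℝ}, AnalyticAt ℝ g y₀ →
      AnalyticAt ℝ (fun x => g (y₀ + x)) 0 := fun {g} hg => by
    have : AnalyticAt ℝ (fun x : EuclideanSpace ℝ (Fin n) => y₀ + x) 0 := by fun_prop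
    exact AnalyticAt.fun_comp (by simpa using hg) this
  obtain ⟨v, hv, hsol⟩ := exists_solution_origin s t
    -- After division by κ the principal part is ∂_s∂_t plus this remainder, which vanishes at the
    -- origin on the block {s, t}².
    (fun i j x => (A i j (y₀ + x) - K i j) / κ)
    (fun i j => ((tr (hA i j)).sub analyticAt_const).div analyticAt_const hκ)
    (fun i j hi hj => by simp [hK0 i j hi hj])
    (fun j I J x => B j I J (y₀ + x) / κ) (fun j I J => (tr (hB j I J)).div analyticAt_const hκ)
    (fun I J x => C I J (y₀ + x) / κ) (fun I J => (tr (hC I J)).div analyticAt_const hκ)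
    (fun I x => f I (y₀ + x) / κ) (fun I => (tr (hf I)).div analyticAt_const hκ)
  have hsub : AnalyticAt ℝ (fun x : EuclideanSpace ℝ (Fin n) => x - y₀) y₀ := by fun_prop
  refine ⟨fun I x => v I (x - y₀), fun I => AnalyticAt.fun_comp (by simpa using hv I) hsub, ?_⟩
  have hdiff2 : ∀ᶠ x in 𝓝 (0 : EuclideanSpace ℝ (Fin n)), ∀ I, AnalyticAt ℝ (v I) x :=
    eventually_all.2 fun I => (hv I).eventually_analyticAt
  have htend : Tendsto (fun x : EuclideanSpace ℝ (Fin n) => x - y₀) (𝓝 y₀) (𝓝 0) := by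
    simpa using hsub.continuousAt.tendsto
  filter_upwards [htend.eventually hsol, htend.eventually hdiff2] with y hy hcd I
  have e1 : ∀ j J, partialDeriv j (fun x => v J (x - y₀)) =
      fun x => partialDeriv j (v J) (x - y₀) := fun j J =>
    funext fun x => partialDeriv_comp_sub j (v J) y₀ x
  have e2 : ∀ i j J, partialDeriv i (partialDeriv j (fun x => v J (x - y₀))) y =
      partialDeriv i (partialDeriv j (v J)) (y - y₀) := fun i j J => by
    rw [e1, partialDeriv_comp_sub]
  have hs : ∀ i j, partialDeriv i (partialDeriv j (v I)) (y - y₀) =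
      partialDeriv j (partialDeriv i (v I)) (y - y₀) :=
    partialDeriv_comm (hcd I)
  have h := hy I
  simp only [add_sub_cancel] at h
  simp only [e2]
  simp only [e1]
  have hKD := hK (fun i j => partialDeriv i (partialDeriv j (v I)) (y - y₀)) hs
  simp only [div_mul_eq_mul_div, ← Finset.sum_div] at h
  rw [← add_div, ← add_div, ← sub_eq_zero] at h
  simp only [sub_mul, Finset.sum_sub_distrib] at h
  rw [hKD] at h
  field_simp at h
  linarith

end CauchyKovalevskaya

/-! ### Tensor calculus -/

section TensorCalculus

variable {n k l : ℕ}

/-- The space of `n` coordinates. -/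
abbrev Coord (n : ℕ) : Type := EuclideanSpace ℝ (Fin n)

lemma partialDeriv_congr {V : Set (Coord n)} (hV : IsOpen V) {f g : Coord n → ℝ} (h : ∀ x ∈ V, f x = g x)
    {y : Coord n} (hy : y ∈ V) (i : Fin n) : partialDeriv i f y = partialDeriv i g y := by
  have : f =ᶠ[𝓝 y] g := Filter.eventuallyEq_of_mem (hV.mem_nhds hy) h
  unfold partialDeriv
  rw [this.fderiv_eq]

lemma partialDeriv_add {f g : Coord n → ℝ} {y : Coord n} (hf : AnalyticAt ℝ f y) (hg : AnalyticAt ℝ g y)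
    (i : Fin n) :
    partialDeriv i (fun x => f x + g x) y = partialDeriv i f y + partialDeriv i g y := by
  unfold partialDeriv
  rw [fderiv_fun_add hf.differentiableAt hg.differentiableAt]
  rfl

lemma partialDeriv_sub {f g : Coord n → ℝ} {y : Coord n} (hf : AnalyticAt ℝ f y) (hg : AnalyticAt ℝ g y)
    (i : Fin n) :
    partialDeriv i (fun x => f x - g x) y = partialDeriv i f y - partialDeriv i g y := by
  unfold partialDeriv
  rw [fderiv_fun_sub hf.differentiableAt hg.differentiableAt]
  rfl

lemma partialDeriv_mul {f g : Coord n → ℝ} {y : Coord n} (hf : AnalyticAt ℝ f y) (hg : AnalyticAt ℝ g y)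
    (i : Fin n) : partialDeriv i (fun x => f x * g x) y =
      partialDeriv i f y * g y + f y * partialDeriv i g y := by
  unfold partialDeriv
  rw [fderiv_fun_mul hf.differentiableAt hg.differentiableAt]
  simp
  ring

lemma partialDeriv_const (c : ℝ) (y : Coord n) (i : Fin n) : partialDeriv i (fun _ => c) y = 0 := by
  simp [partialDeriv]

lemma partialDeriv_sum {ι : Type*} (s : Finset ι) {f : ι → Coord n → ℝ} {y : Coord n}
    (hf : ∀ j, AnalyticAt ℝ (f j) y) (i : Fin n) :
    partialDeriv i (fun x => ∑ j ∈ s, f j x) y = ∑ j ∈ s, partialDeriv i (f j) y := by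
  unfold partialDeriv
  rw [fderiv_fun_sum fun j _ => (hf j).differentiableAt]
  simp

lemma analyticAt_partialDeriv {f : Coord n → ℝ} {y : Coord n} (hf : AnalyticAt ℝ f y) (i : Fin n) :
    AnalyticAt ℝ (partialDeriv i f) y := by
  have h2 : AnalyticAt ℝ (fun L : Coord n →L[ℝ] ℝ => L (EuclideanSpace.single i 1)) (fderiv ℝ f y) :=
    ((ContinuousLinearMap.apply ℝ ℝ (EuclideanSpace.single i (1 : ℝ) : Coord n))).analyticAt _
  change AnalyticAt ℝ (fun x => fderiv ℝ f x (EuclideanSpace.single i 1)) y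
  exact AnalyticAt.fun_comp h2 hf.fderiv

/-- Arrays of `n ^ k` numbers: the components of covariant tensors of rank `k` at a point. -/
abbrev TensorArray (n k : ℕ) : Type := (Fin k → Fin n) → ℝ

/-- The derivation of the tensor algebra given by the endomorphism `A`:
`∑_s A^m_{a_s} T_{a₁…m…a_k}`. -/
def act (A : Fin n → Fin n → ℝ) : TensorArray n k →ₗ[ℝ] TensorArray n k where
  toFun T v := ∑ s, ∑ m, A m (v s) * T (Function.update v s m)
  map_add' T S := by
    ext v
    simp [mul_add, Finset.sum_add_distrib]
  map_smul' c T := by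
    ext v
    simp only [Pi.smul_apply, smul_eq_mul, Finset.mul_sum, RingHom.id_apply]
    exact Finset.sum_congr rfl fun s _ => Finset.sum_congr rfl fun m _ => by ring

lemma act_apply (A : Fin n → Fin n → ℝ) (T : TensorArray n k) (v : Fin k → Fin n) :
    act A T v = ∑ s, ∑ m, A m (v s) * T (Function.update v s m) := rfl

lemma act_add_left (A B : Fin n → Fin n → ℝ) (T : TensorArray n k) (v : Fin k → Fin n) :
    act (fun m a => A m a + B m a) T v = act A T v + act B T v := by
  simp [act_apply, add_mul, Finset.sum_add_distrib]

lemma act_sub_left (A B : Fin n → Fin n → ℝ) (T : TensorArray n k) (v : Fin k → Fin n) :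
    act (fun m a => A m a - B m a) T v = act A T v - act B T v := by
  simp [act_apply, sub_mul, Finset.sum_sub_distrib]

/-- A commutator of derivations of the tensor algebra is the derivation of the commutator
endomorphism; this produces the quadratic part of the curvature. -/
lemma act_comm (A B : Fin n → Fin n → ℝ) (T : TensorArray n k) (v : Fin k → Fin n) :
    act A (act B T) v - act B (act A T) v =
      act (fun d a => ∑ m, (A m a * B d m - B m a * A d m)) T v := by
  have e : ∀ A B : Fin n → Fin n → ℝ, act A (act B T) v =
      (∑ s, ∑ t, if s = t then ∑ m, ∑ p, A m (v s) * B p m * T (Function.update v s p) else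
        ∑ m, ∑ p, A m (v s) * B p (v t) *
          T (Function.update (Function.update v s m) t p)) := fun A B => by
    simp only [act_apply, Finset.mul_sum]
    refine Finset.sum_congr rfl fun s _ => ?_
    rw [Finset.sum_comm]
    refine Finset.sum_congr rfl fun t _ => ?_
    split_ifs with h
    · subst h
      simp [mul_assoc]
    · simp [Function.update_of_ne (Ne.symm h), mul_assoc]
  rw [e A B, e B A]
  -- Endomorphisms acting in two different slots commute, so these contributions are brought to the
  -- same form and cancel; only s = t survives.
  have e2 : (∑ s, ∑ t, if s = t then ∑ m, ∑ p, B m (v s) * A p m * T (Function.update v s p) else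
        ∑ m, ∑ p, B m (v s) * A p (v t) *
          T (Function.update (Function.update v s m) t p)) =
      (∑ s, ∑ t, if s = t then ∑ m, ∑ p, B m (v s) * A p m * T (Function.update v s p) else
        ∑ m, ∑ p, A m (v s) * B p (v t) *
          T (Function.update (Function.update v s m) t p)) := by
    rw [Finset.sum_comm]
    refine Finset.sum_congr rfl fun s _ => Finset.sum_congr rfl fun t _ => ?_
    by_cases h : s = t
    · subst h; simp
    · rw [if_neg h, if_neg (Ne.symm h), Finset.sum_comm]
      refine Finset.sum_congr rfl fun m _ => Finset.sum_congr rfl fun p _ => ?_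
      rw [Function.update_comm (Ne.symm h)]
      ring
  rw [e2, ← Finset.sum_sub_distrib, act_apply]
  refine Finset.sum_congr rfl fun s _ => ?_
  rw [← Finset.sum_sub_distrib, Finset.sum_eq_single s (fun t _ ht => by simp [Ne.symm ht])
    (by simp)]
  simp only [if_true, ← Finset.sum_sub_distrib, Finset.sum_mul]
  rw [Finset.sum_comm]
  exact Finset.sum_congr rfl fun m _ => Finset.sum_congr rfl fun p _ => by ring

/-- `∂_e T - Γ_e T`, the covariant derivative in the direction `e`. -/
def dirDeriv (G : Components n 2) (e : Fin n) (T : Components n k) : Components n k := fun y v =>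
  partialDeriv e (fun x => T x v) y - act (fun m a => christoffel G m e a y) (T y) v

lemma covDeriv_eq (G : Components n 2) (T : Components n k) (y : Coord n) (v : Fin (k + 1) → Fin n) :
    covDeriv G T y v = dirDeriv G (v (Fin.last k)) T y fun s => v s.castSucc := rfl

/-- Besides the iterated directional derivative there is a correction from the index created by the
first derivative. For a torsion-free connection it is symmetric in the two derivative indices. -/
lemma covDeriv_covDeriv (G : Components n 2) (T : Components n k) (y : Coord n)
    (v : Fin (k + 2) → Fin n) :
    covDeriv G (covDeriv G T) y v =
      dirDeriv G (v (Fin.last _)) (dirDeriv G (v (Fin.last k).castSucc) T) y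
          (fun s => v s.castSucc.castSucc)
        - ∑ m, christoffel G m (v (Fin.last _)) (v (Fin.last k).castSucc) y *
          dirDeriv G m T y fun s => v s.castSucc.castSucc := by
  rw [covDeriv_eq, dirDeriv, act_apply, Fin.sum_univ_castSucc]
  simp only [covDeriv_eq, Function.update_self]
  have h1 : ∀ m, (fun s : Fin k => Function.update (fun s : Fin (k + 1) => v s.castSucc)
      (Fin.last k) m s.castSucc) = fun s => v s.castSucc.castSucc := fun m => by
    ext s
    rw [Function.update_of_ne (Fin.castSucc_lt_last s).ne]
  have h2 : ∀ (s : Fin k) m, (fun r : Fin k => Function.update (fun s : Fin (k + 1) => v s.castSucc)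
      s.castSucc m r.castSucc) = Function.update (fun r : Fin k => v r.castSucc.castSucc) s m :=
    fun s m => by
      ext r
      by_cases h : r = s
      · subst h; simp
      · rw [Function.update_of_ne h, Function.update_of_ne (by simpa using h)]
  have h3 : ∀ (s : Fin k) (m : Fin n), Function.update (fun s : Fin (k + 1) => v s.castSucc)
      s.castSucc m (Fin.last k) = v (Fin.last k).castSucc := fun s m => by
    rw [Function.update_of_ne (Fin.castSucc_lt_last s).ne']
  simp only [h1, h2, h3]
  rw [← sub_sub]
  rfl

/-- Fields with analytic components on `V`. -/
def AnalyticField (T : Components n k) (V : Set (Coord n)) : Prop :=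
  ∀ v, AnalyticOnNhd ℝ (fun y => T y v) V

/-- The metric `G` is analytic, symmetric and nondegenerate on the open set `V`. -/
structure IsMetricOn (G : Components n 2) (V : Set (Coord n)) : Prop where
  isOpen : IsOpen V
  analytic : AnalyticField G V
  symm : ∀ y ∈ V, ∀ i j, G y ![i, j] = G y ![j, i]
  isUnit_det : ∀ y ∈ V, IsUnit (Matrix.of fun i j => G y ![i, j]).det

lemma analyticAt_det {m : ℕ} {M : Coord n → Matrix (Fin m) (Fin m) ℝ} {y : Coord n}
    (hM : ∀ i j, AnalyticAt ℝ (fun x => M x i j) y) : AnalyticAt ℝ (fun x => (M x).det) y := by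
  simp only [Matrix.det_apply']
  exact Finset.analyticAt_fun_sum _ fun σ _ => analyticAt_const.mul
    (Finset.analyticAt_fun_prod _ fun i _ => hM _ _)

/-! ### Levi-Civita calculus: analyticity, metric compatibility, the Ricci identity -/

namespace IsMetricOn

variable {G : Components n 2} {V : Set (Coord n)} (hG : IsMetricOn G V)
include hG

/-- By Cramer's rule the entries are polynomials in the metric divided by its nonvanishing
determinant. -/
lemma analyticAt_invMetric {y : Coord n} (hy : y ∈ V) (i j : Fin n) :
    AnalyticAt ℝ (fun x => invMetric G x i j) y := by
  have h0 : ∀ i j, AnalyticAt ℝ (fun x => (Matrix.of fun i j => G x ![i, j]) i j) y :=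
    fun i j => hG.analytic _ y hy
  have hdet := analyticAt_det h0
  have hadj : AnalyticAt ℝ (fun x => (Matrix.of fun i j => G x ![i, j]).adjugate i j) y := by
    simp only [Matrix.adjugate_apply]
    refine analyticAt_det fun a b => ?_
    by_cases h : a = j
    · subst h; simp only [Matrix.updateRow_self]; exact analyticAt_const
    · simp only [Matrix.updateRow_ne h]; exact h0 a b
  unfold invMetric
  simp only [Matrix.inv_def, Ring.inverse_eq_inv', Matrix.smul_apply, smul_eq_mul]
  exact (hdet.inv (hG.isUnit_det y hy).ne_zero).mul hadj

lemma analyticAt_christoffel {y : Coord n} (hy : y ∈ V) (m i j : Fin n) :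
    AnalyticAt ℝ (christoffel G m i j) y := by
  unfold christoffel
  refine analyticAt_const.mul (Finset.analyticAt_fun_sum _ fun l _ =>
    (hG.analyticAt_invMetric hy _ _).mul ?_)
  exact ((analyticAt_partialDeriv (hG.analytic _ y hy) _).add
    (analyticAt_partialDeriv (hG.analytic _ y hy) _)).sub
      (analyticAt_partialDeriv (hG.analytic _ y hy) _)

lemma analyticAt_riemannUp {y : Coord n} (hy : y ∈ V) (d a b c : Fin n) :
    AnalyticAt ℝ (riemannUp G d a b c) y := by
  have h := fun m i j => hG.analyticAt_christoffel hy m i j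
  unfold riemannUp
  exact ((analyticAt_partialDeriv (h _ _ _) _).sub (analyticAt_partialDeriv (h _ _ _) _)).add
    (Finset.analyticAt_fun_sum _ fun m _ => ((h _ _ _).mul (h _ _ _)).sub ((h _ _ _).mul (h _ _ _)))

lemma christoffel_symm {y : Coord n} (hy : y ∈ V) (m i j : Fin n) :
    christoffel G m i j y = christoffel G m j i y := by
  unfold christoffel
  congr 1
  refine Finset.sum_congr rfl fun l _ => ?_
  rw [partialDeriv_congr hG.isOpen (fun x hx => hG.symm x hx i j) hy]
  ring

lemma mul_invMetric {y : Coord n} (hy : y ∈ V) :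
    (Matrix.of fun i j => G y ![i, j]) * invMetric G y = 1 :=
  Matrix.mul_nonsing_inv _ (hG.isUnit_det y hy)

lemma invMetric_mul {y : Coord n} (hy : y ∈ V) :
    invMetric G y * (Matrix.of fun i j => G y ![i, j]) = 1 :=
  Matrix.nonsing_inv_mul _ (hG.isUnit_det y hy)

lemma sum_mul_invMetric {y : Coord n} (hy : y ∈ V) (i j : Fin n) :
    ∑ m, G y ![i, m] * invMetric G y m j = if i = j then 1 else 0 := by
  simpa [Matrix.mul_apply, Matrix.one_apply] using congrFun₂ (hG.mul_invMetric hy) i j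

lemma sum_invMetric_mul {y : Coord n} (hy : y ∈ V) (i j : Fin n) :
    ∑ m, invMetric G y i m * G y ![m, j] = if i = j then 1 else 0 := by
  simpa [Matrix.mul_apply, Matrix.one_apply] using congrFun₂ (hG.invMetric_mul hy) i j

lemma invMetric_symm {y : Coord n} (hy : y ∈ V) (i j : Fin n) :
    invMetric G y i j = invMetric G y j i := by
  have : (invMetric G y).transpose = invMetric G y := by
    unfold invMetric
    rw [Matrix.transpose_nonsing_inv]
    congr 1
    ext i j
    exact hG.symm y hy j i
  exact congrFun₂ this j i

lemma sum_christoffel_lower {y : Coord n} (hy : y ∈ V) (e a b : Fin n) :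
    ∑ m, christoffel G m e a y * G y ![b, m] =
      (1 / 2) * (partialDeriv e (fun x => G x ![a, b]) y + partialDeriv a (fun x => G x ![e, b]) y
        - partialDeriv b (fun x => G x ![e, a]) y) := by
  unfold christoffel
  simp only [mul_assoc, ← Finset.mul_sum, Finset.sum_mul]
  congr 1
  rw [Finset.sum_comm]
  have : ∀ l, ∑ m, invMetric G y m l * ((partialDeriv e (fun x => G x ![a, l]) y +
      partialDeriv a (fun x => G x ![e, l]) y - partialDeriv l (fun x => G x ![e, a]) y) *
        G y ![b, m]) = (if b = l then 1 else 0) * (partialDeriv e (fun x => G x ![a, l]) y +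
      partialDeriv a (fun x => G x ![e, l]) y - partialDeriv l (fun x => G x ![e, a]) y) :=
    fun l => by
      rw [← hG.sum_mul_invMetric hy, Finset.sum_mul]
      exact Finset.sum_congr rfl fun m _ => by ring
  simp [this]

/-- Metric compatibility ∇g = 0, written out with Christoffel symbols. -/
lemma partialDeriv_metric {y : Coord n} (hy : y ∈ V) (e a b : Fin n) :
    partialDeriv e (fun x => G x ![a, b]) y =
      ∑ m, (christoffel G m e a y * G y ![m, b] + christoffel G m e b y * G y ![a, m]) := by
  rw [Finset.sum_add_distrib]
  have h1 : ∑ m, christoffel G m e a y * G y ![m, b] = ∑ m, christoffel G m e a y * G y ![b, m] :=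
    Finset.sum_congr rfl fun m _ => by rw [hG.symm y hy]
  rw [h1, hG.sum_christoffel_lower hy, hG.sum_christoffel_lower hy,
    partialDeriv_congr hG.isOpen (fun x hx => hG.symm x hx b a) hy e,
    partialDeriv_congr hG.isOpen (fun x hx => hG.symm x hx e b) hy a,
    partialDeriv_congr hG.isOpen (fun x hx => hG.symm x hx e a) hy b]
  ring

lemma partialDeriv_invMetric {y : Coord n} (hy : y ∈ V) (e a b : Fin n) :
    partialDeriv e (fun x => invMetric G x a b) y =
      - ∑ m, (christoffel G a e m y * invMetric G y m b
        + christoffel G b e m y * invMetric G y a m) := by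
  let g : Matrix (Fin n) (Fin n) ℝ := Matrix.of fun i j => G y ![i, j]
  let h : Matrix (Fin n) (Fin n) ℝ := invMetric G y
  let Γ : Matrix (Fin n) (Fin n) ℝ := Matrix.of fun m a => christoffel G m e a y
  let dg : Matrix (Fin n) (Fin n) ℝ := Matrix.of fun i j => partialDeriv e (fun x => G x ![i, j]) y
  let dh : Matrix (Fin n) (Fin n) ℝ :=
    Matrix.of fun i j => partialDeriv e (fun x => invMetric G x i j) y
  have hgh : g * h = 1 := hG.mul_invMetric hy
  have hhg : h * g = 1 := hG.invMetric_mul hy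
  -- Differentiating h g = 1 and inserting the compatibility formula for dg determines dh by matrix
  -- algebra.
  have h1 : dh * g + h * dg = 0 := by
    ext i j
    have h2 := partialDeriv_congr hG.isOpen (fun x hx => hG.sum_invMetric_mul hx i j) hy e
    rw [partialDeriv_const, partialDeriv_sum _ fun m =>
      (hG.analyticAt_invMetric hy _ _).fun_mul (hG.analytic _ y hy)] at h2
    simp only [Matrix.add_apply, Matrix.mul_apply, Matrix.zero_apply, ← Finset.sum_add_distrib]
    rw [← h2]
    refine Finset.sum_congr rfl fun m _ => ?_
    rw [partialDeriv_mul (hG.analyticAt_invMetric hy _ _) (hG.analytic _ y hy)]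
    rfl
  have h3 : dg = Γ.transpose * g + g * Γ := by
    ext i j
    simp only [Matrix.add_apply, Matrix.mul_apply, ← Finset.sum_add_distrib]
    refine (hG.partialDeriv_metric hy e i j).trans (Finset.sum_congr rfl fun m _ => ?_)
    simp only [Matrix.transpose_apply, Matrix.of_apply, Γ, g]
    ring
  have h4 : dh = -(Γ * h + h * Γ.transpose) := by
    have h5 : dh * g = -(h * dg) := eq_neg_of_add_eq_zero_left h1
    calc dh = dh * g * h := by rw [mul_assoc, hgh, mul_one]
      _ = -(h * (Γ.transpose * g + g * Γ)) * h := by rw [h5, h3]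
      _ = -(h * Γ.transpose * (g * h) + h * g * (Γ * h)) := by noncomm_ring
      _ = _ := by rw [hgh, hhg, mul_one, one_mul, add_comm]
  have h6 := congrFun₂ h4 a b
  simp only [Matrix.neg_apply, Matrix.add_apply, Matrix.mul_apply, ← Finset.sum_add_distrib] at h6
  refine h6.trans (congrArg _ (Finset.sum_congr rfl fun m _ => ?_))
  simp only [Matrix.transpose_apply, Matrix.of_apply, Γ, h]
  ring

omit hG in
lemma analyticAt_act {A : Coord n → Fin n → Fin n → ℝ} {T : Components n k} {y : Coord n}
    (hA : ∀ m a, AnalyticAt ℝ (fun x => A x m a) y) (hT : ∀ v, AnalyticAt ℝ (fun x => T x v) y)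
    (v : Fin k → Fin n) : AnalyticAt ℝ (fun x => act (A x) (T x) v) y := by
  simp only [act_apply]
  exact Finset.analyticAt_fun_sum _ fun s _ => Finset.analyticAt_fun_sum _ fun m _ =>
    (hA _ _).mul (hT _)

lemma analyticField_dirDeriv {T : Components n k} (hT : AnalyticField T V) (e : Fin n) :
    AnalyticField (dirDeriv G e T) V := fun v y hy =>
  (analyticAt_partialDeriv (hT v y hy) e).sub
    (analyticAt_act (fun m a => hG.analyticAt_christoffel hy m e a) (fun v => hT v y hy) v)

lemma analyticField_covDeriv {T : Components n k} (hT : AnalyticField T V) :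
    AnalyticField (covDeriv G T) V := fun v y hy =>
  hG.analyticField_dirDeriv hT (v (Fin.last k)) _ y hy

omit hG in
lemma partialDeriv_act {A : Coord n → Fin n → Fin n → ℝ} {T : Components n k} {y : Coord n}
    (hA : ∀ m a, AnalyticAt ℝ (fun x => A x m a) y) (hT : ∀ v, AnalyticAt ℝ (fun x => T x v) y)
    (e : Fin n) (v : Fin k → Fin n) : partialDeriv e (fun x => act (A x) (T x) v) y =
      act (fun m a => partialDeriv e (fun x => A x m a) y) (T y) v +
        act (A y) (fun w => partialDeriv e (fun x => T x w) y) v := by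
  simp only [act_apply]
  rw [partialDeriv_sum _ fun s => Finset.analyticAt_fun_sum _ fun m _ => (hA _ _).fun_mul (hT _),
    ← Finset.sum_add_distrib]
  refine Finset.sum_congr rfl fun s _ => ?_
  rw [partialDeriv_sum _ fun m => (hA _ _).fun_mul (hT _), ← Finset.sum_add_distrib]
  exact Finset.sum_congr rfl fun m _ => partialDeriv_mul (hA _ _) (hT _) e

/-- The second directional covariant derivative in terms of partial derivatives. -/
lemma dirDeriv_dirDeriv {T : Components n k} (hT : AnalyticField T V) {y : Coord n} (hy : y ∈ V)
    (e f : Fin n) (v : Fin k → Fin n) :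
    dirDeriv G f (dirDeriv G e T) y v =
      partialDeriv f (partialDeriv e (fun x => T x v)) y
        - act (fun m a => partialDeriv f (christoffel G m e a) y) (T y) v
        - act (fun m a => christoffel G m e a y) (fun w => partialDeriv f (fun x => T x w) y) v
        - act (fun m a => christoffel G m f a y) (fun w => partialDeriv e (fun x => T x w) y) v
        + act (fun m a => christoffel G m f a y) (act (fun m a => christoffel G m e a y) (T y)) v
    := by
  have hΓ : ∀ m a, AnalyticAt ℝ (fun x => christoffel G m e a x) y := fun m a =>
    hG.analyticAt_christoffel hy m e a
  have hT' : ∀ v, AnalyticAt ℝ (fun x => T x v) y := fun v => hT v y hy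
  rw [dirDeriv]
  have h1 : partialDeriv f (fun x => dirDeriv G e T x v) y =
      partialDeriv f (partialDeriv e (fun x => T x v)) y
        - (act (fun m a => partialDeriv f (christoffel G m e a) y) (T y) v
        + act (fun m a => christoffel G m e a y) (fun w => partialDeriv f (fun x => T x w) y) v) := by
    rw [← partialDeriv_act hΓ hT']
    exact partialDeriv_sub (analyticAt_partialDeriv (hT' v) e) (analyticAt_act hΓ hT' v) f
  have h2 : dirDeriv G e T y = (fun w => partialDeriv e (fun x => T x w) y)
      - act (fun m a => christoffel G m e a y) (T y) := rfl
  rw [h1, h2, map_sub, Pi.sub_apply]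
  ring

/-- The Ricci identity. -/
lemma covDeriv_covDeriv_sub {T : Components n k} (hT : AnalyticField T V) {y : Coord n} (hy : y ∈ V)
    (e f : Fin n) (v w : Fin (k + 2) → Fin n) (hv : v (Fin.last _) = f)
    (hv' : v (Fin.last k).castSucc = e) (hw : w (Fin.last _) = e)
    (hw' : w (Fin.last k).castSucc = f) (hvw : ∀ s : Fin k, v s.castSucc.castSucc =
      w s.castSucc.castSucc) :
    covDeriv G (covDeriv G T) y v - covDeriv G (covDeriv G T) y w =
      act (fun m a => riemannUp G m a e f y) (T y) fun s => v s.castSucc.castSucc := by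
  have hvw' : (fun s : Fin k => w s.castSucc.castSucc) = fun s => v s.castSucc.castSucc :=
    funext fun s => (hvw s).symm
  rw [covDeriv_covDeriv, covDeriv_covDeriv, hv, hv', hw, hw', hvw',
    hG.dirDeriv_dirDeriv hT hy, hG.dirDeriv_dirDeriv hT hy]
  set u : Fin k → Fin n := fun s => v s.castSucc.castSucc
  rw [partialDeriv_comm (hT u y hy) e f]
  have h1 : ∑ m, christoffel G m f e y * dirDeriv G m T y u =
      ∑ m, christoffel G m e f y * dirDeriv G m T y u :=
    Finset.sum_congr rfl fun m _ => by rw [hG.christoffel_symm hy]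
  -- The terms quadratic in the Christoffel symbols form a commutator of derivations, hence one
  -- derivation. Together with the derivatives of the symbols it is the action of the curvature.
  have h2 := act_comm (fun m a => christoffel G m f a y) (fun m a => christoffel G m e a y) (T y) u
  have h3 : ∀ i j, (fun m a => partialDeriv i (christoffel G m j a) y) =
      fun m a => partialDeriv i (christoffel G m a j) y := fun i j => by
    ext m a
    exact partialDeriv_congr hG.isOpen (fun x hx => hG.christoffel_symm hx m j a) hy i
  have h4 : act (fun m a => riemannUp G m a e f y) (T y) u =
      act (fun m a => partialDeriv e (christoffel G m a f) y) (T y) u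
      - act (fun m a => partialDeriv f (christoffel G m a e) y) (T y) u
      + act (fun d a => ∑ m, (christoffel G m f a y * christoffel G d e m y
        - christoffel G m e a y * christoffel G d f m y)) (T y) u := by
    rw [← act_sub_left, ← act_add_left]
    refine congrArg (fun A => act A (T y) u) ?_
    ext d a
    unfold riemannUp
    congr 1
    refine Finset.sum_congr rfl fun m _ => ?_
    rw [hG.christoffel_symm hy d m e, hG.christoffel_symm hy m a f, hG.christoffel_symm hy d m f,
      hG.christoffel_symm hy m a e]
    ring
  rw [h4, h1, ← h2, h3 f e, h3 e f]
  ring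

end IsMetricOn

end TensorCalculus

/-! ### Parallel operators and the projection onto Weyl candidates -/

section Parallel

variable {n k l m : ℕ}

/-- Pointwise linear operators that preserve analyticity and commute with the covariant
derivative. -/
def IsParallel (G : Components n 2) (V : Set (Coord n))
    (P : Coord n → TensorArray n k →ₗ[ℝ] TensorArray n l) : Prop :=
  ∀ T : Components n k, AnalyticField T V → AnalyticField (fun y => P y (T y)) V ∧
    ∀ y ∈ V, ∀ e, dirDeriv G e (fun y => P y (T y)) y = P y (dirDeriv G e T y)

lemma dirDeriv_congr {G : Components n 2} {V : Set (Coord n)} (hV : IsOpen V)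
    {T S : Components n k} (h : ∀ x ∈ V, T x = S x) {y : Coord n} (hy : y ∈ V) (e : Fin n) :
    dirDeriv G e T y = dirDeriv G e S y := by
  ext v
  unfold dirDeriv
  rw [partialDeriv_congr hV (fun x hx => congrFun (h x hx) v) hy, h y hy]

lemma act_two (A : Fin n → Fin n → ℝ) (T : TensorArray n 2) (a b : Fin n) :
    act A T ![a, b] = ∑ m, (A m a * T ![m, b] + A m b * T ![a, m]) := by
  have h0 : ∀ m, Function.update ![a, b] 0 m = ![m, b] := fun m => by
    ext i; fin_cases i <;> rfl
  have h1 : ∀ m, Function.update ![a, b] 1 m = ![a, m] := fun m => by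
    ext i; fin_cases i <;> rfl
  rw [act_apply, Fin.sum_univ_two, ← Finset.sum_add_distrib]
  simp only [h0, h1]
  rfl

lemma act_four (A : Fin n → Fin n → ℝ) (T : TensorArray n 4) (a b c d : Fin n) :
    act A T ![a, b, c, d] = ∑ m, (A m a * T ![m, b, c, d] + A m b * T ![a, m, c, d]
      + A m c * T ![a, b, m, d] + A m d * T ![a, b, c, m]) := by
  have h0 : ∀ m, Function.update ![a, b, c, d] 0 m = ![m, b, c, d] := fun m => by
    ext i; fin_cases i <;> rfl
  have h1 : ∀ m, Function.update ![a, b, c, d] 1 m = ![a, m, c, d] := fun m => by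
    ext i; fin_cases i <;> rfl
  have h2 : ∀ m, Function.update ![a, b, c, d] 2 m = ![a, b, m, d] := fun m => by
    ext i; fin_cases i <;> rfl
  have h3 : ∀ m, Function.update ![a, b, c, d] 3 m = ![a, b, c, m] := fun m => by
    ext i; fin_cases i <;> rfl
  rw [act_apply, Fin.sum_univ_four]
  simp only [Finset.sum_add_distrib, h0, h1, h2, h3]
  rfl

lemma vec_two (v : Fin 2 → Fin n) : v = ![v 0, v 1] := by
  ext i; fin_cases i <;> rfl

lemma vec_four (v : Fin 4 → Fin n) : v = ![v 0, v 1, v 2, v 3] := by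
  ext i; fin_cases i <;> rfl

/-- The permutation of the slots of a tensor. -/
def permSlots (σ : Equiv.Perm (Fin k)) : TensorArray n k →ₗ[ℝ] TensorArray n k :=
  LinearMap.funLeft ℝ ℝ fun v => v ∘ σ

lemma permSlots_apply (σ : Equiv.Perm (Fin k)) (T : TensorArray n k) (v : Fin k → Fin n) :
    permSlots σ T v = T (v ∘ σ) := rfl

lemma act_permSlots (σ : Equiv.Perm (Fin k)) (A : Fin n → Fin n → ℝ) (T : TensorArray n k) :
    act A (permSlots σ T) = permSlots σ (act A T) := by
  ext v
  simp only [act_apply, permSlots_apply]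
  refine (Equiv.sum_comp σ fun s => ∑ m, A m (v s) * T (Function.update v s m ∘ σ)).symm.trans ?_
  refine Finset.sum_congr rfl fun s _ => Finset.sum_congr rfl fun m _ => ?_
  congr 2
  ext i
  by_cases h : i = s
  · subst h; simp
  · simp [Function.update_of_ne h, Function.update_of_ne (σ.injective.ne h)]

/-- The contraction of the first and third slots. -/
def contract (h : Matrix (Fin n) (Fin n) ℝ) : TensorArray n 4 →ₗ[ℝ] TensorArray n 2 where
  toFun T v := ∑ a, ∑ c, h a c * T ![a, v 0, c, v 1]
  map_add' T S := by ext v; simp [mul_add, Finset.sum_add_distrib]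
  map_smul' r T := by
    ext v
    simp only [Pi.smul_apply, smul_eq_mul, Finset.mul_sum, RingHom.id_apply]
    exact Finset.sum_congr rfl fun s _ => Finset.sum_congr rfl fun m _ => by ring

lemma contract_apply (h : Matrix (Fin n) (Fin n) ℝ) (T : TensorArray n 4) (b d : Fin n) :
    contract h T ![b, d] = ∑ a, ∑ c, h a c * T ![a, b, c, d] := rfl

/-- The pure trace tensor `(h^{ab} K_{ab}) g`. -/
def traceMul (h : Matrix (Fin n) (Fin n) ℝ) (g : TensorArray n 2) :
    TensorArray n 2 →ₗ[ℝ] TensorArray n 2 where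
  toFun K v := (∑ a, ∑ c, h a c * K ![a, c]) * g v
  map_add' T S := by ext v; simp [mul_add, Finset.sum_add_distrib, add_mul]
  map_smul' r T := by
    ext v
    simp only [Pi.smul_apply, smul_eq_mul, Finset.mul_sum, Finset.sum_mul, RingHom.id_apply]
    exact Finset.sum_congr rfl fun s _ => Finset.sum_congr rfl fun m _ => by ring

lemma traceMul_apply (h : Matrix (Fin n) (Fin n) ℝ) (g K : TensorArray n 2) (v : Fin 2 → Fin n) :
    traceMul h g K v = (∑ a, ∑ c, h a c * K ![a, c]) * g v := rfl

/-- The tensor product `g ⊗ K`. -/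
def metricMul (g : TensorArray n 2) : TensorArray n 2 →ₗ[ℝ] TensorArray n 4 where
  toFun K v := g ![v 0, v 1] * K ![v 2, v 3]
  map_add' T S := by ext v; simp; ring
  map_smul' r T := by ext v; simp; ring

lemma metricMul_apply (g K : TensorArray n 2) (a b c d : Fin n) :
    metricMul g K ![a, b, c, d] = g ![a, b] * K ![c, d] := rfl

/-- The permutation `(a, b, c, d) ↦ (a, c, d, b)`. -/
def permACDB : Equiv.Perm (Fin 4) := ⟨![0, 2, 3, 1], ![0, 3, 1, 2], by decide, by decide⟩

/-- The permutation `(a, b, c, d) ↦ (a, d, b, c)`. -/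
def permADBC : Equiv.Perm (Fin 4) := ⟨![0, 3, 1, 2], ![0, 2, 3, 1], by decide, by decide⟩

/-- The permutation `(a, b, c, d) ↦ (c, d, a, b)`. -/
def permCDAB : Equiv.Perm (Fin 4) := ⟨![2, 3, 0, 1], ![2, 3, 0, 1], by decide, by decide⟩

/-- The permutation `(a, b, c, d) ↦ (a, c, b, d)`. -/
def permACBD : Equiv.Perm (Fin 4) := ⟨![0, 2, 1, 3], ![0, 2, 1, 3], by decide, by decide⟩

/-- The permutation `(a, b, c, d) ↦ (b, a, c, d)`. -/
def permBACD : Equiv.Perm (Fin 4) := ⟨![1, 0, 2, 3], ![1, 0, 2, 3], by decide, by decide⟩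

/-- The permutation `(a, b, c, d) ↦ (a, b, d, c)`. -/
def permABDC : Equiv.Perm (Fin 4) := ⟨![0, 1, 3, 2], ![0, 1, 3, 2], by decide, by decide⟩

section PermLemmas

variable (T : TensorArray n 4) (a b c d : Fin n)

lemma permSlots_ACDB : permSlots permACDB T ![a, b, c, d] = T ![a, c, d, b] :=
  congrArg T (by ext i; fin_cases i <;> rfl)

lemma permSlots_ADBC : permSlots permADBC T ![a, b, c, d] = T ![a, d, b, c] :=
  congrArg T (by ext i; fin_cases i <;> rfl)

lemma permSlots_CDAB : permSlots permCDAB T ![a, b, c, d] = T ![c, d, a, b] :=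
  congrArg T (by ext i; fin_cases i <;> rfl)

lemma permSlots_ACBD : permSlots permACBD T ![a, b, c, d] = T ![a, c, b, d] :=
  congrArg T (by ext i; fin_cases i <;> rfl)

lemma permSlots_BACD : permSlots permBACD T ![a, b, c, d] = T ![b, a, c, d] :=
  congrArg T (by ext i; fin_cases i <;> rfl)

lemma permSlots_ABDC : permSlots permABDC T ![a, b, c, d] = T ![a, b, d, c] :=
  congrArg T (by ext i; fin_cases i <;> rfl)

end PermLemmas

/-- The Kulkarni–Nomizu product with `g`. -/
def kulkarniNomizu (g : TensorArray n 2) : TensorArray n 2 →ₗ[ℝ] TensorArray n 4 :=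
  (LinearMap.id - permSlots permABDC) ∘ₗ (LinearMap.id - permSlots permBACD) ∘ₗ
    permSlots permACBD ∘ₗ metricMul g

lemma kulkarniNomizu_apply (g K : TensorArray n 2) (a b c d : Fin n) :
    kulkarniNomizu g K ![a, b, c, d] = g ![a, c] * K ![b, d] + g ![b, d] * K ![a, c]
      - g ![a, d] * K ![b, c] - g ![b, c] * K ![a, d] := by
  simp only [kulkarniNomizu, LinearMap.comp_apply, LinearMap.sub_apply, LinearMap.id_apply,
    Pi.sub_apply, permSlots_ABDC, permSlots_BACD, permSlots_ACBD, metricMul_apply]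
  ring

/-- The projection onto arrays with the symmetries of the Riemann tensor. -/
def youngProj : TensorArray n 4 →ₗ[ℝ] TensorArray n 4 :=
  (1 / 24 : ℝ) • ((2 : ℝ) • LinearMap.id - permSlots permACDB - permSlots permADBC) ∘ₗ
    (LinearMap.id + permSlots permCDAB) ∘ₗ (LinearMap.id - permSlots permABDC) ∘ₗ
      (LinearMap.id - permSlots permBACD)

/-- The removal of the traces of an array with the symmetries of the Riemann tensor. -/
def traceFreeProj (h : Matrix (Fin n) (Fin n) ℝ) (g : TensorArray n 2) :
    TensorArray n 4 →ₗ[ℝ] TensorArray n 4 :=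
  LinearMap.id - (1 / ((n : ℝ) - 2)) • kulkarniNomizu g ∘ₗ
    (LinearMap.id - (1 / (2 * ((n : ℝ) - 1))) • traceMul h g) ∘ₗ contract h

/-- The projection onto Weyl candidates. -/
def weylProj (h : Matrix (Fin n) (Fin n) ℝ) (g : TensorArray n 2) :
    TensorArray n 4 →ₗ[ℝ] TensorArray n 4 :=
  traceFreeProj h g ∘ₗ youngProj

lemma sum_swap_outer (f : Fin n → Fin n → Fin n → ℝ) :
    ∑ a, ∑ c, ∑ m, f a c m = ∑ a, ∑ c, ∑ m, f m c a := by
  rw [Finset.sum_comm]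
  conv_rhs => rw [Finset.sum_comm]
  exact Finset.sum_congr rfl fun c _ => Finset.sum_comm

lemma sum_rotate (f : Fin n → Fin n → Fin n → ℝ) :
    ∑ m, ∑ a, ∑ c, f m a c = ∑ a, ∑ c, ∑ m, f m a c := by
  rw [Finset.sum_comm]
  exact Finset.sum_congr rfl fun c _ => Finset.sum_comm

/-! ### Closure properties and examples of parallel operators -/

namespace IsParallel

variable {G : Components n 2} {V : Set (Coord n)}

lemma id : IsParallel G V fun _ => (LinearMap.id : TensorArray n k →ₗ[ℝ] TensorArray n k) :=
  fun _ hT => ⟨hT, fun _ _ _ => rfl⟩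

lemma add {P Q : Coord n → TensorArray n k →ₗ[ℝ] TensorArray n l} (hP : IsParallel G V P)
    (hQ : IsParallel G V Q) : IsParallel G V fun y => P y + Q y := fun T hT => by
  refine ⟨fun v y hy => ((hP T hT).1 v y hy).add ((hQ T hT).1 v y hy), fun y hy e => ?_⟩
  have h1 := (hP T hT).2 y hy e
  have h2 := (hQ T hT).2 y hy e
  rw [LinearMap.add_apply, ← h1, ← h2]
  ext v
  simp only [dirDeriv, LinearMap.add_apply, Pi.add_apply, map_add]
  rw [partialDeriv_add ((hP T hT).1 v y hy) ((hQ T hT).1 v y hy)]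
  ring

lemma smul (c : ℝ) {P : Coord n → TensorArray n k →ₗ[ℝ] TensorArray n l}
    (hP : IsParallel G V P) : IsParallel G V fun y => c • P y := fun T hT => by
  refine ⟨fun v y hy => analyticAt_const.mul ((hP T hT).1 v y hy), fun y hy e => ?_⟩
  have h1 := (hP T hT).2 y hy e
  rw [LinearMap.smul_apply, ← h1]
  ext v
  simp only [dirDeriv, LinearMap.smul_apply, Pi.smul_apply, map_smul, smul_eq_mul]
  rw [partialDeriv_mul analyticAt_const ((hP T hT).1 v y hy), partialDeriv_const]
  ring

lemma sub {P Q : Coord n → TensorArray n k →ₗ[ℝ] TensorArray n l} (hP : IsParallel G V P)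
    (hQ : IsParallel G V Q) : IsParallel G V fun y => P y - Q y := by
  have : (fun y => P y - Q y) = fun y => P y + (-1 : ℝ) • Q y := by
    ext y
    simp [sub_eq_add_neg]
  rw [this]
  exact hP.add (hQ.smul (-1))

lemma comp {P : Coord n → TensorArray n l →ₗ[ℝ] TensorArray n m}
    {Q : Coord n → TensorArray n k →ₗ[ℝ] TensorArray n l} (hP : IsParallel G V P)
    (hQ : IsParallel G V Q) : IsParallel G V fun y => P y ∘ₗ Q y := fun T hT => by
  have h1 := hQ T hT
  have h2 := hP _ h1.1
  refine ⟨h2.1, fun y hy e => ?_⟩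
  exact (h2.2 y hy e).trans (congrArg (P y) (h1.2 y hy e))

lemma of_permSlots (σ : Equiv.Perm (Fin k)) : IsParallel G V fun _ => permSlots (n := n) σ :=
  fun T hT => by
    refine ⟨fun v y hy => hT _ y hy, fun y hy e => ?_⟩
    ext v
    simp only [dirDeriv, act_permSlots]
    rfl

/-- The derivative of the inverse metric supplies exactly the Christoffel terms of the two
contracted slots, leaving only those of the free slots. The proof is a renaming of summation indices
to exhibit this cancellation. -/
lemma of_contract (hG : IsMetricOn G V) : IsParallel G V fun y => contract (invMetric G y) :=
  fun T hT => by
    have ha : ∀ y ∈ V, ∀ b d a c,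
        AnalyticAt ℝ (fun x => invMetric G x a c * T x ![a, b, c, d]) y := fun y hy b d a c =>
      (hG.analyticAt_invMetric hy a c).fun_mul (hT _ y hy)
    refine ⟨fun v y hy => ?_, fun y hy e => ?_⟩
    · change AnalyticAt ℝ (fun x => ∑ a, ∑ c, invMetric G x a c * T x ![a, v 0, c, v 1]) y
      exact Finset.analyticAt_fun_sum _ fun a _ => Finset.analyticAt_fun_sum _
        fun c _ => ha y hy _ _ a c
    ext v
    obtain ⟨b, d, rfl⟩ : ∃ b d, v = ![b, d] := ⟨_, _, vec_two v⟩
    simp only [dirDeriv, act_two, contract_apply, act_four]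
    rw [partialDeriv_sum _ fun a => Finset.analyticAt_fun_sum _ fun c _ => ha y hy b d a c]
    have e1 : ∀ a, partialDeriv e (fun x => ∑ c, invMetric G x a c * T x ![a, b, c, d]) y =
        ∑ c, (-(∑ m, (christoffel G a e m y * invMetric G y m c
          + christoffel G c e m y * invMetric G y a m)) * T y ![a, b, c, d]
          + invMetric G y a c * partialDeriv e (fun x => T x ![a, b, c, d]) y) := fun a => by
      rw [partialDeriv_sum _ fun c => ha y hy b d a c]
      refine Finset.sum_congr rfl fun c _ => ?_
      rw [partialDeriv_mul (hG.analyticAt_invMetric hy a c) (hT _ y hy),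
        hG.partialDeriv_invMetric hy]
    simp only [e1]
    set h := invMetric G y
    have e2 : ∑ a, ∑ c, ∑ m, christoffel G a e m y * h m c * T y ![a, b, c, d] =
        ∑ a, ∑ c, ∑ m, h a c * (christoffel G m e a y * T y ![m, b, c, d]) := by
      rw [sum_swap_outer]
      exact Finset.sum_congr rfl fun a _ => Finset.sum_congr rfl fun c _ =>
        Finset.sum_congr rfl fun m _ => by ring
    have e3 : ∑ a, ∑ c, ∑ m, christoffel G c e m y * h a m * T y ![a, b, c, d] =
        ∑ a, ∑ c, ∑ m, h a c * (christoffel G m e c y * T y ![a, b, m, d]) := by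
      refine Finset.sum_congr rfl fun a _ => ?_
      rw [Finset.sum_comm]
      exact Finset.sum_congr rfl fun c _ => Finset.sum_congr rfl fun m _ => by ring
    have e4 : ∑ m, ∑ a, ∑ c, christoffel G m e b y * (h a c * T y ![a, m, c, d]) =
        ∑ a, ∑ c, ∑ m, h a c * (christoffel G m e b y * T y ![a, m, c, d]) := by
      rw [sum_rotate]
      exact Finset.sum_congr rfl fun a _ => Finset.sum_congr rfl fun c _ =>
        Finset.sum_congr rfl fun m _ => by ring
    have e5 : ∑ m, ∑ a, ∑ c, christoffel G m e d y * (h a c * T y ![a, b, c, m]) =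
        ∑ a, ∑ c, ∑ m, h a c * (christoffel G m e d y * T y ![a, b, c, m]) := by
      rw [sum_rotate]
      exact Finset.sum_congr rfl fun a _ => Finset.sum_congr rfl fun c _ =>
        Finset.sum_congr rfl fun m _ => by ring
    simp only [mul_sub, neg_mul, Finset.sum_mul, Finset.mul_sum, add_mul, mul_add,
      Finset.sum_add_distrib, Finset.sum_sub_distrib, Finset.sum_neg_distrib] at e2 e3 e4 e5 ⊢
    linarith

lemma of_traceMul (hG : IsMetricOn G V) :
    IsParallel G V fun y => traceMul (invMetric G y) (G y) := fun T hT => by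
  have ha : ∀ y ∈ V, ∀ a c, AnalyticAt ℝ (fun x => invMetric G x a c * T x ![a, c]) y :=
    fun y hy a c => (hG.analyticAt_invMetric hy a c).fun_mul (hT _ y hy)
  have hs : ∀ y ∈ V, AnalyticAt ℝ (fun x => ∑ a, ∑ c, invMetric G x a c * T x ![a, c]) y :=
    fun y hy => Finset.analyticAt_fun_sum _ fun a _ => Finset.analyticAt_fun_sum _
        fun c _ => ha y hy a c
  refine ⟨fun v y hy => (hs y hy).fun_mul (hG.analytic v y hy), fun y hy e => ?_⟩
  ext v
  obtain ⟨b, d, rfl⟩ : ∃ b d, v = ![b, d] := ⟨_, _, vec_two v⟩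
  simp only [dirDeriv, act_two, traceMul_apply]
  rw [partialDeriv_mul (hs y hy) (hG.analytic _ y hy), hG.partialDeriv_metric hy]
  rw [partialDeriv_sum _ fun a => Finset.analyticAt_fun_sum _ fun c _ => ha y hy a c]
  have e1 : ∀ a, partialDeriv e (fun x => ∑ c, invMetric G x a c * T x ![a, c]) y =
      ∑ c, (-(∑ m, (christoffel G a e m y * invMetric G y m c
        + christoffel G c e m y * invMetric G y a m)) * T y ![a, c]
        + invMetric G y a c * partialDeriv e (fun x => T x ![a, c]) y) := fun a => by
    rw [partialDeriv_sum _ fun c => ha y hy a c]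
    refine Finset.sum_congr rfl fun c _ => ?_
    rw [partialDeriv_mul (hG.analyticAt_invMetric hy a c) (hT _ y hy),
      hG.partialDeriv_invMetric hy]
  simp only [e1]
  set h := invMetric G y
  have e2 : ∑ a, ∑ c, ∑ m, christoffel G a e m y * h m c * T y ![a, c] =
      ∑ a, ∑ c, ∑ m, h a c * (christoffel G m e a y * T y ![m, c]) := by
    rw [sum_swap_outer]
    exact Finset.sum_congr rfl fun a _ => Finset.sum_congr rfl fun c _ =>
      Finset.sum_congr rfl fun m _ => by ring
  have e3 : ∑ a, ∑ c, ∑ m, christoffel G c e m y * h a m * T y ![a, c] =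
      ∑ a, ∑ c, ∑ m, h a c * (christoffel G m e c y * T y ![a, m]) := by
    refine Finset.sum_congr rfl fun a _ => ?_
    rw [Finset.sum_comm]
    exact Finset.sum_congr rfl fun c _ => Finset.sum_congr rfl fun m _ => by ring
  have e4 : ∑ m, (christoffel G m e b y * ((∑ a, ∑ c, h a c * T y ![a, c]) * G y ![m, d])
      + christoffel G m e d y * ((∑ a, ∑ c, h a c * T y ![a, c]) * G y ![b, m])) =
      (∑ a, ∑ c, h a c * T y ![a, c]) * ∑ m, (christoffel G m e b y * G y ![m, d]
        + christoffel G m e d y * G y ![b, m]) := by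
    rw [Finset.mul_sum]
    exact Finset.sum_congr rfl fun m _ => by ring
  rw [e4, add_sub_cancel_right]
  congr 1
  simp only [mul_sub, neg_mul, Finset.sum_mul, Finset.mul_sum, add_mul, mul_add,
    Finset.sum_add_distrib, Finset.sum_sub_distrib, Finset.sum_neg_distrib] at e2 e3 ⊢
  linarith

/-- The Leibniz rule together with ∇g = 0. -/
lemma of_metricMul (hG : IsMetricOn G V) : IsParallel G V fun y => metricMul (G y) :=
  fun T hT => by
    refine ⟨fun v y hy => (hG.analytic _ y hy).fun_mul (hT _ y hy), fun y hy e => ?_⟩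
    ext v
    obtain ⟨a, b, c, d, rfl⟩ : ∃ a b c d, v = ![a, b, c, d] := ⟨_, _, _, _, vec_four v⟩
    simp only [dirDeriv, act_two, act_four, metricMul_apply]
    rw [partialDeriv_mul (hG.analytic _ y hy) (hT _ y hy), hG.partialDeriv_metric hy, mul_sub,
      Finset.mul_sum, Finset.sum_mul, sub_eq_sub_iff_add_eq_add, add_right_comm,
      ← Finset.sum_add_distrib, add_comm]
    congr 1
    exact Finset.sum_congr rfl fun m _ => by ring

lemma of_kulkarniNomizu (hG : IsMetricOn G V) :
    IsParallel G V fun y => kulkarniNomizu (G y) :=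
  (id.sub (of_permSlots _)).comp ((id.sub (of_permSlots _)).comp
    ((of_permSlots _).comp (of_metricMul hG)))

/-- The projection is composed of slot permutations, contractions and products with g, each of which
is parallel. -/
lemma of_weylProj (hG : IsMetricOn G V) :
    IsParallel G V fun y => weylProj (invMetric G y) (G y) := by
  refine comp (id.sub (smul _ ((of_kulkarniNomizu hG).comp
    ((id.sub (smul _ (of_traceMul hG))).comp (of_contract hG))))) ?_
  exact smul _ ((((id.smul 2).sub (of_permSlots _)).sub (of_permSlots _)).comp
    ((id.add (of_permSlots _)).comp
      ((id.sub (of_permSlots _)).comp (id.sub (of_permSlots _)))))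

end IsParallel

/-- The pointwise symmetries of the components of a Weyl candidate. -/
structure IsWeylArray (h : Matrix (Fin n) (Fin n) ℝ) (X : TensorArray n 4) : Prop where
  skew_left : ∀ a b c d, X ![b, a, c, d] = -X ![a, b, c, d]
  skew_right : ∀ a b c d, X ![a, b, d, c] = -X ![a, b, c, d]
  cyclic : ∀ a b c d, X ![a, b, c, d] + X ![a, c, d, b] + X ![a, d, b, c] = 0
  trace_eq_zero : ∀ b c, ∑ i, ∑ j, h i j * X ![i, b, c, j] = 0

/-- The classical combination of the four cyclic identities with the two skew symmetries;
tracelessness plays no part. -/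
lemma IsWeylArray.pair_symm {h : Matrix (Fin n) (Fin n) ℝ} {X : TensorArray n 4}
    (hX : IsWeylArray h X) (a b c d : Fin n) : X ![c, d, a, b] = X ![a, b, c, d] := by
  have l := hX.skew_left
  have r := hX.skew_right
  linarith [hX.cyclic a b c d, hX.cyclic b c d a, hX.cyclic c d a b, hX.cyclic d a b c,
    l a b c d, l a c d b, l a d b c, l b c d a, l b d a c, l c d a b, r a b c d, r a c d b,
    r a d b c, r b c d a, r b d a c, r c d a b, l b a c d, l c d b a, r b a c d, r d c a b,
    r c b a d, r c a d b, r d b c a, r d a b c, r c a b d]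

/-- On an array with the curvature symmetries, the two skew-symmetrizations and the pair
symmetrization each multiply by 2 and the cyclic factor multiplies by 3, whence the normalization
1/24. -/
lemma youngProj_apply (T : TensorArray n 4) (a b c d : Fin n) :
    youngProj T ![a, b, c, d] = (1 / 24) *
      (2 * (T ![a, b, c, d] - T ![b, a, c, d] - T ![a, b, d, c] + T ![b, a, d, c]
        + T ![c, d, a, b] - T ![c, d, b, a] - T ![d, c, a, b] + T ![d, c, b, a])
      - (T ![a, c, d, b] - T ![c, a, d, b] - T ![a, c, b, d] + T ![c, a, b, d]
        + T ![d, b, a, c] - T ![d, b, c, a] - T ![b, d, a, c] + T ![b, d, c, a])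
      - (T ![a, d, b, c] - T ![d, a, b, c] - T ![a, d, c, b] + T ![d, a, c, b]
        + T ![b, c, a, d] - T ![b, c, d, a] - T ![c, b, a, d] + T ![c, b, d, a])) := by
  simp only [youngProj, LinearMap.comp_apply, LinearMap.sub_apply, LinearMap.id_apply,
    LinearMap.add_apply, LinearMap.smul_apply, Pi.add_apply, Pi.smul_apply, smul_eq_mul,
    Pi.sub_apply, permSlots_ABDC, permSlots_BACD, permSlots_CDAB, permSlots_ADBC, permSlots_ACDB]
  ring

lemma traceFreeProj_apply (h : Matrix (Fin n) (Fin n) ℝ) (g : TensorArray n 2)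
    (X : TensorArray n 4) : traceFreeProj h g X = X - (1 / ((n : ℝ) - 2)) • kulkarniNomizu g
      (contract h X - (1 / (2 * ((n : ℝ) - 1))) • traceMul h g (contract h X)) := rfl

/-- The symmetries make the Young part act as the identity, and tracelessness annihilates the
Ricci-type contraction, so nothing is subtracted. -/
lemma weylProj_of_isWeylArray {h : Matrix (Fin n) (Fin n) ℝ} (g : TensorArray n 2)
    {X : TensorArray n 4} (hX : IsWeylArray h X) : weylProj h g X = X := by
  have h1 : youngProj X = X := by
    ext v
    obtain ⟨a, b, c, d, rfl⟩ : ∃ a b c d, v = ![a, b, c, d] := ⟨_, _, _, _, vec_four v⟩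
    have l := hX.skew_left
    have r := hX.skew_right
    have p := hX.pair_symm
    rw [youngProj_apply, p a b c d, p a b d c, p b a c d, p b a d c, p a c d b, p a c b d,
      p c a d b, p c a b d, p a d b c, p a d c b, p d a b c, p d a c b, l a b d c, l a b c d,
      l a c d b, l a c b d, l a d b c, l a d c b, r a b c d, r a c d b, r a d b c]
    linarith [hX.cyclic a b c d]
  have h2 : contract h X = 0 := by
    ext v
    obtain ⟨b, d, rfl⟩ : ∃ b d, v = ![b, d] := ⟨_, _, vec_two v⟩
    rw [contract_apply]
    simp only [fun a c => hX.skew_right a b d c, mul_neg, Finset.sum_neg_distrib]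
    rw [hX.trace_eq_zero]
    simp
  rw [weylProj, LinearMap.comp_apply, h1, traceFreeProj_apply, h2]
  simp

/-- The classical Ricci decomposition. The Young part B has the curvature symmetries, and
subtracting 1/(n-2) times the Kulkarni–Nomizu product of g with the Schouten-type tensor K removes
all traces: that product has trace (n-2)K + (tr K) g, which equals (n-2)R by the choice of K. The
bound on n keeps n-1 and n-2 nonzero. -/
lemma isWeylArray_weylProj {h : Matrix (Fin n) (Fin n) ℝ} {g : TensorArray n 2} (hn : 4 ≤ n)
    (hh : ∀ i j, h i j = h j i) (hg : ∀ i j, g ![i, j] = g ![j, i])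
    (hhg : ∀ i j, ∑ m, h i m * g ![m, j] = if i = j then 1 else 0) (T : TensorArray n 4) :
    IsWeylArray h (weylProj h g T) := by
  set B := youngProj T with hB
  have l : ∀ a b c d, B ![b, a, c, d] = -B ![a, b, c, d] := fun a b c d => by
    rw [hB, youngProj_apply, youngProj_apply]; ring
  have r : ∀ a b c d, B ![a, b, d, c] = -B ![a, b, c, d] := fun a b c d => by
    rw [hB, youngProj_apply, youngProj_apply]; ring
  have cyc : ∀ a b c d, B ![a, b, c, d] + B ![a, c, d, b] + B ![a, d, b, c] = 0 :=
    fun a b c d => by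
      rw [hB, youngProj_apply, youngProj_apply, youngProj_apply]; ring
  have pr : ∀ a b c d, B ![c, d, a, b] = B ![a, b, c, d] := fun a b c d => by
    rw [hB, youngProj_apply, youngProj_apply]; ring
  set R := contract h B with hR
  have hRs : ∀ b d, R ![b, d] = R ![d, b] := fun b d => by
    rw [hR, contract_apply, contract_apply, Finset.sum_comm]
    exact Finset.sum_congr rfl fun c _ => Finset.sum_congr rfl fun a _ => by rw [hh, pr]
  set K := R - (1 / (2 * ((n : ℝ) - 1))) • traceMul h g R with hK
  have hKs : ∀ b d, K ![b, d] = K ![d, b] := fun b d => by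
    simp only [hK, Pi.sub_apply, Pi.smul_apply, traceMul_apply, hRs b d, hg b d]
  have hW : ∀ a b c d, weylProj h g T ![a, b, c, d] = B ![a, b, c, d] - (1 / ((n : ℝ) - 2)) *
      (g ![a, c] * K ![b, d] + g ![b, d] * K ![a, c]
      - g ![a, d] * K ![b, c] - g ![b, c] * K ![a, d]) := fun a b c d => by
    rw [← kulkarniNomizu_apply]; rfl
  refine ⟨fun a b c d => ?_, fun a b c d => ?_, fun a b c d => ?_, fun b c => ?_⟩
  · rw [hW, hW, l]; ring
  · rw [hW, hW, r]; ring
  · rw [hW, hW, hW, hKs d b, hKs c b, hKs d c, hg d b, hg c b, hg d c]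
    linear_combination cyc a b c d
  · have hn2 : (n : ℝ) - 2 ≠ 0 := by
      have : (4 : ℝ) ≤ n := by exact_mod_cast hn
      linarith
    have hn1 : (n : ℝ) - 1 ≠ 0 := by
      have : (4 : ℝ) ≤ n := by exact_mod_cast hn
      linarith
    set s := ∑ a, ∑ c, h a c * R ![a, c] with hs
    have hgh' : ∀ (f : Fin n → ℝ) (c : Fin n), ∑ i, ∑ j, h i j * (g ![i, c] * f j) = f c :=
      fun f c => by
        rw [Finset.sum_comm]
        have : ∀ j, ∑ i, h i j * (g ![i, c] * f j) = (if j = c then 1 else 0) * f j := fun j => by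
          rw [← hhg, Finset.sum_mul]
          exact Finset.sum_congr rfl fun i _ => by rw [hh]; ring
        simp [this]
    have hgh'' : ∀ (f : Fin n → ℝ) (c : Fin n), ∑ i, ∑ j, h i j * (g ![c, j] * f i) = f c :=
      fun f c => by
        rw [Finset.sum_comm, ← hgh' f c]
        exact Finset.sum_congr rfl fun i _ => Finset.sum_congr rfl fun j _ => by rw [hh, hg]
    have htr : ∑ i, ∑ j, h i j * g ![i, j] = n := by
      have : ∀ i, ∑ j, h i j * g ![i, j] = 1 := fun i => by
        refine Eq.trans ?_ ((hhg i i).trans (if_pos rfl))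
        exact Finset.sum_congr rfl fun j _ => by rw [hg]
      simp [this]
    have hKtr : ∑ i, ∑ j, h i j * K ![i, j] = s - 1 / (2 * ((n : ℝ) - 1)) * (s * n) := by
      have : ∀ i j, h i j * K ![i, j] = h i j * R ![i, j]
          - 1 / (2 * ((n : ℝ) - 1)) * s * (h i j * g ![i, j]) := fun i j => by
        simp only [hK, Pi.sub_apply, Pi.smul_apply, traceMul_apply, smul_eq_mul]
        ring
      simp only [this, Finset.sum_sub_distrib, ← Finset.mul_sum, htr]
      ring
    have hBtr : ∑ i, ∑ j, h i j * B ![i, b, c, j] = -R ![b, c] := by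
      rw [hR, contract_apply]
      simp only [fun i j => r i b j c, mul_neg, Finset.sum_neg_distrib]
    have e : ∀ i j, h i j * weylProj h g T ![i, b, c, j] = h i j * B ![i, b, c, j]
        - (1 / ((n : ℝ) - 2)) * (h i j * (g ![i, c] * K ![b, j]) + h i j * (g ![b, j] * K ![i, c])
        - K ![b, c] * (h i j * g ![i, j]) - g ![b, c] * (h i j * K ![i, j])) := fun i j => by
      rw [hW]; ring
    simp only [e, Finset.sum_sub_distrib, Finset.sum_add_distrib, ← Finset.mul_sum, hBtr, htr,
      hKtr]
    rw [hgh' (fun j => K ![b, j]) c, hgh'' (fun i => K ![i, c]) b]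
    have : K ![b, c] = R ![b, c] - (1 / (2 * ((n : ℝ) - 1))) * (s * g ![b, c]) := rfl
    rw [this]
    field_simp
    ring

end Parallel

/-! ### Algebra of curvature terms at a point -/

section PointwiseAlgebra

variable {n : ℕ}

lemma antisymmetrize_two {ι : Type*} (T : (Fin 2 → ι) → ℝ) (a b : ι) :
    antisymmetrize T ![a, b] = (1 / 2) * (T ![a, b] - T ![b, a]) := by
  have h : ∀ σ : Equiv.Perm (Fin 2), (fun i => ![a, b] (σ i)) = ![![a, b] (σ 0), ![a, b] (σ 1)] :=
    fun σ => by ext i; fin_cases i <;> rfl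
  have hu : (Finset.univ : Finset (Equiv.Perm (Fin 2))) = {Equiv.refl _, Equiv.swap 0 1} := by
    decide
  unfold antisymmetrize
  simp only [h]
  rw [hu, Finset.sum_insert (by decide), Finset.sum_singleton]
  simp
  ring

lemma antisymmetrize_three {ι : Type*} (T : (Fin 3 → ι) → ℝ) (a b c : ι) :
    antisymmetrize T ![a, b, c] = (1 / 6) * (T ![a, b, c] + T ![b, c, a] + T ![c, a, b]
      - T ![a, c, b] - T ![b, a, c] - T ![c, b, a]) := by
  have h : ∀ σ : Equiv.Perm (Fin 3), (fun i => ![a, b, c] (σ i)) =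
      ![![a, b, c] (σ 0), ![a, b, c] (σ 1), ![a, b, c] (σ 2)] :=
    fun σ => by ext i; fin_cases i <;> rfl
  have hu : (Finset.univ : Finset (Equiv.Perm (Fin 3))) = {Equiv.refl _, Equiv.swap 0 1,
      Equiv.swap 0 2, Equiv.swap 1 2, Equiv.swap 0 1 * Equiv.swap 1 2,
      Equiv.swap 1 2 * Equiv.swap 0 1} := by decide
  unfold antisymmetrize
  simp only [h]
  rw [hu, Finset.sum_insert (by decide), Finset.sum_insert (by decide),
    Finset.sum_insert (by decide), Finset.sum_insert (by decide), Finset.sum_insert (by decide),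
    Finset.sum_singleton]
  simp [Equiv.swap_apply_def, Nat.factorial]
  ring

/-- The antisymmetrization over four indices vanishes if the antisymmetrization over the
transpositions of the first index does. -/
lemma antisymmetrize_four_eq_zero {ι : Type*} {T : (Fin 4 → ι) → ℝ}
    (hT : ∀ a b c d, T ![a, b, c, d] - T ![b, a, c, d] - T ![c, b, a, d] - T ![d, b, c, a] = 0)
    (v : Fin 4 → ι) : antisymmetrize T v = 0 := by
  -- Composing with the transposition (0 j) reverses the sign, so each of the three transposed sums
  -- is minus the signed sum S. Summed over all permutations, the hypothesis then reads 4S = 0.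
  have h1 : ∀ j : Fin 4, j ≠ 0 →
      ∑ σ : Equiv.Perm (Fin 4), ((Equiv.Perm.sign σ : ℤ) : ℝ) * T (fun i => v (σ i)) =
      ∑ σ : Equiv.Perm (Fin 4), -(((Equiv.Perm.sign σ : ℤ) : ℝ) *
        T (fun i => v (σ (Equiv.swap 0 j i)))) := fun j hj => by
    refine (Equiv.sum_comp (Equiv.mulRight (Equiv.swap (0 : Fin 4) j)) _).symm.trans ?_
    refine Finset.sum_congr rfl fun σ _ => ?_
    simp [Equiv.Perm.sign_swap hj.symm]
  have h2 : ∀ σ : Equiv.Perm (Fin 4), T (fun i => v (σ i)) - T (fun i => v (σ (Equiv.swap 0 1 i)))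
      - T (fun i => v (σ (Equiv.swap 0 2 i))) - T (fun i => v (σ (Equiv.swap 0 3 i))) = 0 :=
    fun σ => by
      refine Eq.trans ?_ (hT (v (σ 0)) (v (σ 1)) (v (σ 2)) (v (σ 3)))
      congr 3
      all_goals first | rfl | (congr 1; ext i; fin_cases i <;> rfl)
  have h3 : ∑ σ : Equiv.Perm (Fin 4), ((Equiv.Perm.sign σ : ℤ) : ℝ) *
      (T (fun i => v (σ i)) - T (fun i => v (σ (Equiv.swap 0 1 i)))
      - T (fun i => v (σ (Equiv.swap 0 2 i))) - T (fun i => v (σ (Equiv.swap 0 3 i)))) = 0 :=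
    Finset.sum_eq_zero fun σ _ => by rw [h2, mul_zero]
  simp only [mul_sub, Finset.sum_sub_distrib] at h3
  have e1 := h1 1 (by decide)
  have e2 := h1 2 (by decide)
  have e3 := h1 3 (by decide)
  simp only [Finset.sum_neg_distrib] at e1 e2 e3
  rw [antisymmetrize, mul_eq_zero]
  right
  linarith

/-- The double contraction `h^{ij} h^{mp} F_{ijmp}`. -/
def doubleTrace (h : Matrix (Fin n) (Fin n) ℝ) (F : Fin n → Fin n → Fin n → Fin n → ℝ) : ℝ :=
  ∑ i, ∑ j, ∑ m, ∑ p, h i j * h m p * F i j m p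

section DoubleTrace

variable {h : Matrix (Fin n) (Fin n) ℝ} (F F' : Fin n → Fin n → Fin n → Fin n → ℝ)

lemma doubleTrace_neg : doubleTrace h (fun i j m p => -F i j m p) = -doubleTrace h F := by
  simp [doubleTrace]

lemma doubleTrace_add :
    doubleTrace h (fun i j m p => F i j m p + F' i j m p) = doubleTrace h F + doubleTrace h F' := by
  simp [doubleTrace, mul_add, Finset.sum_add_distrib]

lemma doubleTrace_comm : doubleTrace h (fun i j m p => F m p i j) = doubleTrace h F := by
  unfold doubleTrace
  calc _ = ∑ i, ∑ m, ∑ j, ∑ p, h i j * h m p * F m p i j :=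
        Finset.sum_congr rfl fun _ _ => Finset.sum_comm
    _ = ∑ m, ∑ i, ∑ j, ∑ p, h i j * h m p * F m p i j := Finset.sum_comm
    _ = ∑ m, ∑ i, ∑ p, ∑ j, h i j * h m p * F m p i j :=
        Finset.sum_congr rfl fun _ _ => Finset.sum_congr rfl fun _ _ => Finset.sum_comm
    _ = ∑ m, ∑ p, ∑ i, ∑ j, h i j * h m p * F m p i j :=
        Finset.sum_congr rfl fun _ _ => Finset.sum_comm
    _ = _ := Finset.sum_congr rfl fun _ _ => Finset.sum_congr rfl fun _ _ =>
        Finset.sum_congr rfl fun _ _ => Finset.sum_congr rfl fun _ _ => by ring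

lemma doubleTrace_flip_left (hh : ∀ i j, h i j = h j i) :
    doubleTrace h (fun i j m p => F j i m p) = doubleTrace h F := by
  unfold doubleTrace
  rw [Finset.sum_comm]
  exact Finset.sum_congr rfl fun i _ => Finset.sum_congr rfl fun j _ => by simp only [hh i j]

lemma doubleTrace_flip_right (hh : ∀ i j, h i j = h j i) :
    doubleTrace h (fun i j m p => F i j p m) = doubleTrace h F := by
  rw [← doubleTrace_comm, doubleTrace_flip_left (fun i j m p => F m p i j) hh, doubleTrace_comm]

lemma doubleTrace_eq_zero_left (hF : ∀ m p, ∑ i, ∑ j, h i j * F i j m p = 0) :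
    doubleTrace h F = 0 := by
  rw [← doubleTrace_comm]
  refine Finset.sum_eq_zero fun m _ => Finset.sum_eq_zero fun p _ => ?_
  simp only [mul_assoc, ← Finset.mul_sum]
  rw [hF, mul_zero]

end DoubleTrace

namespace IsWeylArray

variable {h : Matrix (Fin n) (Fin n) ℝ} {X : TensorArray n 4} (hX : IsWeylArray h X)
include hX

lemma trace_one_three (b c : Fin n) : ∑ i, ∑ j, h i j * X ![i, b, j, c] = 0 := by
  simp only [fun i j => hX.skew_right i b c j, mul_neg, Finset.sum_neg_distrib]
  simpa using hX.trace_eq_zero b c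

lemma trace_two_three (b c : Fin n) : ∑ i, ∑ j, h i j * X ![b, i, j, c] = 0 := by
  simp only [fun i j => hX.skew_left i b j c, mul_neg, Finset.sum_neg_distrib]
  simpa using hX.trace_one_three b c

lemma cyclic_three (a b c d : Fin n) : X ![a, b, c, d] + X ![b, c, a, d] + X ![c, a, b, d] = 0 := by
  have h1 := hX.cyclic d a b c
  have p := hX.pair_symm
  have l := hX.skew_left
  have r := hX.skew_right
  linarith [p a b c d, p b c a d, p c a b d, r c d a b, l c d b a, r a d b c, l a d c b,
    r b d c a, l b d a c, l c d a b, l a d b c, l b d c a]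

/-- The derivation action of an infinitesimal isometry preserves Weyl candidates. -/
lemma act {A : Fin n → Fin n → ℝ} (hA : ∀ a b, ∑ m, (A a m * h m b + A b m * h a m) = 0) :
    IsWeylArray h (act A X) where
  skew_left a b c d := by
    rw [act_four, act_four, ← Finset.sum_neg_distrib]
    refine Finset.sum_congr rfl fun m _ => ?_
    rw [hX.skew_left a b, hX.skew_left a b, hX.skew_left a m, hX.skew_left m b]
    ring
  skew_right a b c d := by
    rw [act_four, act_four, ← Finset.sum_neg_distrib]
    refine Finset.sum_congr rfl fun m _ => ?_
    rw [hX.skew_right _ _ c d, hX.skew_right _ _ c d, hX.skew_right _ _ c m, hX.skew_right _ _ m d]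
    ring
  cyclic a b c d := by
    rw [act_four, act_four, act_four, ← Finset.sum_add_distrib, ← Finset.sum_add_distrib]
    refine Finset.sum_eq_zero fun m _ => ?_
    linear_combination A m a * hX.cyclic m b c d + A m b * hX.cyclic a m c d
      + A m c * hX.cyclic a b m d + A m d * hX.cyclic a b c m
  trace_eq_zero b c := by
    -- The action on the free slots leaves traces of X, which vanish. The action on the contracted
    -- slots can be moved onto h, where skewness of A with respect to h kills it.
    have h1 : ∀ i j, h i j * WeylPotential.act A X ![i, b, c, j] =
        (∑ m, h i j * A m i * X ![m, b, c, j] + ∑ m, h i j * A m j * X ![i, b, c, m])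
        + (∑ m, A m b * (h i j * X ![i, m, c, j]) + ∑ m, A m c * (h i j * X ![i, b, m, j])) :=
      fun i j => by
        rw [act_four, Finset.mul_sum, ← Finset.sum_add_distrib, ← Finset.sum_add_distrib,
          ← Finset.sum_add_distrib]
        exact Finset.sum_congr rfl fun m _ => by ring
    simp only [h1, Finset.sum_add_distrib]
    have e3 : ∑ i, ∑ j, ∑ m, A m b * (h i j * X ![i, m, c, j]) = 0 := by
      rw [← sum_rotate]
      refine Finset.sum_eq_zero fun m _ => ?_
      simp only [← Finset.mul_sum]
      rw [hX.trace_eq_zero, mul_zero]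
    have e4 : ∑ i, ∑ j, ∑ m, A m c * (h i j * X ![i, b, m, j]) = 0 := by
      rw [← sum_rotate]
      refine Finset.sum_eq_zero fun m _ => ?_
      simp only [← Finset.mul_sum]
      rw [hX.trace_eq_zero, mul_zero]
    have e1 : ∑ i, ∑ j, ∑ m, h i j * A m i * X ![m, b, c, j] =
        ∑ i, ∑ j, ∑ m, h m j * A i m * X ![i, b, c, j] := sum_swap_outer _
    have e2 : ∑ i, ∑ j, ∑ m, h i j * A m j * X ![i, b, c, m] =
        ∑ i, ∑ j, ∑ m, h i m * A j m * X ![i, b, c, j] :=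
      Finset.sum_congr rfl fun i _ => Finset.sum_comm
    rw [e1, e2, e3, e4, add_zero, add_zero, ← Finset.sum_add_distrib]
    refine Finset.sum_eq_zero fun i _ => ?_
    rw [← Finset.sum_add_distrib]
    refine Finset.sum_eq_zero fun j _ => ?_
    rw [← Finset.sum_add_distrib]
    calc _ = (∑ m, (A i m * h m j + A j m * h i m)) * X ![i, b, c, j] := by
          rw [Finset.sum_mul]
          exact Finset.sum_congr rfl fun m _ => by ring
      _ = 0 := by rw [hA, zero_mul]

end IsWeylArray

/-- The contraction `h^{ij} (R_{dj} X)_{abci}`, where `R_{dj}` acts as a derivation. -/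
def divAct (h : Matrix (Fin n) (Fin n) ℝ) (R : Fin n → Fin n → Fin n → Fin n → ℝ)
    (X : TensorArray n 4) (a b c d : Fin n) : ℝ :=
  ∑ i, ∑ j, h i j * act (fun m p => R m p d j) X ![a, b, c, i]

/-- The commutator terms that relate `∇²` to the Weyl tensor of a superpotential. -/
def curvOp (h : Matrix (Fin n) (Fin n) ℝ) (R : Fin n → Fin n → Fin n → Fin n → ℝ) :
    TensorArray n 4 →ₗ[ℝ] TensorArray n 4 where
  toFun X v := -(1 / 2) * (divAct h R X (v 0) (v 1) (v 3) (v 2)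
    - divAct h R X (v 0) (v 1) (v 2) (v 3) + divAct h R X (v 2) (v 3) (v 1) (v 0)
    - divAct h R X (v 2) (v 3) (v 0) (v 1))
  map_add' X Y := by
    ext v
    simp only [divAct, map_add, Pi.add_apply, mul_add, Finset.sum_add_distrib]
    ring
  map_smul' r X := by
    ext v
    simp only [divAct, map_smul, Pi.smul_apply, smul_eq_mul, mul_left_comm _ r, ← Finset.mul_sum,
      RingHom.id_apply]
    ring

lemma curvOp_apply (h : Matrix (Fin n) (Fin n) ℝ) (R : Fin n → Fin n → Fin n → Fin n → ℝ)
    (X : TensorArray n 4) (a b c d : Fin n) : curvOp h R X ![a, b, c, d] =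
      -(1 / 2) * (divAct h R X a b d c - divAct h R X a b c d + divAct h R X c d b a
        - divAct h R X c d a b) := rfl

/-- Skewness is built into the formula, and the cyclic identity follows from the skew and cyclic
symmetries of the first three slots of `divAct`. In the trace, two of the four terms contract a Weyl
candidate R_{dj}X with itself, and the other two cancel. -/
lemma IsWeylArray.curvOp {h : Matrix (Fin n) (Fin n) ℝ} (hh : ∀ i j, h i j = h j i)
    {R : Fin n → Fin n → Fin n → Fin n → ℝ} {X : TensorArray n 4}
    (hR : ∀ d j, IsWeylArray h (WeylPotential.act (fun m p => R m p d j) X))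
    (hskew : ∀ m p d j, R m p j d = -R m p d j) : IsWeylArray h (curvOp h R X) := by
  have hY : ∀ d j v, WeylPotential.act (fun m p => R m p j d) X v =
      -WeylPotential.act (fun m p => R m p d j) X v := fun d j v => by
    simp only [act_apply, hskew _ _ d j, neg_mul, Finset.sum_neg_distrib]
  have hB1 : ∀ a b c d, divAct h R X b a c d = -divAct h R X a b c d := fun a b c d => by
    simp only [divAct, (hR _ _).skew_left a b, mul_neg, Finset.sum_neg_distrib]
  have hB2 : ∀ a b c d, divAct h R X a b c d + divAct h R X b c a d + divAct h R X c a b d = 0 :=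
    fun a b c d => by
      simp only [divAct, ← Finset.sum_add_distrib, ← mul_add, (hR _ _).cyclic_three, mul_zero,
        Finset.sum_const_zero]
  refine ⟨fun a b c d => ?_, fun a b c d => ?_, fun a b c d => ?_, fun b c => ?_⟩
  · rw [curvOp_apply, curvOp_apply, hB1 a b, hB1 a b]; ring
  · rw [curvOp_apply, curvOp_apply, hB1 c d, hB1 c d]; ring
  · simp only [curvOp_apply]
    linarith [hB2 a b c d, hB2 a b d c, hB2 a c d b, hB2 b c d a, hB1 a b c d, hB1 a b d c,
      hB1 a c b d, hB1 a c d b, hB1 a d b c, hB1 a d c b, hB1 b c d a, hB1 c d b a, hB1 d b c a,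
      hB1 b c a d, hB1 c d a b, hB1 d b a c]
  · set Y : Fin n → Fin n → TensorArray n 4 := fun d j => WeylPotential.act (fun m p => R m p d j) X
    have t1 : ∑ a, ∑ d, h a d * divAct h R X a b d c =
        doubleTrace h fun a d i j => Y c j ![a, b, d, i] := by
      simp only [divAct, doubleTrace, Finset.mul_sum, mul_assoc, Y]
    have t2 : ∑ a, ∑ d, h a d * divAct h R X a b c d =
        doubleTrace h fun a d i j => Y d j ![a, b, c, i] := by
      simp only [divAct, doubleTrace, Finset.mul_sum, mul_assoc, Y]
    have t3 : ∑ a, ∑ d, h a d * divAct h R X c d b a =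
        doubleTrace h fun a d i j => Y a j ![c, d, b, i] := by
      simp only [divAct, doubleTrace, Finset.mul_sum, mul_assoc, Y]
    have t4 : ∑ a, ∑ d, h a d * divAct h R X c d a b =
        doubleTrace h fun a d i j => Y b j ![c, d, a, i] := by
      simp only [divAct, doubleTrace, Finset.mul_sum, mul_assoc, Y]
    have z1 : (doubleTrace h fun a d i j => Y c j ![a, b, d, i]) = 0 :=
      doubleTrace_eq_zero_left _ fun i j => (hR c j).trace_one_three b i
    have z4 : (doubleTrace h fun a d i j => Y b j ![c, d, a, i]) = 0 := by
      refine doubleTrace_eq_zero_left _ fun i j => ?_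
      rw [Finset.sum_comm]
      simpa only [hh] using (hR b j).trace_two_three c i
    -- Exchanging the two contracted pairs and using the skewness of the curvature in its form
    -- indices identifies the two surviving terms.
    have z2 : (doubleTrace h fun a d i j => Y a j ![c, d, b, i]) =
        doubleTrace h fun a d i j => Y d j ![a, b, c, i] := by
      rw [← doubleTrace_comm, ← doubleTrace_flip_right _ hh]
      congr 1
      ext a d i j
      refine (hY d j _).trans ?_
      simp only [Y]
      rw [(hR d j).pair_symm b a c i, (hR d j).skew_left a b, neg_neg]
    have : ∀ a d, h a d * WeylPotential.curvOp h R X ![a, b, c, d] = -(1 / 2) *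
        (h a d * divAct h R X a b d c - h a d * divAct h R X a b c d + h a d * divAct h R X c d b a
          - h a d * divAct h R X c d a b) := fun a d => by rw [curvOp_apply]; ring
    simp only [this, ← Finset.mul_sum, Finset.sum_sub_distrib, Finset.sum_add_distrib]
    rw [t1, t2, t3, t4, z1, z4, z2]
    ring

/-- The terms in the expansion of `divAct` for a curvature tensor with all indices lowered. -/
lemma divAct_eq {h : Matrix (Fin n) (Fin n) ℝ} {R : Fin n → Fin n → Fin n → Fin n → ℝ} {r : TensorArray n 4} (hr : IsWeylArray 0 r)
    (hR : ∀ m a b c, R m a b c = ∑ p, h m p * r ![p, a, b, c])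
    {X : TensorArray n 4} (hX : IsWeylArray h X) (a b c d : Fin n) :
    divAct h R X a b c d =
      (doubleTrace h fun i j m p => r ![p, a, d, j] * X ![m, b, c, i])
      - (doubleTrace h fun i j m p => r ![p, b, d, j] * X ![m, a, c, i])
      - (1 / 2) * (doubleTrace h fun i j m p => r ![c, d, p, j] * X ![a, b, m, i])
      - doubleTrace h fun i j m p => r ![i, p, j, d] * X ![m, c, a, b] := by
  -- With 0 in place of h the trace condition on `r` is void, so `r` is only assumed to have the
  -- algebraic symmetries of a curvature tensor.
  have h1 : divAct h R X a b c d = doubleTrace h fun i j m p =>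
      r ![p, a, d, j] * X ![m, b, c, i] + r ![p, b, d, j] * X ![a, m, c, i]
        + r ![p, c, d, j] * X ![a, b, m, i] + r ![p, i, d, j] * X ![a, b, c, m] := by
    unfold divAct doubleTrace
    refine Finset.sum_congr rfl fun i _ => Finset.sum_congr rfl fun j _ => ?_
    rw [act_four, Finset.mul_sum]
    refine Finset.sum_congr rfl fun m _ => ?_
    simp only [hR, Finset.sum_mul, ← Finset.sum_add_distrib, Finset.mul_sum]
    exact Finset.sum_congr rfl fun p _ => by ring
  have h2 : (doubleTrace h fun i j m p => r ![p, b, d, j] * X ![a, m, c, i]) =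
      -doubleTrace h fun i j m p => r ![p, b, d, j] * X ![m, a, c, i] := by
    rw [← doubleTrace_neg]
    congr 1
    ext i j m p
    rw [hX.skew_left m a]
    ring
  have h4 : (doubleTrace h fun i j m p => r ![p, i, d, j] * X ![a, b, c, m]) =
      -doubleTrace h fun i j m p => r ![i, p, j, d] * X ![m, c, a, b] := by
    rw [← doubleTrace_neg]
    congr 1
    ext i j m p
    rw [hr.skew_left i p, hr.skew_right i p j d, hX.pair_symm c m, hX.skew_left m c]
    ring
  have e3 : (doubleTrace h fun i j m p => r ![p, c, d, j] * X ![a, b, m, i]) =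
      doubleTrace h fun i j m p => r ![j, c, d, p] * X ![a, b, i, m] := (doubleTrace_comm _).symm
  -- X is skew in the contracted pair, so only the corresponding skew part of r enters. The cyclic
  -- identity yields E = -(Q + E) for this term E and the contraction Q with r_{cdpj}, which is the
  -- origin of the coefficient 1/2.
  have h3 : (doubleTrace h fun i j m p => r ![j, c, d, p] * X ![a, b, i, m]) =
      -((doubleTrace h fun i j m p => r ![c, d, p, j] * X ![a, b, m, i])
        + doubleTrace h fun i j m p => r ![p, c, d, j] * X ![a, b, m, i]) := by
    rw [← doubleTrace_add, ← doubleTrace_neg]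
    congr 1
    ext i j m p
    have p1 := hr.pair_symm
    have l := hr.skew_left
    have q := hr.skew_right
    rw [hX.skew_right a b m i]
    have : r ![p, c, d, j] - r ![j, c, d, p] + r ![c, d, p, j] = 0 := by
      linarith [hr.cyclic p c d j, p1 j c d p, l c d p j, q d p j c, p1 p d j c, l p d j c,
        p1 p j c d, q p j c d, l c d j p, q c d p j, l c j d p, l p c d j, q p d c j, p1 p d c j,
        l j c d p, p1 c j d p, q d p c j]
    linear_combination X ![a, b, m, i] * this
  rw [h1, doubleTrace_add, doubleTrace_add, doubleTrace_add, h2, h4]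
  linarith

/-- Pair symmetry of both factors combined with an exchange of the two contractions. It identifies
the mixed terms that arise from different placements of the free indices. -/
lemma doubleTrace_curvature_symm {h : Matrix (Fin n) (Fin n) ℝ} {r : TensorArray n 4} (hr : IsWeylArray 0 r) {X : TensorArray n 4} (hX : IsWeylArray h X)
    (a b c d : Fin n) : (doubleTrace h fun i j m p => r ![p, d, a, j] * X ![m, c, b, i]) =
      doubleTrace h fun i j m p => r ![p, a, d, j] * X ![m, b, c, i] := by
  rw [← doubleTrace_comm]
  congr 1
  ext i j m p
  rw [← hr.pair_symm, hr.skew_left p a, hr.skew_right p a, neg_neg, ← hX.pair_symm i c,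
    hX.skew_left m b, hX.skew_right m b, neg_neg]

end PointwiseAlgebra

/-! ### Curvature symmetries and the identification of {R⊗X} with `curvOp` -/

section CurvatureTerm

variable {n : ℕ} {G : Components n 2} {V : Set (Coord n)}

namespace IsMetricOn

variable (hG : IsMetricOn G V)
include hG

lemma covDeriv_metric {y : Coord n} (hy : y ∈ V) : covDeriv G G y = 0 := by
  ext v
  rw [covDeriv_eq, dirDeriv, vec_two (fun s : Fin 2 => v s.castSucc), act_two,
    hG.partialDeriv_metric hy, sub_self]
  rfl

omit hG in
lemma riemannUp_skew (d a b c : Fin n) (y : Coord n) :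
    riemannUp G d a c b y = -riemannUp G d a b c y := by
  simp only [riemannUp, Finset.sum_sub_distrib]
  ring

/-- The first Bianchi identity: after symmetry of the Christoffel symbols all derivative and
quadratic terms cancel in pairs. -/
lemma riemannUp_cyclic {y : Coord n} (hy : y ∈ V) (d a b c : Fin n) :
    riemannUp G d a b c y + riemannUp G d b c a y + riemannUp G d c a b y = 0 := by
  have h1 : ∀ i j k, partialDeriv i (christoffel G d j k) y =
      partialDeriv i (christoffel G d k j) y := fun i j k =>
    partialDeriv_congr hG.isOpen (fun x hx => hG.christoffel_symm hx d j k) hy i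
  have h2 : ∀ m, christoffel G m b a y = christoffel G m a b y ∧
      christoffel G m c a y = christoffel G m a c y ∧
      christoffel G m c b y = christoffel G m b c y := fun m =>
    ⟨hG.christoffel_symm hy m b a, hG.christoffel_symm hy m c a, hG.christoffel_symm hy m c b⟩
  simp only [riemannUp, Finset.sum_sub_distrib, (h2 _).1, (h2 _).2.1, (h2 _).2.2]
  rw [h1 b a c, h1 c a b, h1 a b c]
  ring

/-- The symmetries of the curvature tensor. -/
lemma isWeylArray_riemannDown {y : Coord n} (hy : y ∈ V) :
    IsWeylArray 0 fun v => riemannDown G (v 0) (v 1) (v 2) (v 3) y where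
  skew_left a b c d := by
    -- The Ricci identity is applied to the metric itself. Its left side vanishes since ∇g = 0,
    -- leaving skewness in the first pair.
    have h1 := hG.covDeriv_covDeriv_sub hG.analytic hy c d ![b, a, c, d] ![b, a, d, c] rfl rfl rfl
      rfl (fun s => by fin_cases s <;> rfl)
    have h2 : ∀ v, covDeriv G (covDeriv G G) y v = 0 := fun v => by
      rw [covDeriv_eq, dirDeriv_congr hG.isOpen (S := 0) (fun x hx => hG.covDeriv_metric hx) hy]
      simp [dirDeriv, partialDeriv_const, act_apply]
    rw [h2, h2, vec_two (fun s : Fin 2 => _), act_two, Finset.sum_add_distrib] at h1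
    have h3 : riemannDown G a b c d y = ∑ m, riemannUp G m b c d y * G y ![m, a] :=
      Finset.sum_congr rfl fun m _ => by rw [hG.symm y hy a m, mul_comm]
    have h4 : riemannDown G b a c d y = ∑ m, riemannUp G m a c d y * G y ![b, m] :=
      Finset.sum_congr rfl fun m _ => by rw [mul_comm]
    change riemannDown G b a c d y = -riemannDown G a b c d y
    rw [h3, h4]
    have h5 : (∑ m, riemannUp G m b c d y * G y ![m, a])
        + ∑ m, riemannUp G m a c d y * G y ![b, m] = 0 := by
      simpa using h1.symm
    linarith
  skew_right a b c d := by
    change riemannDown G a b d c y = -riemannDown G a b c d y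
    simp only [riemannDown, riemannUp_skew _ b c d, mul_neg, Finset.sum_neg_distrib]
  cyclic a b c d := by
    change riemannDown G a b c d y + riemannDown G a c d b y + riemannDown G a d b c y = 0
    simp only [riemannDown, ← Finset.sum_add_distrib, ← mul_add, hG.riemannUp_cyclic hy, mul_zero,
      Finset.sum_const_zero]
  trace_eq_zero b c := by simp

lemma riemannUp_eq {y : Coord n} (hy : y ∈ V) (m a b c : Fin n) :
    riemannUp G m a b c y = ∑ p, invMetric G y m p * riemannDown G p a b c y := by
  simp only [riemannDown, Finset.mul_sum, ← mul_assoc]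
  rw [Finset.sum_comm]
  simp only [← Finset.sum_mul, hG.sum_invMetric_mul hy]
  simp

/-- Skewness of the lowered curvature in its first pair says that each curvature endomorphism is
skew with respect to g, that is, an infinitesimal isometry. -/
lemma isWeylArray_act_riemannUp {y : Coord n} (hy : y ∈ V) {X : TensorArray n 4}
    (hX : IsWeylArray (invMetric G y) X) (d j : Fin n) :
    IsWeylArray (invMetric G y) (act (fun m p => riemannUp G m p d j y) X) := by
  refine hX.act fun a b => ?_
  simp only [hG.riemannUp_eq hy, Finset.sum_mul, Finset.sum_add_distrib]
  conv_lhs =>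
    congr
    · rw [Finset.sum_comm]
  rw [← Finset.sum_add_distrib]
  refine Finset.sum_eq_zero fun m _ => ?_
  rw [← Finset.sum_add_distrib]
  refine Finset.sum_eq_zero fun p _ => ?_
  have h1 : riemannDown G p m d j y = -riemannDown G m p d j y :=
    (hG.isWeylArray_riemannDown hy).skew_left m p d j
  rw [h1, hG.invMetric_symm hy b]
  ring

lemma isWeylArray_curvOp {y : Coord n} (hy : y ∈ V) {X : TensorArray n 4}
    (hX : IsWeylArray (invMetric G y) X) : IsWeylArray (invMetric G y)
      (curvOp (invMetric G y) (fun m p d j => riemannUp G m p d j y) X) :=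
  IsWeylArray.curvOp (hG.invMetric_symm hy) (hG.isWeylArray_act_riemannUp hy hX)
    fun _ _ _ _ => riemannUp_skew _ _ _ _ _

/-- Both sides are sums of three kinds of double contraction: mixed, Ricci and full pair. Once each
is in the normal form of `divAct_eq`, matching the antisymmetrizations is linear arithmetic. -/
lemma curvatureTerm_eq {X : Components n 4} {y : Coord n} (hy : y ∈ V)
    (hX : IsWeylArray (invMetric G y) (X y)) (a b c d : Fin n) :
    curvatureTerm G X a b c d y =
      curvOp (invMetric G y) (fun m p d j => riemannUp G m p d j y) (X y) ![a, b, c, d] := by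
  have hh := hG.invMetric_symm hy
  have hr : IsWeylArray 0 fun v => riemannDown G (v 0) (v 1) (v 2) (v 3) y :=
    hG.isWeylArray_riemannDown hy
  have hup : ∀ m a b c, riemannUp G m a b c y = ∑ p, invMetric G y m p *
      (fun v : Fin 4 → Fin n => riemannDown G (v 0) (v 1) (v 2) (v 3) y) ![p, a, b, c] :=
    fun m a b c => hG.riemannUp_eq hy m a b c
  have hr' : ∀ a b c d, riemannDown G a b c d y =
    (fun v : Fin 4 → Fin n => riemannDown G (v 0) (v 1) (v 2) (v 3) y) ![a, b, c, d] :=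
    fun _ _ _ _ => rfl
  have hraise : ∀ m b c d, raiseFirst G X m b c d y =
      ∑ r, invMetric G y m r * X y ![r, b, c, d] := fun _ _ _ _ => rfl
  have hraise' : ∀ a b e m, raiseLastTwo G X a b e m y =
      ∑ r, ∑ s, invMetric G y e r * invMetric G y m s * X y ![a, b, r, s] := fun _ _ _ _ => rfl
  -- From here on only the algebraic symmetries of the curvature and of the inverse metric are used.
  generalize (fun v : Fin 4 → Fin n => riemannDown G (v 0) (v 1) (v 2) (v 3) y) = r at hr hup hr'
  generalize invMetric G y = h at hX hh hup hraise hraise' ⊢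
  have hZ : ∀ d a b c, ∑ e, ∑ m, riemannUp G e d m a y * raiseFirst G X m b e c y =
      doubleTrace h fun i j m p => r ![p, a, d, j] * X y ![m, b, c, i] := fun d a b c => by
    rw [← doubleTrace_flip_right _ hh]
    unfold doubleTrace
    refine Finset.sum_congr rfl fun e _ => ?_
    simp only [hup, hraise, Finset.sum_mul, Finset.mul_sum]
    refine Finset.sum_comm.trans ?_
    refine (Finset.sum_congr rfl fun m _ => Finset.sum_comm).trans (Finset.sum_comm.trans ?_)
    refine Finset.sum_congr rfl fun q _ => Finset.sum_comm.trans ?_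
    refine Finset.sum_congr rfl fun m _ => Finset.sum_congr rfl fun p _ => ?_
    rw [hr.pair_symm m a q d, hX.skew_right p b c e, hr.skew_right m a d q]
    ring
  have hN : ∀ d c a b, ∑ m, ricci G m d y * raiseFirst G X m c a b y =
      doubleTrace h fun i j m p => r ![i, p, j, d] * X y ![m, c, a, b] := fun d c a b => by
    rw [← doubleTrace_comm, ← doubleTrace_flip_left _ hh, ← doubleTrace_flip_right _ hh]
    unfold doubleTrace ricci
    simp only [hup, hraise, Finset.sum_mul, Finset.mul_sum]
    refine Finset.sum_congr rfl fun m _ => Finset.sum_congr rfl fun q _ =>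
      Finset.sum_congr rfl fun c _ => Finset.sum_congr rfl fun p _ => ?_
    ring
  have hQ : ∀ a b c d, ∑ e, ∑ m, riemannDown G c d e m y * raiseLastTwo G X a b e m y =
      doubleTrace h fun i j m p => r ![c, d, p, j] * X y ![a, b, m, i] := fun a b c d => by
    rw [← doubleTrace_comm, ← doubleTrace_flip_left _ hh, ← doubleTrace_flip_right _ hh]
    unfold doubleTrace
    simp only [hr', hraise', Finset.mul_sum]
    refine Finset.sum_congr rfl fun e _ => Finset.sum_comm.trans ?_
    refine Finset.sum_congr rfl fun q _ => Finset.sum_congr rfl fun m _ =>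
      Finset.sum_congr rfl fun p _ => ?_
    ring
  have hs := doubleTrace_curvature_symm (h := h) hr hX
  have hQs : ∀ a b c d, (doubleTrace h fun i j m p => r ![d, c, p, j] * X y ![a, b, m, i]) =
      -doubleTrace h fun i j m p => r ![c, d, p, j] * X y ![a, b, m, i] := fun a b c d => by
    simp only [hr.skew_left c d, neg_mul, doubleTrace_neg]
  have hB := divAct_eq (R := fun m p d j => riemannUp G m p d j y) hr hup hX
  simp only [curvatureTerm, antisymmetrize_two, Finset.sum_add_distrib, curvOp_apply, hB,
    Matrix.cons_val_zero, Matrix.cons_val_one, hZ, hN, hQ]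
  rw [hQs a b c d, hQs c d a b, hs a b d c, hs a b c d, hs b a d c, hs b a c d]
  ring

end IsMetricOn

end CurvatureTerm

/-! ### Local solvability in coordinates -/

section Local

variable {n : ℕ} {G : Components n 2} {V : Set (Coord n)}

lemma vec_five (v : Fin 5 → Fin n) : v = ![v 0, v 1, v 2, v 3, v 4] := by
  ext i; fin_cases i <;> rfl

lemma covDeriv_four (G : Components n 2) (X : Components n 4) (y : Coord n) (a b c d e : Fin n) :
    covDeriv G X y ![a, b, c, d, e] = dirDeriv G e X y ![a, b, c, d] := by
  rw [covDeriv_eq]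
  congr 1
  ext s; fin_cases s <;> rfl

lemma covDeriv_five (G : Components n 2) (P : Components n 5) (y : Coord n)
    (a b c d e f : Fin n) :
    covDeriv G P y ![a, b, c, d, e, f] = dirDeriv G f P y ![a, b, c, d, e] := by
  rw [covDeriv_eq]
  congr 1
  ext s; fin_cases s <;> rfl

/-- The components `X_{abcd;ef}` as an array in `a, b, c, d`. -/
def secondCovDeriv (G : Components n 2) (X : Components n 4) (e f : Fin n) (y : Coord n) :
    TensorArray n 4 :=
  dirDeriv G f (dirDeriv G e X) y - ∑ m, christoffel G m f e y • dirDeriv G m X y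

lemma covDeriv_covDeriv_four (G : Components n 2) (X : Components n 4) (y : Coord n)
    (a b c d e f : Fin n) : covDeriv G (covDeriv G X) y ![a, b, c, d, e, f] =
      secondCovDeriv G X e f y ![a, b, c, d] := by
  have h : (fun s : Fin 4 => ![a, b, c, d, e, f] s.castSucc.castSucc) = ![a, b, c, d] := by
    ext s; fin_cases s <;> rfl
  rw [covDeriv_covDeriv, h, secondCovDeriv, Pi.sub_apply, Finset.sum_apply]
  rfl

lemma laplacian_eq (G : Components n 2) (X : Components n 4) (y : Coord n) :
    laplacian G X y = ∑ e, ∑ f, invMetric G y e f • secondCovDeriv G X e f y := by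
  ext v
  simp only [laplacian, covDeriv_covDeriv_four, ← vec_four, Finset.sum_apply, Pi.smul_apply,
    smul_eq_mul]

/-- The first order coefficients of `∇²`. -/
def laplacianFirst (G : Components n 2) (j : Fin n) (y : Coord n) :
    TensorArray n 4 →ₗ[ℝ] TensorArray n 4 :=
  -(∑ e, invMetric G y e j • act fun m a => christoffel G m e a y)
    - (∑ f, invMetric G y j f • act fun m a => christoffel G m f a y)
    - (∑ e, ∑ f, invMetric G y e f * christoffel G j f e y) • LinearMap.id

/-- The coefficients of order zero of `∇²`. -/
def laplacianZero (G : Components n 2) (y : Coord n) : TensorArray n 4 →ₗ[ℝ] TensorArray n 4 :=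
  ∑ e, ∑ f, invMetric G y e f • ((act fun m a => christoffel G m f a y) ∘ₗ
      (act fun m a => christoffel G m e a y)
    - (act fun m a => partialDeriv f (christoffel G m e a) y)
    + ∑ m, christoffel G m f e y • act fun p a => christoffel G p m a y)

namespace IsMetricOn

lemma mono (hG : IsMetricOn G V) {V' : Set (Coord n)} (hV' : IsOpen V') (h : V' ⊆ V) :
    IsMetricOn G V' where
  isOpen := hV'
  analytic v := (hG.analytic v).mono h
  symm y hy := hG.symm y (h hy)
  isUnit_det y hy := hG.isUnit_det y (h hy)

variable (hG : IsMetricOn G V)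
include hG

/-- Exhibits ∇² as g^{ij}∂_i∂_j acting on each component separately, plus lower order terms, which
is the form covered by `exists_analytic_solution`. -/
lemma laplacian_expand {X : Components n 4} (hX : AnalyticField X V) {y : Coord n} (hy : y ∈ V)
    (v : Fin 4 → Fin n) : laplacian G X y v =
      (∑ i, ∑ j, invMetric G y j i * partialDeriv i (partialDeriv j fun x => X x v) y)
        + (∑ j, laplacianFirst G j y (fun w => partialDeriv j (fun x => X x w) y) v)
        + laplacianZero G y (X y) v := by
  have h1 : ∀ e f, secondCovDeriv G X e f y v =
      partialDeriv f (partialDeriv e fun x => X x v) y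
        - act (fun m a => christoffel G m e a y) (fun w => partialDeriv f (fun x => X x w) y) v
        - act (fun m a => christoffel G m f a y) (fun w => partialDeriv e (fun x => X x w) y) v
        - (∑ m, christoffel G m f e y * partialDeriv m (fun x => X x v) y)
        + (act (fun m a => christoffel G m f a y) (act (fun m a => christoffel G m e a y) (X y)) v
          - act (fun m a => partialDeriv f (christoffel G m e a) y) (X y) v
          + ∑ m, christoffel G m f e y * act (fun p a => christoffel G p m a y) (X y) v) :=
    fun e f => by
      rw [secondCovDeriv, Pi.sub_apply, Finset.sum_apply, hG.dirDeriv_dirDeriv hX hy]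
      simp only [Pi.smul_apply, smul_eq_mul, dirDeriv, mul_sub, Finset.sum_sub_distrib]
      ring
  have h2 : laplacianZero G y (X y) v = ∑ e, ∑ f, invMetric G y e f *
      (act (fun m a => christoffel G m f a y) (act (fun m a => christoffel G m e a y) (X y)) v
          - act (fun m a => partialDeriv f (christoffel G m e a) y) (X y) v
          + ∑ m, christoffel G m f e y * act (fun p a => christoffel G p m a y) (X y) v) := by
    simp [laplacianZero, LinearMap.sum_apply, Finset.sum_apply, mul_add]
  have h3 : ∑ j, laplacianFirst G j y (fun w => partialDeriv j (fun x => X x w) y) v =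
      -(∑ e, ∑ f, invMetric G y e f *
          act (fun m a => christoffel G m e a y) (fun w => partialDeriv f (fun x => X x w) y) v)
        - (∑ e, ∑ f, invMetric G y e f *
          act (fun m a => christoffel G m f a y) (fun w => partialDeriv e (fun x => X x w) y) v)
        - ∑ e, ∑ f, invMetric G y e f *
          ∑ m, christoffel G m f e y * partialDeriv m (fun x => X x v) y := by
    have h4 : ∑ e, ∑ f, invMetric G y e f *
        ∑ m, christoffel G m f e y * partialDeriv m (fun x => X x v) y =
        ∑ m, ∑ e, ∑ f, invMetric G y e f * christoffel G m f e y *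
          partialDeriv m (fun x => X x v) y := by
      simp only [Finset.mul_sum, ← mul_assoc]
      exact (sum_rotate fun m e f => invMetric G y e f * christoffel G m f e y *
        partialDeriv m (fun x => X x v) y).symm
    rw [h4, Finset.sum_comm (f := fun e f => invMetric G y e f *
          act (fun m a => christoffel G m e a y) (fun w => partialDeriv f (fun x => X x w) y) v),
      ← Finset.sum_neg_distrib, ← Finset.sum_sub_distrib, ← Finset.sum_sub_distrib]
    refine Finset.sum_congr rfl fun j _ => ?_
    simp [laplacianFirst, LinearMap.sum_apply, Finset.sum_apply, Finset.sum_mul]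
  rw [laplacian_eq, h2, h3, Finset.sum_comm (f := fun i j => invMetric G y j i *
    partialDeriv i (partialDeriv j fun x => X x v) y)]
  simp only [Finset.sum_apply, Pi.smul_apply, smul_eq_mul, h1, ← Finset.sum_neg_distrib,
    ← Finset.sum_add_distrib, ← Finset.sum_sub_distrib]
  refine Finset.sum_congr rfl fun e _ => Finset.sum_congr rfl fun f _ => ?_
  ring

lemma analyticAt_laplacianFirst {y : Coord n} (hy : y ∈ V) (j : Fin n) (T : TensorArray n 4)
    (v : Fin 4 → Fin n) : AnalyticAt ℝ (fun x => laplacianFirst G j x T v) y := by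
  have hh := hG.analyticAt_invMetric hy
  have hΓ := hG.analyticAt_christoffel hy
  simp only [laplacianFirst, LinearMap.sub_apply, LinearMap.neg_apply, LinearMap.sum_apply,
    LinearMap.smul_apply, Pi.sub_apply, Pi.neg_apply, Finset.sum_apply, Pi.smul_apply, smul_eq_mul,
    LinearMap.id_apply]
  refine AnalyticAt.fun_sub (AnalyticAt.fun_sub (AnalyticAt.fun_neg ?_) ?_) ?_
  · exact Finset.analyticAt_fun_sum _ fun e _ => (hh _ _).fun_mul
      (analyticAt_act (T := fun _ => T) (fun m a => hΓ _ _ _) (fun _ => analyticAt_const) _)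
  · exact Finset.analyticAt_fun_sum _ fun e _ => (hh _ _).fun_mul
      (analyticAt_act (T := fun _ => T) (fun m a => hΓ _ _ _) (fun _ => analyticAt_const) _)
  · exact (Finset.analyticAt_fun_sum _ fun e _ => Finset.analyticAt_fun_sum _ fun f _ =>
      (hh _ _).fun_mul (hΓ _ _ _)).fun_mul analyticAt_const

lemma analyticAt_laplacianZero {y : Coord n} (hy : y ∈ V) (T : TensorArray n 4)
    (v : Fin 4 → Fin n) : AnalyticAt ℝ (fun x => laplacianZero G x T v) y := by
  have hh := hG.analyticAt_invMetric hy
  have hΓ := hG.analyticAt_christoffel hy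
  simp only [laplacianZero, LinearMap.add_apply, LinearMap.sub_apply, LinearMap.sum_apply,
    LinearMap.smul_apply, Pi.sub_apply, Pi.add_apply, Finset.sum_apply, Pi.smul_apply, smul_eq_mul,
    LinearMap.comp_apply]
  refine Finset.analyticAt_fun_sum _ fun e _ => Finset.analyticAt_fun_sum _ fun f _ =>
    (hh _ _).fun_mul (AnalyticAt.fun_add (AnalyticAt.fun_sub ?_ ?_) ?_)
  · exact analyticAt_act (T := fun x => act (fun m a => christoffel G m e a x) T)
      (fun m a => hΓ _ _ _) (fun _ => analyticAt_act (T := fun _ => T) (fun m a => hΓ _ _ _)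
        (fun _ => analyticAt_const) _) _
  · exact analyticAt_act (T := fun _ => T) (fun m a => analyticAt_partialDeriv (hΓ _ _ _) _)
      (fun _ => analyticAt_const) _
  · exact Finset.analyticAt_fun_sum _ fun m _ => (hΓ _ _ _).fun_mul
      (analyticAt_act (T := fun _ => T) (fun m a => hΓ _ _ _) (fun _ => analyticAt_const) _)

lemma analyticAt_curvOp {y : Coord n} (hy : y ∈ V) {T : Components n 4}
    (hT : ∀ v, AnalyticAt ℝ (fun x => T x v) y) (v : Fin 4 → Fin n) : AnalyticAt ℝ (fun x =>
      curvOp (invMetric G x) (fun m p d j => riemannUp G m p d j x) (T x) v) y := by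
  have hB : ∀ a b c d, AnalyticAt ℝ (fun x =>
      divAct (invMetric G x) (fun m p d j => riemannUp G m p d j x) (T x) a b c d) y :=
    fun a b c d => Finset.analyticAt_fun_sum _ fun i _ => Finset.analyticAt_fun_sum _ fun j _ =>
      (hG.analyticAt_invMetric hy _ _).fun_mul
        (analyticAt_act (fun m a => hG.analyticAt_riemannUp hy _ _ _ _) hT _)
  exact analyticAt_const.fun_mul ((((hB _ _ _ _).fun_sub (hB _ _ _ _)).fun_add
    (hB _ _ _ _)).fun_sub (hB _ _ _ _))

/-- Solvability of the linear equation `∇² Y = R(π Y) + W`, where `π` is the projection onto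
Weyl candidates. -/
lemma exists_solution {W : Components n 4} (hW : AnalyticField W V) {y₀ : Coord n} (hy₀ : y₀ ∈ V)
    (hn : 0 < n) : ∃ (Y : Components n 4) (V' : Set (Coord n)), IsOpen V' ∧ y₀ ∈ V' ∧ V' ⊆ V ∧
      AnalyticField Y V' ∧ ∀ y ∈ V', laplacian G Y y = curvOp (invMetric G y)
        (fun m p d j => riemannUp G m p d j y) (weylProj (invMetric G y) (G y) (Y y)) + W y := by
  classical
  -- The term R(πY) involves no derivatives of Y, so it joins the zeroth order coefficients and
  -- leaves the principal part scalar.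
  let C : Coord n → TensorArray n 4 →ₗ[ℝ] TensorArray n 4 := fun y =>
    laplacianZero G y - curvOp (invMetric G y) (fun m p d j => riemannUp G m p d j y) ∘ₗ
      weylProj (invMetric G y) (G y)
  -- The inverse metric cannot vanish since its product with g is the identity and n > 0; no
  -- condition on the signature enters.
  have hne : ∃ i j, invMetric G y₀ j i ≠ 0 := by
    by_contra! h0
    have := hG.sum_invMetric_mul hy₀ ⟨0, hn⟩ ⟨0, hn⟩
    simp [h0] at this
  have hC : ∀ (T : TensorArray n 4) v, AnalyticAt ℝ (fun x => C x T v) y₀ := fun T v => by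
    refine (hG.analyticAt_laplacianZero hy₀ T v).fun_sub (hG.analyticAt_curvOp hy₀ (fun w => ?_) v)
    exact (IsParallel.of_weylProj hG (fun _ => T) fun v y _ => analyticAt_const).1 w y₀ hy₀
  obtain ⟨u, hu, hsol⟩ := exists_analytic_solution y₀ (fun i j y => invMetric G y j i)
    (fun i j => hG.analyticAt_invMetric hy₀ j i) (fun i j => hG.invMetric_symm hy₀ j i) hne
    (fun j I J y => laplacianFirst G j y (fun w => if J = w then 1 else 0) I)
    (fun j I J => hG.analyticAt_laplacianFirst hy₀ j _ _)
    (fun I J y => C y (fun w => if J = w then 1 else 0) I) (fun I J => hC _ _)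
    (fun I y => W y I) (fun I => hW I y₀ hy₀)
  have hev : ∀ᶠ y in 𝓝 y₀, y ∈ V ∧ ∀ I, AnalyticAt ℝ (u I) y :=
    Filter.Eventually.and (hG.isOpen.mem_nhds hy₀) (Filter.eventually_all.2 fun I => (hu I).eventually_analyticAt)
  obtain ⟨V', hV', hVo, hyV'⟩ := eventually_nhds_iff.1 (hev.and hsol)
  refine ⟨fun y I => u I y, V', hVo, hyV', fun y hy => (hV' y hy).1.1,
    fun I y hy => (hV' y hy).1.2 I, fun y hy => ?_⟩
  have hG' := hG.mono hVo fun y hy => (hV' y hy).1.1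
  -- The solver takes matrix entries; they are the values on the standard unit arrays, from which
  -- the operators are reassembled.
  have hop : ∀ (L : TensorArray n 4 →ₗ[ℝ] TensorArray n 4) T v,
      L T v = ∑ J, L (fun w => if J = w then 1 else 0) v * T J := fun L T v => by
    rw [L.pi_apply_eq_sum_univ, Finset.sum_apply]
    exact Finset.sum_congr rfl fun J _ => mul_comm _ _
  ext v
  rw [hG'.laplacian_expand (fun I y hy => (hV' y hy).1.2 I) hy, Pi.add_apply]
  have h1 := (hV' y hy).2 v
  simp only [← hop] at h1
  rw [← h1]
  simp only [C, LinearMap.sub_apply, LinearMap.comp_apply, Pi.sub_apply]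
  ring

end IsMetricOn

end Local

/-! ### The superpotential in coordinates -/

section Superpotential

variable {n : ℕ} {G : Components n 2} {V : Set (Coord n)}

namespace IsMetricOn

variable (hG : IsMetricOn G V)
include hG

lemma isWeylArray_weylProj (hn : 4 ≤ n) {y : Coord n} (hy : y ∈ V) (T : TensorArray n 4) :
    IsWeylArray (invMetric G y) (weylProj (invMetric G y) (G y) T) :=
  WeylPotential.isWeylArray_weylProj hn (hG.invMetric_symm hy) (hG.symm y hy)
    (hG.sum_invMetric_mul hy) T

lemma weylProj_dirDeriv_dirDeriv {X : Components n 4} (hX : AnalyticField X V) {y : Coord n}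
    (hy : y ∈ V) (e f : Fin n) :
    dirDeriv G f (dirDeriv G e fun x => weylProj (invMetric G x) (G x) (X x)) y =
      weylProj (invMetric G y) (G y) (dirDeriv G f (dirDeriv G e X) y) := by
  have h := IsParallel.of_weylProj hG
  rw [dirDeriv_congr hG.isOpen (fun x hx => (h X hX).2 x hx e) hy]
  exact (h _ (hG.analyticField_dirDeriv hX e)).2 y hy f

lemma weylProj_secondCovDeriv {X : Components n 4} (hX : AnalyticField X V) {y : Coord n}
    (hy : y ∈ V) (e f : Fin n) :
    secondCovDeriv G (fun x => weylProj (invMetric G x) (G x) (X x)) e f y =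
      weylProj (invMetric G y) (G y) (secondCovDeriv G X e f y) := by
  simp only [secondCovDeriv, map_sub, map_sum, map_smul, hG.weylProj_dirDeriv_dirDeriv hX hy,
    ((IsParallel.of_weylProj hG) X hX).2 y hy]

lemma weylProj_laplacian {X : Components n 4} (hX : AnalyticField X V) {y : Coord n}
    (hy : y ∈ V) : laplacian G (fun x => weylProj (invMetric G x) (G x) (X x)) y =
      weylProj (invMetric G y) (G y) (laplacian G X y) := by
  simp only [laplacian_eq, map_sum, map_smul, hG.weylProj_secondCovDeriv hX hy]

/-- Since X = πX near y and π is parallel, the derivative of X lies in the image of π. -/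
lemma isWeylArray_dirDeriv (hn : 4 ≤ n) {X : Components n 4} (hX : AnalyticField X V)
    (hXw : ∀ y ∈ V, IsWeylArray (invMetric G y) (X y)) {y : Coord n} (hy : y ∈ V) (e : Fin n) :
    IsWeylArray (invMetric G y) (dirDeriv G e X y) := by
  rw [dirDeriv_congr hG.isOpen (fun x hx => (weylProj_of_isWeylArray (G x) (hXw x hx)).symm) hy,
    ((IsParallel.of_weylProj hG) X hX).2 y hy]
  exact hG.isWeylArray_weylProj hn hy _

lemma isWeylArray_secondCovDeriv (hn : 4 ≤ n) {X : Components n 4} (hX : AnalyticField X V)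
    (hXw : ∀ y ∈ V, IsWeylArray (invMetric G y) (X y)) {y : Coord n} (hy : y ∈ V) (e f : Fin n) :
    IsWeylArray (invMetric G y) (secondCovDeriv G X e f y) := by
  have h1 : ∀ x ∈ V, X x = weylProj (invMetric G x) (G x) (X x) := fun x hx =>
    (weylProj_of_isWeylArray (G x) (hXw x hx)).symm
  have h2 : secondCovDeriv G X e f y =
      secondCovDeriv G (fun x => weylProj (invMetric G x) (G x) (X x)) e f y := by
    simp only [secondCovDeriv, dirDeriv_congr hG.isOpen h1 hy]
    rw [dirDeriv_congr hG.isOpen (fun x hx => dirDeriv_congr hG.isOpen h1 hx e) hy]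
  rw [h2, hG.weylProj_secondCovDeriv hX hy]
  exact hG.isWeylArray_weylProj hn hy _

/-- Local existence of a Weyl candidate with prescribed `∇² X - R X`. -/
lemma exists_superpotential (hn : 4 ≤ n) {W : Components n 4} (hW : AnalyticField W V)
    (hWw : ∀ y ∈ V, IsWeylArray (invMetric G y) (W y)) {y₀ : Coord n} (hy₀ : y₀ ∈ V) :
    ∃ (X : Components n 4) (V' : Set (Coord n)), IsOpen V' ∧ y₀ ∈ V' ∧ V' ⊆ V ∧
      AnalyticField X V' ∧ (∀ y ∈ V', IsWeylArray (invMetric G y) (X y)) ∧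
      ∀ y ∈ V', laplacian G X y = curvOp (invMetric G y)
        (fun m p d j => riemannUp G m p d j y) (X y) + W y := by
  obtain ⟨Y, V', hVo, hyV', hVV', hY, hsol⟩ := hG.exists_solution hW hy₀ (by omega)
  have hG' := hG.mono hVo hVV'
  have hXw : ∀ y ∈ V', IsWeylArray (invMetric G y) (weylProj (invMetric G y) (G y) (Y y)) :=
    fun y hy => hG'.isWeylArray_weylProj hn hy _
  refine ⟨fun y => weylProj (invMetric G y) (G y) (Y y), V', hVo, hyV', hVV',
    (IsParallel.of_weylProj hG' Y hY).1, hXw, fun y hy => ?_⟩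
  -- Applying π to the equation for Y: it passes through ∇² on the left, and on the right it fixes
  -- R(πY) and W, both of which are Weyl candidates.
  rw [hG'.weylProj_laplacian hY hy, hsol y hy, map_add,
    weylProj_of_isWeylArray (G y) (hG'.isWeylArray_curvOp hy (hXw y hy)),
    weylProj_of_isWeylArray (G y) (hWw y (hVV' hy))]

end IsMetricOn

/-- The permutation `(a, b, c, d, e) ↦ (a, b, d, e, c)`. -/
def permABDEC : Equiv.Perm (Fin 5) := ⟨![0, 1, 3, 4, 2], ![0, 1, 4, 2, 3], by decide, by decide⟩

/-- The permutation `(a, b, c, d, e) ↦ (a, b, e, c, d)`. -/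
def permABECD : Equiv.Perm (Fin 5) := ⟨![0, 1, 4, 2, 3], ![0, 1, 3, 4, 2], by decide, by decide⟩

/-- Half of the cyclic sum over the last three slots. -/
def cyclicHalf : TensorArray n 5 →ₗ[ℝ] TensorArray n 5 :=
  (1 / 2 : ℝ) • (LinearMap.id + permSlots permABDEC + permSlots permABECD)

lemma cyclicHalf_apply (H : TensorArray n 5) (a b c d e : Fin n) : cyclicHalf H ![a, b, c, d, e] =
    (1 / 2) * (H ![a, b, c, d, e] + H ![a, b, d, e, c] + H ![a, b, e, c, d]) := by
  have h1 : permSlots permABDEC H ![a, b, c, d, e] = H ![a, b, d, e, c] :=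
    congrArg H (by ext i; fin_cases i <;> rfl)
  have h2 : permSlots permABECD H ![a, b, c, d, e] = H ![a, b, e, c, d] :=
    congrArg H (by ext i; fin_cases i <;> rfl)
  simp [cyclicHalf, h1, h2, mul_add]

lemma isParallel_cyclicHalf : IsParallel G V fun _ => cyclicHalf (n := n) :=
  ((IsParallel.id.add (.of_permSlots _)).add (.of_permSlots _)).smul _

/-- The array `(3/2) X_{ab[cd;e]}` of a Weyl candidate field `X`. -/
def potentialArray (G : Components n 2) (X : Components n 4) : Components n 5 :=
  fun y => cyclicHalf (covDeriv G X y)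

/-- The pointwise properties of the components of a potential. -/
structure IsPotentialArray (h : Matrix (Fin n) (Fin n) ℝ) (P : TensorArray n 5) : Prop where
  skew_two : ∀ a b c d e, P ![b, a, c, d, e] = -P ![a, b, c, d, e]
  skew_three_left : ∀ a b c d e, P ![a, b, d, c, e] = -P ![a, b, c, d, e]
  skew_three_right : ∀ a b c d e, P ![a, b, c, e, d] = -P ![a, b, c, d, e]
  cyclic : ∀ u a b c d, P ![u, a, b, c, d] - P ![u, b, a, c, d] - P ![u, c, b, a, d]
    - P ![u, d, b, c, a] = 0
  trace_eq_zero : ∀ v, doubleTrace h (fun i k j l => P ![i, j, k, l, v]) = 0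

/-- The trace `h^{ij} F_{ij}` as a linear functional. -/
def traceForm (h : Matrix (Fin n) (Fin n) ℝ) : (Fin n → Fin n → ℝ) →ₗ[ℝ] ℝ where
  toFun F := ∑ i, ∑ j, h i j * F i j
  map_add' F F' := by simp [mul_add, Finset.sum_add_distrib]
  map_smul' r F := by
    simp only [Pi.smul_apply, smul_eq_mul, mul_left_comm _ r, ← Finset.mul_sum, RingHom.id_apply]

lemma traceForm_apply (h : Matrix (Fin n) (Fin n) ℝ) (F : Fin n → Fin n → ℝ) :
    ∑ i, ∑ j, h i j * F i j = traceForm h F := rfl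

/-! ### The potential of a superpotential and the Weyl tensor it generates -/

namespace IsMetricOn

variable (hG : IsMetricOn G V) (hn : 4 ≤ n) {X : Components n 4} (hX : AnalyticField X V)
  (hXw : ∀ y ∈ V, IsWeylArray (invMetric G y) (X y))
include hG hX

lemma analyticField_potentialArray : AnalyticField (potentialArray G X) V :=
  (isParallel_cyclicHalf (G := G) _ (hG.analyticField_covDeriv hX)).1

lemma covDeriv_potentialArray {y : Coord n} (hy : y ∈ V) (a b c d e f : Fin n) :
    covDeriv G (potentialArray G X) y ![a, b, c, d, e, f] =
      (1 / 2) * (secondCovDeriv G X e f y ![a, b, c, d] + secondCovDeriv G X c f y ![a, b, d, e]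
        + secondCovDeriv G X d f y ![a, b, e, c]) := by
  have h1 := (isParallel_cyclicHalf (G := G) _ (hG.analyticField_covDeriv hX)).2 y hy f
  rw [covDeriv_five]
  refine (congrFun h1 _).trans ?_
  rw [cyclicHalf_apply, ← covDeriv_five, ← covDeriv_five, ← covDeriv_five,
    covDeriv_covDeriv_four, covDeriv_covDeriv_four, covDeriv_covDeriv_four]

lemma act_riemannUp_eq {y : Coord n} (hy : y ∈ V) (e f : Fin n) (v : Fin 4 → Fin n) :
    act (fun m p => riemannUp G m p e f y) (X y) v =
      secondCovDeriv G X e f y v - secondCovDeriv G X f e y v := by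
  have h2 := hG.covDeriv_covDeriv_sub hX hy e f
    (Fin.snoc (α := fun _ => Fin n) (Fin.snoc (α := fun _ => Fin n) v e) f)
    (Fin.snoc (α := fun _ => Fin n) (Fin.snoc (α := fun _ => Fin n) v f) e) (Fin.snoc_last ..)
    (by rw [Fin.snoc_castSucc, Fin.snoc_last]) (Fin.snoc_last ..)
    (by rw [Fin.snoc_castSucc, Fin.snoc_last]) fun s => by simp only [Fin.snoc_castSucc]
  rw [covDeriv_covDeriv, covDeriv_covDeriv] at h2
  simp only [Fin.snoc_castSucc, Fin.snoc_last] at h2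
  rw [← h2]
  simp [secondCovDeriv, Finset.sum_apply]

include hn hXw

/-- Skewness of ∇X in its third and fourth slots pairs the six terms of the antisymmetrization, so
the factor is (3/2)·(1/6)·2 = 1/2 times the cyclic sum. -/
lemma potentialOfSuperpotential_eq {y : Coord n} (hy : y ∈ V) (a b c d e : Fin n) :
    potentialOfSuperpotential G X a b c d e y = potentialArray G X y ![a, b, c, d, e] := by
  have hw := fun e => hG.isWeylArray_dirDeriv hn hX hXw hy e
  rw [potentialOfSuperpotential, antisymmetrize_three, potentialArray, cyclicHalf_apply]
  simp only [Matrix.cons_val, covDeriv_four]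
  rw [(hw d).skew_right a b e c, (hw e).skew_right a b c d, (hw c).skew_right a b d e]
  ring

lemma isPotentialArray_potentialArray {y : Coord n} (hy : y ∈ V) :
    IsPotentialArray (invMetric G y) (potentialArray G X y) := by
  have hw := fun e => hG.isWeylArray_dirDeriv hn hX hXw hy e
  have hP : ∀ a b c d e, potentialArray G X y ![a, b, c, d, e] =
      (1 / 2) * (dirDeriv G e X y ![a, b, c, d] + dirDeriv G c X y ![a, b, d, e]
        + dirDeriv G d X y ![a, b, e, c]) := fun a b c d e => by
    simp only [potentialArray, cyclicHalf_apply, covDeriv_four]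
  refine ⟨fun a b c d e => ?_, fun a b c d e => ?_, fun a b c d e => ?_, fun u a b c d => ?_,
    fun v => ?_⟩
  · rw [hP, hP, (hw e).skew_left a b, (hw c).skew_left a b, (hw d).skew_left a b]
    ring
  · rw [hP, hP, (hw e).skew_right a b c d, (hw d).skew_right a b e c, (hw c).skew_right a b d e]
    ring
  · rw [hP, hP, (hw e).skew_right a b c d, (hw d).skew_right a b e c, (hw c).skew_right a b d e]
    ring
  · simp only [hP]
    linear_combination (1 / 2) * ((hw d).cyclic u a b c - (hw d).skew_right u b c a
      - (hw d).skew_right u c a b + (hw c).cyclic u a d b - (hw c).skew_right u b a d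
      - (hw c).skew_right u d b a + (hw b).cyclic u a c d - (hw b).skew_right u c d a
      - (hw b).skew_right u d a c - (hw a).cyclic u b c d)
  -- In each of the three terms of P one of the two contractions joins two slots of X and does not
  -- involve the derivative index, so it vanishes.
  · have h1 : (doubleTrace (invMetric G y) fun i k j l => potentialArray G X y ![i, j, k, l, v]) =
        (doubleTrace (invMetric G y) fun i k j l => (1 / 2) * dirDeriv G v X y ![i, j, k, l])
        + (doubleTrace (invMetric G y) fun i k j l => (1 / 2) * dirDeriv G k X y ![i, j, l, v])
        + doubleTrace (invMetric G y) fun i k j l => (1 / 2) * dirDeriv G l X y ![i, j, v, k] := by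
      rw [← doubleTrace_add, ← doubleTrace_add]
      congr 1
      ext i k j l
      rw [hP]
      ring
    have h2 : ∀ F : Fin n → Fin n → ℝ, ∑ i, ∑ j, invMetric G y i j * F i j = 0 →
        ∑ i, ∑ j, invMetric G y i j * ((1 / 2) * F i j) = 0 := fun F hF => by
      simp only [mul_left_comm _ (1 / 2 : ℝ), ← Finset.mul_sum, hF, mul_zero]
    rw [h1, doubleTrace_eq_zero_left _ fun j l => h2 _ ((hw v).trace_one_three j l),
      doubleTrace_eq_zero_left _ fun j l => h2 _ ((hw l).trace_eq_zero j v),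
      ← doubleTrace_comm, doubleTrace_eq_zero_left _ fun i k => h2 _ ((hw k).trace_two_three i v)]
    simp

/-- The two divergences of P contribute ½∇²X each, by pair symmetry. Their other terms are second
derivatives with the divergence taken last; the antisymmetrized traces of ∇P contribute the same
derivatives in the opposite order, their remaining terms being traces of X. The differences are the
commutators collected in `curvOp`. -/
lemma weylOfPotential_eq {y : Coord n} (hy : y ∈ V) (a b c d : Fin n) :
    weylOfPotential G (potentialArray G X) a b c d y = laplacian G X y ![a, b, c, d]
      - curvOp (invMetric G y) (fun m p d j => riemannUp G m p d j y) (X y) ![a, b, c, d] := by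
  have hZ := fun e f => hG.isWeylArray_secondCovDeriv hn hX hXw hy e f
  have hact := fun e f a b c d => hG.act_riemannUp_eq hX hy e f ![a, b, c, d]
  have t1 : ∀ e f b c, traceForm (invMetric G y)
      (fun i j => secondCovDeriv G X e f y ![i, b, c, j]) = 0 := fun e f b c =>
    (hZ e f).trace_eq_zero b c
  have t2 : ∀ e f b c, traceForm (invMetric G y)
      (fun i j => secondCovDeriv G X e f y ![i, b, j, c]) = 0 := fun e f b c =>
    (hZ e f).trace_one_three b c
  rw [weylOfPotential, laplacian_eq, curvOp_apply]
  simp only [antisymmetrize_two, divAct, hact, hG.covDeriv_potentialArray hX hy,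
    Matrix.cons_val_zero, Matrix.cons_val_one, Finset.sum_apply, Pi.smul_apply, smul_eq_mul,
    traceForm_apply]
  generalize traceForm (invMetric G y) = τ at t1 t2 ⊢
  have l3 : ∀ A B C : Fin n → Fin n → ℝ, τ (fun i j => 1 / 2 * (A i j + B i j + C i j)) =
      1 / 2 * (τ A + τ B + τ C) := fun A B C => by
    rw [← map_add, ← map_add, ← smul_eq_mul (1 / 2 : ℝ), ← map_smul]
    rfl
  have l2 : ∀ A B : Fin n → Fin n → ℝ, τ (fun i j => A i j - B i j) = τ A - τ B := fun A B =>
    map_sub τ A B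
  have ln : ∀ A B : Fin n → Fin n → ℝ, (∀ i j, A i j = -B i j) → τ A = -τ B := fun A B h => by
    rw [← map_neg]
    exact congrArg τ (funext fun i => funext fun j => h i j)
  have s1 : τ (fun i j => secondCovDeriv G X i j y ![c, d, a, b]) =
      τ fun i j => secondCovDeriv G X i j y ![a, b, c, d] :=
    congrArg τ (funext fun i => funext fun j => (hZ i j).pair_symm a b c d)
  have s2 : ∀ e a b c, τ (fun i j => secondCovDeriv G X e j y ![a, b, i, c]) =
      -τ fun i j => secondCovDeriv G X e j y ![a, b, c, i] := fun e a b c =>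
    ln _ _ fun i j => (hZ e j).skew_right a b c i
  have s3 : ∀ e a b c, τ (fun i j => secondCovDeriv G X j e y ![i, c, a, b]) =
      -τ fun i j => secondCovDeriv G X j e y ![a, b, c, i] := fun e a b c =>
    ln _ _ fun i j => ((hZ j e).pair_symm a b i c).trans ((hZ j e).skew_right a b c i)
  simp only [l3, l2, t1, t2, s1, s2, s3]
  ring

end IsMetricOn

end Superpotential

/-! ### Multilinear maps and their components in a basis -/

section PermVectors

variable {α : Type*} (a b c d e : α)

lemma cons_refl : (fun s => ![a, b, c, d] (Equiv.refl (Fin 4) s)) = ![a, b, c, d] := by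
  ext s; fin_cases s <;> rfl

lemma cons_permACDB : (fun s => ![a, b, c, d] (permACDB s)) = ![a, c, d, b] := by
  ext s; fin_cases s <;> rfl

lemma cons_permADBC : (fun s => ![a, b, c, d] (permADBC s)) = ![a, d, b, c] := by
  ext s; fin_cases s <;> rfl

lemma cons_permBACD : (fun s => ![a, b, c, d] (permBACD s)) = ![b, a, c, d] := by
  ext s; fin_cases s <;> rfl

lemma cons_permABDC : (fun s => ![a, b, c, d] (permABDC s)) = ![a, b, d, c] := by
  ext s; fin_cases s <;> rfl

lemma cons_refl_five : (fun s => ![a, b, c, d, e] (Equiv.refl (Fin 5) s)) = ![a, b, c, d, e] := by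
  ext s; fin_cases s <;> rfl

lemma cons_swap_0_1 : (fun s => ![a, b, c, d, e] (Equiv.swap (α := Fin 5) 0 1 s)) = ![b, a, c, d, e] := by
  ext s; fin_cases s <;> simp [Equiv.swap_apply_def]

lemma cons_swap_2_3 : (fun s => ![a, b, c, d, e] (Equiv.swap (α := Fin 5) 2 3 s)) = ![a, b, d, c, e] := by
  ext s; fin_cases s <;> simp [Equiv.swap_apply_def]

lemma cons_swap_3_4 : (fun s => ![a, b, c, d, e] (Equiv.swap (α := Fin 5) 3 4 s)) = ![a, b, c, e, d] := by
  ext s; fin_cases s <;> simp [Equiv.swap_apply_def]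

lemma cons_swap_1_2 : (fun s => ![a, b, c, d, e] (Equiv.swap (α := Fin 5) 1 2 s)) = ![a, c, b, d, e] := by
  ext s; fin_cases s <;> simp [Equiv.swap_apply_def]

lemma cons_swap_1_3 : (fun s => ![a, b, c, d, e] (Equiv.swap (α := Fin 5) 1 3 s)) = ![a, d, c, b, e] := by
  ext s; fin_cases s <;> simp [Equiv.swap_apply_def]

lemma cons_swap_1_4 : (fun s => ![a, b, c, d, e] (Equiv.swap (α := Fin 5) 1 4 s)) = ![a, e, c, d, b] := by
  ext s; fin_cases s <;> simp [Equiv.swap_apply_def]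

end PermVectors

section Bases

variable {V : Type*} [AddCommGroup V] [Module ℝ V] {n k : ℕ}

/-- The components of a multilinear map in a basis. -/
def basisComponents (b : Module.Basis (Fin n) ℝ V) (T : MultilinearMap ℝ (fun _ : Fin k => V) ℝ) :
    TensorArray n k := fun v => T fun s => b (v s)

lemma basisComponents_two (b : Module.Basis (Fin n) ℝ V)
    (T : MultilinearMap ℝ (fun _ : Fin 2 => V) ℝ) (i j : Fin n) :
    basisComponents b T ![i, j] = T ![b i, b j] :=
  congrArg T (by ext s; fin_cases s <;> rfl)

lemma basisComponents_four (b : Module.Basis (Fin n) ℝ V)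
    (T : MultilinearMap ℝ (fun _ : Fin 4 => V) ℝ) (i j m l : Fin n) :
    basisComponents b T ![i, j, m, l] = T ![b i, b j, b m, b l] :=
  congrArg T (by ext s; fin_cases s <;> rfl)

lemma basisComponents_five (b : Module.Basis (Fin n) ℝ V)
    (T : MultilinearMap ℝ (fun _ : Fin 5 => V) ℝ) (i j m l p : Fin n) :
    basisComponents b T ![i, j, m, l, p] = T ![b i, b j, b m, b l, b p] :=
  congrArg T (by ext s; fin_cases s <;> rfl)

/-- A linear relation between the permutations of a multilinear map holds if it holds in a
basis. -/
lemma sum_perm_eq_zero (b : Module.Basis (Fin n) ℝ V) {T : MultilinearMap ℝ (fun _ : Fin k => V) ℝ}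
    {m : ℕ} (c : Fin m → ℝ) (σ : Fin m → Equiv.Perm (Fin k))
    (h : ∀ v : Fin k → Fin n, ∑ i, c i * basisComponents b T (fun s => v (σ i s)) = 0) (v : Fin k → V) :
    ∑ i, c i * T (fun s => v (σ i s)) = 0 := by
  have h1 : ∑ i, c i • T.domDomCongr (σ i) = 0 := by
    refine Module.Basis.ext_multilinear (fun _ => b) fun w => ?_
    simpa [sum_apply, basisComponents] using h w
  simpa [sum_apply] using congrArg (fun S => S v) h1

lemma map_swap_of_basis (b : Module.Basis (Fin n) ℝ V)
    {T : MultilinearMap ℝ (fun _ : Fin k => V) ℝ} (σ : Equiv.Perm (Fin k))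
    (h : ∀ v, basisComponents b T (fun s => v (σ s)) = -basisComponents b T v) (v : Fin k → V) :
    T (fun s => v (σ s)) = -T v := by
  have h1 := sum_perm_eq_zero b (T := T) ![1, 1] ![σ, Equiv.refl _]
    (fun v => by simp [Fin.sum_univ_two, h v]) v
  simp only [Fin.sum_univ_two, Matrix.cons_val_zero, Matrix.cons_val_one, Equiv.refl_apply,
    one_mul] at h1
  linarith

/-- The bilinear map given by two slots of a multilinear map. -/
def slotPair (T : MultilinearMap ℝ (fun _ : Fin k => V) ℝ) (m : Fin k → V) {i j : Fin k}
    (hij : i ≠ j) : V →ₗ[ℝ] V →ₗ[ℝ] ℝ :=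
  LinearMap.mk₂ ℝ (fun u w => T (Function.update (Function.update m i u) j w))
    (fun u u' w => by simp only [Function.update_comm hij, MultilinearMap.map_update_add])
    (fun c u w => by simp only [Function.update_comm hij, MultilinearMap.map_update_smul])
    (fun u w w' => by simp only [MultilinearMap.map_update_add])
    (fun c u w => by simp only [MultilinearMap.map_update_smul])

variable (g : MultilinearMap ℝ (fun _ : Fin 2 => V) ℝ)

/-- The metric as a bilinear form. -/
def metricForm : V →ₗ[ℝ] V →ₗ[ℝ] ℝ := slotPair g 0 (zero_ne_one (α := Fin 2))

lemma metricForm_apply (u w : V) : metricForm g u w = g ![u, w] :=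
  congrArg g (by ext s; fin_cases s <;> rfl)

/-- A kernel vector of the Gram matrix gives a vector orthogonal to the whole basis, which
nondegeneracy forces to be zero. -/
lemma isUnit_det_gram (hg : IsScalarProduct g) (b : Module.Basis (Fin n) ℝ V) :
    IsUnit (Matrix.of fun i j => g ![b i, b j]).det := by
  rw [isUnit_iff_ne_zero, Ne, ← Matrix.exists_mulVec_eq_zero_iff]
  rintro ⟨c, hc, h0⟩
  refine hc ?_
  have h1 : ∑ j, c j • b j = 0 := by
    refine hg.nondegenerate _ fun v => ?_
    rw [hg.symm, ← metricForm_apply]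
    have h2 : (metricForm g).flip (∑ j, c j • b j) = 0 := by
      refine b.ext fun i => ?_
      have := congrFun h0 i
      simp only [Matrix.mulVec, dotProduct, Matrix.of_apply, Pi.zero_apply] at this
      rw [LinearMap.flip_apply]
      simp only [map_sum, map_smul, metricForm_apply, smul_eq_mul, LinearMap.zero_apply]
      rw [← this]
      exact Finset.sum_congr rfl fun j _ => mul_comm _ _
    exact congrArg (fun f => f v) h2
  ext j
  exact Fintype.linearIndependent_iff.1 b.linearIndependent c h1 j

/-- The trace of a bilinear form does not depend on the basis. -/
lemma sum_invGram_mul (b b' : Module.Basis (Fin n) ℝ V) (B : V →ₗ[ℝ] V →ₗ[ℝ] ℝ) :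
    ∑ i, ∑ j, invGram g b' i j * B (b' i) (b' j) = ∑ i, ∑ j, invGram g b i j * B (b i) (b j) := by
  have hexp : ∀ C : V →ₗ[ℝ] V →ₗ[ℝ] ℝ, (Matrix.of fun i j => C (b' i) (b' j)) =
      (b.toMatrix b').transpose * (Matrix.of fun i j => C (b i) (b j)) * b.toMatrix b' :=
    fun C => by
      ext i j
      simp only [Matrix.of_apply, Matrix.mul_apply, Matrix.transpose_apply]
      conv_lhs => rw [← b.sum_toMatrix_smul_self b' i, ← b.sum_toMatrix_smul_self b' j]
      simp only [map_sum, map_smul, LinearMap.sum_apply, LinearMap.smul_apply, smul_eq_mul,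
        Finset.mul_sum, Finset.sum_mul]
      exact Finset.sum_congr rfl fun p _ => Finset.sum_congr rfl fun q _ => by ring
  have htr : ∀ (b : Module.Basis (Fin n) ℝ V), ∑ i, ∑ j, invGram g b i j * B (b i) (b j) =
      ((invGram g b) * (Matrix.of fun i j => B (b i) (b j)).transpose).trace := fun b => by
    simp [Matrix.trace, Matrix.mul_apply]
  -- The Gram matrix changes by congruence, so its inverse changes by the inverse congruence, and
  -- the change of basis cancels inside the matrix trace.
  have hgram : invGram g b' = (b'.toMatrix b) * invGram g b * (b'.toMatrix b).transpose := by
    have h1 := hexp (metricForm g)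
    simp only [metricForm_apply] at h1
    have h2 : (b.toMatrix b')⁻¹ = b'.toMatrix b :=
      Matrix.inv_eq_right_inv (b.toMatrix_mul_toMatrix_flip b')
    have h3 : ((b.toMatrix b').transpose)⁻¹ = (b'.toMatrix b).transpose := by
      rw [← Matrix.transpose_nonsing_inv, h2]
    unfold invGram
    rw [h1, Matrix.mul_inv_rev, Matrix.mul_inv_rev, h2, h3, Matrix.mul_assoc]
  have h4 : (b'.toMatrix b).transpose * (b.toMatrix b').transpose = 1 := by
    rw [← Matrix.transpose_mul, b.toMatrix_mul_toMatrix_flip b', Matrix.transpose_one]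
  rw [htr, htr, hexp B, hgram, Matrix.transpose_mul, Matrix.transpose_mul, Matrix.transpose_transpose]
  set S := (Matrix.of fun i j => B (b i) (b j)).transpose
  calc _ = ((b'.toMatrix b) * (invGram g b * ((b'.toMatrix b).transpose *
        (b.toMatrix b').transpose) * S * b.toMatrix b')).trace := by
        simp only [Matrix.mul_assoc]
    _ = (invGram g b * S * (b.toMatrix b' * b'.toMatrix b)).trace := by
        rw [h4, mul_one, Matrix.trace_mul_comm, Matrix.mul_assoc]
    _ = _ := by rw [b.toMatrix_mul_toMatrix_flip b', mul_one]

variable {g}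

lemma isWeylArray_of_isWeylCandidate (b : Module.Basis (Fin n) ℝ V)
    {X : MultilinearMap ℝ (fun _ : Fin 4 => V) ℝ} (hX : IsWeylCandidate n g X) :
    IsWeylArray (invGram g b) (basisComponents b X) where
  skew_left a b c d := by
    simp only [basisComponents_four]
    exact hX.skew_left _ _ _ _
  skew_right a b c d := by
    simp only [basisComponents_four]
    exact hX.skew_right _ _ _ _
  cyclic a b' c d := by
    simp only [basisComponents_four]
    have h1 := hX.cyclic (b a) (b b') (b c) (b d)
    rw [antisymmetrize_three] at h1
    simp only [Matrix.cons_val] at h1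
    have r := hX.skew_right (b a)
    linarith [r (b b') (b c) (b d), r (b c) (b d) (b b'), r (b d) (b b') (b c)]
  trace_eq_zero v w := by
    simp only [basisComponents_four]
    exact hX.trace_eq_zero b _ _

/-- Linear symmetries extend from a basis by multilinearity. The trace condition is required in
every basis and for arbitrary vectors, so it also needs the invariance of the trace. -/
lemma isWeylCandidate_of_isWeylArray (b : Module.Basis (Fin n) ℝ V)
    {X : MultilinearMap ℝ (fun _ : Fin 4 => V) ℝ}
    (hX : IsWeylArray (invGram g b) (basisComponents b X)) : IsWeylCandidate n g X := by
  have hl : ∀ u v w z, X ![v, u, w, z] = -X ![u, v, w, z] := fun u v w z => by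
    rw [← map_swap_of_basis b permBACD (fun t => ?_) ![u, v, w, z]]
    · rw [cons_permBACD]
    · rw [vec_four t, cons_permBACD]
      exact hX.skew_left _ _ _ _
  have hr : ∀ u v w z, X ![u, v, z, w] = -X ![u, v, w, z] := fun u v w z => by
    rw [← map_swap_of_basis b permABDC (fun t => ?_) ![u, v, w, z]]
    · rw [cons_permABDC]
    · rw [vec_four t, cons_permABDC]
      exact hX.skew_right _ _ _ _
  refine ⟨hl, hr, fun u v w z => ?_, fun b' v w => ?_⟩
  · have h1 := sum_perm_eq_zero b (T := X) ![1, 1, 1] ![Equiv.refl _, permACDB, permADBC]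
      (fun t => ?_) ![u, v, w, z]
    · simp only [Fin.sum_univ_three, Matrix.cons_val, one_mul, cons_refl, cons_permACDB,
        cons_permADBC] at h1
      rw [antisymmetrize_three]
      simp only [Matrix.cons_val]
      linarith [hr u v w z, hr u w z v, hr u z v w]
    · rw [vec_four t]
      simp only [Fin.sum_univ_three, Matrix.cons_val, one_mul, cons_refl, cons_permACDB,
        cons_permADBC]
      exact hX.cyclic (t 0) (t 1) (t 2) (t 3)
  -- With v and w fixed, the contracted slots form a bilinear map whose trace may be moved to the
  -- basis b; bilinearity in v and w then reduces to basis vectors.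
  · have h1 : ∀ u z, slotPair X ![0, v, w, 0] (i := 0) (j := 3) (by decide) u z = X ![u, v, w, z] :=
      fun u z => congrArg X (by ext s; fin_cases s <;> rfl)
    simp only [← h1]
    rw [sum_invGram_mul g b b']
    simp only [h1]
    have h2 : ∀ i j v w, slotPair X ![b i, 0, 0, b j] (i := 1) (j := 2) (by decide) v w =
        X ![b i, v, w, b j] :=
      fun i j v w => congrArg X (by ext s; fin_cases s <;> rfl)
    have h3 : ∑ i, ∑ j, invGram g b i j •
        slotPair X ![b i, 0, 0, b j] (i := 1) (j := 2) (by decide) = 0 := by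
      refine LinearMap.ext_basis b b fun p q => ?_
      simp only [LinearMap.sum_apply, LinearMap.smul_apply, h2, smul_eq_mul, LinearMap.zero_apply]
      simpa only [basisComponents_four] using hX.trace_eq_zero p q
    have h4 := congrArg (fun L => L v w) h3
    simpa only [LinearMap.sum_apply, LinearMap.smul_apply, h2, smul_eq_mul,
      LinearMap.zero_apply] using h4

lemma isWeylPotentialForm_of_isPotentialArray (b : Module.Basis (Fin n) ℝ V)
    {P : MultilinearMap ℝ (fun _ : Fin 5 => V) ℝ}
    (hP : IsPotentialArray (invGram g b) (basisComponents b P)) : IsWeylPotentialForm n g P := by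
  have hs : ∀ (i j : Fin 5), (∀ t : Fin 5 → Fin n, basisComponents b P (fun s => t (Equiv.swap i j s))
      = -basisComponents b P t) → ∀ v : Fin 5 → V, P (fun s => v (Equiv.swap i j s)) = -P v :=
    fun i j h => map_swap_of_basis b _ h
  refine ⟨⟨fun u v x y z => ?_, fun u v x y z => ?_, fun u v x y z => ?_⟩, fun u v x y z => ?_,
    fun b' v => ?_⟩
  · rw [← hs 0 1 (fun t => by rw [vec_five t, cons_swap_0_1]; exact hP.skew_two _ _ _ _ _) ![u, v, x, y, z], cons_swap_0_1]
  · rw [← hs 2 3 (fun t => by rw [vec_five t, cons_swap_2_3]; exact hP.skew_three_left _ _ _ _ _) ![u, v, x, y, z],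
      cons_swap_2_3]
  · rw [← hs 3 4 (fun t => by rw [vec_five t, cons_swap_3_4]; exact hP.skew_three_right _ _ _ _ _) ![u, v, x, y, z],
      cons_swap_3_4]
  · refine antisymmetrize_four_eq_zero (fun a b' c d => ?_) _
    simp only [Matrix.cons_val]
    have h1 := sum_perm_eq_zero b (T := P) ![1, -1, -1, -1]
      ![Equiv.refl _, Equiv.swap 1 2, Equiv.swap 1 3, Equiv.swap 1 4] (fun t => ?_) ![u, a, b', c, d]
    · simp only [Fin.sum_univ_four, Matrix.cons_val, one_mul, cons_swap_1_2, cons_swap_1_3, cons_swap_1_4, cons_refl_five] at h1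
      linarith
    · rw [vec_five t]
      simp only [Fin.sum_univ_four, Matrix.cons_val, one_mul, cons_swap_1_2, cons_swap_1_3, cons_swap_1_4, cons_refl_five]
      linarith [hP.cyclic (t 0) (t 1) (t 2) (t 3) (t 4)]
  · have h1 : ∀ j l u w, slotPair P ![0, j, 0, l, v] (i := 0) (j := 2) (by decide) u w =
        P ![u, j, w, l, v] := fun j l u w => congrArg P (by ext s; fin_cases s <;> rfl)
    have h2 : ∀ i k u w, slotPair P ![i, 0, k, 0, v] (i := 1) (j := 3) (by decide) u w =
        P ![i, u, k, w, v] := fun i k u w => congrArg P (by ext s; fin_cases s <;> rfl)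
    have h3 : ∑ i, ∑ k, ∑ j, ∑ l, invGram g b i k * invGram g b j l * P ![b i, b j, b k, b l, v]
        = 0 := by
      have h4 : ∑ i, ∑ k, ∑ j, ∑ l, (invGram g b i k * invGram g b j l) •
          P.toLinearMap ![b i, b j, b k, b l, 0] 4 = 0 := by
        refine b.ext fun p => ?_
        have h5 := hP.trace_eq_zero p
        simp only [doubleTrace, basisComponents_five] at h5
        simp only [LinearMap.sum_apply, LinearMap.smul_apply, smul_eq_mul, LinearMap.zero_apply]
        refine Eq.trans ?_ h5
        refine Finset.sum_congr rfl fun i _ => Finset.sum_congr rfl fun k _ =>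
          Finset.sum_congr rfl fun j _ => Finset.sum_congr rfl fun l _ => congrArg _ ?_
        exact congrArg P (by ext s; fin_cases s <;> rfl)
      have h5 := congrArg (fun L => L v) h4
      simp only [LinearMap.sum_apply, LinearMap.smul_apply, smul_eq_mul, LinearMap.zero_apply] at h5
      refine Eq.trans ?_ h5
      refine Finset.sum_congr rfl fun i _ => Finset.sum_congr rfl fun k _ =>
        Finset.sum_congr rfl fun j _ => Finset.sum_congr rfl fun l _ => congrArg _ ?_
      exact congrArg P (by ext s; fin_cases s <;> rfl)
    have h4 : ∀ F : Fin n → Fin n → Fin n → Fin n → ℝ,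
        ∑ i, ∑ j, ∑ k, ∑ l, F i k j l = ∑ j, ∑ l, ∑ i, ∑ k, F i k j l := fun F => by
      calc _ = ∑ j, ∑ i, ∑ k, ∑ l, F i k j l := Finset.sum_comm
        _ = ∑ j, ∑ i, ∑ l, ∑ k, F i k j l := Finset.sum_congr rfl fun _ _ =>
            Finset.sum_congr rfl fun _ _ => Finset.sum_comm
        _ = _ := Finset.sum_congr rfl fun _ _ => Finset.sum_comm
    have h5 : ∀ F : Fin n → Fin n → Fin n → Fin n → ℝ,
        ∑ j, ∑ l, ∑ i, ∑ k, F i k j l = ∑ i, ∑ k, ∑ j, ∑ l, F i k j l := fun F => by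
      rw [← h4, Finset.sum_congr rfl fun _ _ => Finset.sum_comm]
    -- The basis is replaced in one contracted pair at a time, the other pair being frozen
    -- meanwhile.
    calc ∑ i, ∑ j, ∑ k, ∑ l, invGram g b' i k * invGram g b' j l * P ![b' i, b' j, b' k, b' l, v]
      _ = ∑ j, ∑ l, ∑ i, ∑ k,
          invGram g b' i k * invGram g b' j l * P ![b' i, b' j, b' k, b' l, v] :=
        h4 fun i k j l => invGram g b' i k * invGram g b' j l * P ![b' i, b' j, b' k, b' l, v]
      _ = ∑ j, ∑ l, ∑ i, ∑ k,
          invGram g b i k * invGram g b' j l * P ![b i, b' j, b k, b' l, v] := by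
        refine Finset.sum_congr rfl fun j _ => Finset.sum_congr rfl fun l _ => ?_
        simp only [mul_right_comm _ (invGram g b' j l), ← Finset.sum_mul]
        simp only [← h1, sum_invGram_mul g b b']
      _ = ∑ i, ∑ k, ∑ j, ∑ l,
          invGram g b i k * invGram g b' j l * P ![b i, b' j, b k, b' l, v] :=
        h5 fun i k j l => invGram g b i k * invGram g b' j l * P ![b i, b' j, b k, b' l, v]
      _ = ∑ i, ∑ k, ∑ j, ∑ l, invGram g b i k * invGram g b j l * P ![b i, b j, b k, b l, v] := by
        refine Finset.sum_congr rfl fun i _ => Finset.sum_congr rfl fun k _ => ?_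
        simp only [mul_assoc, ← Finset.mul_sum]
        simp only [← h2, sum_invGram_mul g b b']
      _ = 0 := h3

end Bases

/-! ### Tensor fields from components -/

section Transfer

variable {n k : ℕ} {M : Type*} [TopologicalSpace M]
  [ChartedSpace (EuclideanSpace ℝ (Fin n)) M]

lemma mdifferentiable_of_mem_maximalAtlas [IsManifold (𝓡 n) ω M]
    {e : OpenPartialHomeomorph M (EuclideanSpace ℝ (Fin n))}
    (he : e ∈ IsManifold.maximalAtlas (𝓡 n) ω M) : e.MDifferentiable (𝓡 n) (𝓡 n) :=
  ⟨(contMDiffOn_of_mem_maximalAtlas he).mdifferentiableOn (by simp),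
    (contMDiffOn_symm_of_mem_maximalAtlas he).mdifferentiableOn (by simp)⟩

variable {e : OpenPartialHomeomorph M (EuclideanSpace ℝ (Fin n))}

/-- The coordinate vectors form a basis. -/
def coordBasis (he : e.MDifferentiable (𝓡 n) (𝓡 n)) {y : Coord n} (hy : y ∈ e.target) :
    Module.Basis (Fin n) ℝ (TangentSpace (𝓡 n) (e.symm y)) :=
  (EuclideanSpace.basisFun (Fin n) ℝ).toBasis.map (he.symm.mfderiv hy).toLinearEquiv

lemma coordBasis_apply (he : e.MDifferentiable (𝓡 n) (𝓡 n)) {y : Coord n} (hy : y ∈ e.target)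
    (i : Fin n) : coordBasis he hy i = coordVector e y i := by
  refine (Module.Basis.map_apply _ _ _).trans ?_
  change mfderiv (𝓡 n) (𝓡 n) e.symm y ((EuclideanSpace.basisFun (Fin n) ℝ).toBasis i) = _
  rw [OrthonormalBasis.coe_toBasis, EuclideanSpace.basisFun_apply]
  rfl

lemma basisComponents_coordBasis (he : e.MDifferentiable (𝓡 n) (𝓡 n)) {y : Coord n}
    (hy : y ∈ e.target) (T : TensorField n M k) :
    basisComponents (coordBasis he hy) (T (e.symm y)) = components e T y := by
  ext v
  simp only [basisComponents, coordBasis_apply]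
  rfl

lemma invGram_coordBasis (he : e.MDifferentiable (𝓡 n) (𝓡 n)) {y : Coord n} (hy : y ∈ e.target)
    (g : TensorField n M 2) :
    invGram (g (e.symm y)) (coordBasis he hy) = invMetric (components e g) y := by
  unfold invGram invMetric
  congr 2
  ext i j
  rw [← basisComponents_two, basisComponents_coordBasis]

/-- The coordinate differential `dx^i` of the chart `e` at `q`. -/
def coordForm (e : OpenPartialHomeomorph M (EuclideanSpace ℝ (Fin n))) (q : M) (i : Fin n) :
    TangentSpace (𝓡 n) q →ₗ[ℝ] ℝ :=
  (EuclideanSpace.proj (𝕜 := ℝ) i : EuclideanSpace ℝ (Fin n) →L[ℝ] ℝ).toLinearMap ∘ₗ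
    (mfderiv (𝓡 n) (𝓡 n) e q).toLinearMap

lemma coordForm_coordVector (he : e.MDifferentiable (𝓡 n) (𝓡 n)) {y : Coord n}
    (hy : y ∈ e.target) (i j : Fin n) :
    coordForm e (e.symm y) i (coordVector e y j) = if i = j then 1 else 0 := by
  have h := congrArg (fun L => L (EuclideanSpace.single j (1 : ℝ))) (he.comp_symm_deriv hy)
  have h2 : mfderiv (𝓡 n) (𝓡 n) e (e.symm y) (coordVector e y j) =
      EuclideanSpace.single j (1 : ℝ) := h
  change (EuclideanSpace.proj i : EuclideanSpace ℝ (Fin n) →L[ℝ] ℝ)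
    (mfderiv (𝓡 n) (𝓡 n) e (e.symm y) (coordVector e y j)) = _
  rw [h2]
  simp

/-- The tensor field with given components in the chart `e`. -/
def ofComponents (e : OpenPartialHomeomorph M (EuclideanSpace ℝ (Fin n))) (A : Components n k) :
    TensorField n M k := fun q =>
  ∑ w : Fin k → Fin n, A (e q) w •
    (MultilinearMap.mkPiAlgebra ℝ (Fin k) ℝ).compLinearMap fun s => coordForm e q (w s)

/-- The coordinate differentials are dual to the coordinate vectors over the chart's target, so a
single summand survives. -/
lemma components_ofComponents (he : e.MDifferentiable (𝓡 n) (𝓡 n)) (A : Components n k)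
    {y : Coord n} (hy : y ∈ e.target) : components e (ofComponents e A) y = A y := by
  ext v
  have h1 : ∀ w : Fin k → Fin n, ∏ s, coordForm e (e.symm y) (w s) (coordVector e y (v s)) =
      if w = v then 1 else 0 := fun w => by
    simp only [coordForm_coordVector he hy]
    rw [Finset.prod_ite_zero]
    simp [funext_iff]
  simp only [components, ofComponents, sum_apply, smul_apply,
    MultilinearMap.compLinearMap_apply, MultilinearMap.mkPiAlgebra_apply, h1, e.right_inv hy]
  simp

lemma isMetricOn_components (he : e.MDifferentiable (𝓡 n) (𝓡 n)) {g : TensorField n M 2}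
    (hg : ∀ p, IsScalarProduct (g p)) (hg' : AnalyticInChart e g Set.univ) :
    IsMetricOn (components e g) e.target where
  isOpen := e.open_target
  analytic v := by simpa using hg' v
  symm y hy i j := by
    rw [← basisComponents_coordBasis he hy, basisComponents_two, basisComponents_two,
      (hg _).symm]
  isUnit_det y hy := by
    have h := isUnit_det_gram _ (hg (e.symm y)) (coordBasis he hy)
    simpa only [← basisComponents_two, basisComponents_coordBasis] using h

/-- The covariant derivative depends only on the germ, so fields may be replaced by arrays that
agree with them only on an open set. -/
lemma covDeriv_congr {G : Components n 2} {V : Set (Coord n)} (hV : IsOpen V)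
    {T S : Components n k} (h : ∀ x ∈ V, T x = S x) {y : Coord n} (hy : y ∈ V) :
    covDeriv G T y = covDeriv G S y := by
  ext v
  rw [covDeriv_eq, covDeriv_eq, dirDeriv_congr hV h hy]

lemma covDeriv_covDeriv_congr {G : Components n 2} {V : Set (Coord n)} (hV : IsOpen V)
    {T S : Components n k} (h : ∀ x ∈ V, T x = S x) {y : Coord n} (hy : y ∈ V) :
    covDeriv G (covDeriv G T) y = covDeriv G (covDeriv G S) y :=
  covDeriv_congr hV (fun _ hx => covDeriv_congr hV h hx) hy

end Transfer

end WeylPotential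

end

open WeylPotential

theorem mainTheorem1 (n : ℕ) (hn : 4 ≤ n)
    (M : Type*) [TopologicalSpace M] [ChartedSpace (EuclideanSpace ℝ (Fin n)) M]
    [IsManifold (𝓡 n) ω M]
    (g : WeylPotential.TensorField n M 2)
    (hg : WeylPotential.IsAnalyticPseudoRiemannianMetric g)
    (W : WeylPotential.TensorField n M 4)
    (hW : ∀ p, WeylPotential.IsWeylCandidate n (g p) (W p))
    (hW_analytic : WeylPotential.IsAnalyticTensorField W)
    (e : OpenPartialHomeomorph M (EuclideanSpace ℝ (Fin n)))
    (he : e ∈ IsManifold.maximalAtlas (𝓡 n) ω M) (p : M) (hp : p ∈ e.source) :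
    ∃ U : Set M, IsOpen U ∧ p ∈ U ∧ U ⊆ e.source ∧
      ∃ (P : WeylPotential.TensorField n M 5) (X : WeylPotential.TensorField n M 4),
        WeylPotential.AnalyticInChart e P U ∧ WeylPotential.AnalyticInChart e X U ∧
        (∀ q ∈ U, WeylPotential.IsWeylPotentialForm n (g q) (P q)) ∧
        (∀ q ∈ U, WeylPotential.IsWeylCandidate n (g q) (X q)) ∧
        (∀ q ∈ U, ∀ a b c d : Fin n,
          WeylPotential.components e W (e q) ![a, b, c, d] =
            WeylPotential.weylOfPotential (WeylPotential.components e g)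
              (WeylPotential.components e P) a b c d (e q)) ∧
        (∀ q ∈ U, ∀ a b c d f : Fin n,
          WeylPotential.components e P (e q) ![a, b, c, d, f] =
            WeylPotential.potentialOfSuperpotential (WeylPotential.components e g)
              (WeylPotential.components e X) a b c d f (e q)) ∧
        (∀ q ∈ U, ∀ a b c d : Fin n,
          WeylPotential.laplacian (WeylPotential.components e g)
              (WeylPotential.components e X) (e q) ![a, b, c, d]
            - WeylPotential.curvatureTerm (WeylPotential.components e g)
              (WeylPotential.components e X) a b c d (e q) =
          WeylPotential.components e W (e q) ![a, b, c, d]) := by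
  have hd := mdifferentiable_of_mem_maximalAtlas he
  have hG := isMetricOn_components hd hg.isScalarProduct (hg.analytic e he)
  have hWa : AnalyticField (components e W) e.target := fun v => by
    simpa using hW_analytic e he v
  have hWw : ∀ y ∈ e.target, IsWeylArray (invMetric (components e g) y) (components e W y) :=
    fun y hy => by
      rw [← invGram_coordBasis hd hy, ← basisComponents_coordBasis hd hy]
      exact isWeylArray_of_isWeylCandidate _ (hW _)
  obtain ⟨X₀, V, hVo, hpV, hVt, hX₀, hX₀w, hsol⟩ :=
    hG.exists_superpotential hn hWa hWw (e.map_source hp)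
  have hGV := hG.mono hVo hVt
  -- The arrays are made into tensor fields on all of M; only their values over V are controlled,
  -- and U is the part of the chart domain lying over V.
  set X := ofComponents e X₀ with hX_def
  set P := ofComponents e (potentialArray (components e g) X₀) with hP_def
  have hX : ∀ y ∈ V, components e X y = X₀ y := fun y hy =>
    components_ofComponents hd X₀ (hVt hy)
  have hP : ∀ y ∈ V, components e P y = potentialArray (components e g) X₀ y := fun y hy =>
    components_ofComponents hd _ (hVt hy)
  have hanal : ∀ {k : ℕ} {T : TensorField n M k} {A : Components n k}, AnalyticField A V →
      (∀ y ∈ V, components e T y = A y) → AnalyticInChart e T (e.source ∩ e ⁻¹' V) :=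
    fun {k T A} hA hT v y hy => by
      have hyV : y ∈ V := by simpa [e.right_inv hy.1] using hy.2.2
      refine (hA v y hyV).congr ?_
      exact Filter.eventuallyEq_of_mem (hVo.mem_nhds hyV) fun x hx => (congrFun (hT x hx) v).symm
  have hpoint : ∀ {F : M → Prop}, (∀ y ∈ V, F (e.symm y)) → ∀ q ∈ e.source ∩ e ⁻¹' V, F q :=
    fun {F} h q hq => e.left_inv hq.1 ▸ h (e q) hq.2
  refine ⟨e.source ∩ e ⁻¹' V, e.isOpen_inter_preimage hVo, ⟨hp, hpV⟩, Set.inter_subset_left, P, X,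
    hanal (hGV.analyticField_potentialArray hX₀) hP, hanal hX₀ hX,
    hpoint (F := fun q => IsWeylPotentialForm n (g q) (P q)) fun y hy => ?_,
    hpoint (F := fun q => IsWeylCandidate n (g q) (X q)) fun y hy => ?_,
    fun q hq a b c d => ?_, fun q hq a b c d f => ?_, fun q hq a b c d => ?_⟩
  · refine isWeylPotentialForm_of_isPotentialArray (coordBasis hd (hVt hy)) ?_
    rw [invGram_coordBasis, basisComponents_coordBasis, hP y hy]
    exact hGV.isPotentialArray_potentialArray hn hX₀ hX₀w hy
  · refine isWeylCandidate_of_isWeylArray (coordBasis hd (hVt hy)) ?_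
    rw [invGram_coordBasis, basisComponents_coordBasis, hX y hy]
    exact hX₀w y hy
  · have h1 : weylOfPotential (components e g) (components e P) a b c d (e q) =
        weylOfPotential (components e g) (potentialArray (components e g) X₀) a b c d (e q) := by
      simp only [weylOfPotential, covDeriv_congr hVo hP hq.2]
    rw [h1, hGV.weylOfPotential_eq hn hX₀ hX₀w hq.2, hsol _ hq.2, Pi.add_apply]
    ring
  · have h1 : potentialOfSuperpotential (components e g) (components e X) a b c d f (e q) =
        potentialOfSuperpotential (components e g) X₀ a b c d f (e q) := by
      simp only [potentialOfSuperpotential, covDeriv_congr hVo hX hq.2]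
    rw [h1, hP _ hq.2, hGV.potentialOfSuperpotential_eq hn hX₀ hX₀w hq.2]
  · have h1 : laplacian (components e g) (components e X) (e q) =
        laplacian (components e g) X₀ (e q) := by
      ext v
      simp only [laplacian, covDeriv_covDeriv_congr hVo hX hq.2]
    have hXw : IsWeylArray (invMetric (components e g) (e q)) (components e X (e q)) := by
      rw [hX _ hq.2]
      exact hX₀w _ hq.2
    rw [h1, hGV.curvatureTerm_eq hq.2 hXw, hsol _ hq.2, hX _ hq.2, Pi.add_apply]
    ring
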